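/- Fix a nonzero *real* number $i$. Let $U$ be an open subset of the jet space $J^1=\mathbb R^3$ with coordinates $(x,y,p)$ and let $Q:U\to\mathbb R$ be smooth. The equation $y''=Q(x,y,y')$ is represented by the real 1-forms $$\lambda=-i(dy-p\,dx),\qquad \mu=dp-Q\,dx,\qquad \bar\mu=dx ,$$ given up to $\lambda\to A\lambda$, $\mu\to B\mu+C\lambda$, $\bar\mu\to\bar B\bar\mu+\bar C\lambda$ with real functions, $AB\bar B\ne0$. (A bar only distinguishes names; barred and unbarred objects are independent and real.) A smooth map $\varphi:U'\to U$ is a point equivalence from $y''=Q'(x,y,y')$ on $U'$ to $y''=Q(x,y,y')$ on $U$ if $\varphi^*\lambda=A\lambda'$, $\varphi^*\mu=B\mu'+C\lambda'$, $\varphi^*\bar\mu=\bar B\bar\mu'+\bar C\lambda'$ with functions such that $AB\bar B\neq0$; it is then a local diffeomorphism. A *Cartan coframe* over $(U,Q)$ is an 8-dimensional manifold $P$ (all considerations are local: an open subset of $\mathbb R^8$) with a smooth map $\pi:P\to U$, smooth functions $a,b,\bar b,c,\bar c,\mathcal R,\bar{\mathcal R},\mathcal S,\bar{\mathcal S}$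 on $P$ with $ab\bar b\ne0$, and smooth real 1-forms $\theta^1,\theta^2,\theta^3,\Omega_2,\bar\Omega_2,\Omega_3,\bar\Omega_3,\Omega_4$, linearly independent at every point, such that $$\theta^1=b\,\pi^*\mu+c\,\pi^*\lambda,\quad \theta^2=\bar b\,\pi^*\bar\mu+\bar c\,\pi^*\lambda,\quad \theta^3=a\,\pi^*\lambda,$$ $$\begin{aligned} d\theta^1&=\Omega_2\wedge\theta^1+\Omega_3\wedge\theta^3,\\ d\theta^2&=\bar\Omega_2\wedge\theta^2+\bar\Omega_3\wedge\theta^3,\\ d\theta^3&=i\theta^1\wedge\theta^2+(\Omega_2+\bar\Omega_2)\wedge\theta^3,\\ d\Omega_2&=2i\theta^1\wedge\bar\Omega_3+i\theta^2\wedge\Omega_3+\Omega_4\wedge\theta^3,\\ d\bar\Omega_2&=-2i\theta^2\wedge\Omega_3-i\theta^1\wedge\bar\Omega_3+\Omega_4\wedge\theta^3,\\ d\Omega_3&=\Omega_4\wedge\theta^1+\Omega_3\wedge\bar\Omega_2+\mathcal R\,\theta^2\wedge\theta^3,\\ d\bar\Omega_3&=\Omega_4\wedge\theta^2+\bar\Omega_3\wedge\Omega_2+\bar{\mathcal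 R}\,\theta^1\wedge\theta^3,\\ d\Omega_4&=i\Omega_3\wedge\bar\Omega_3+\Omega_4\wedge(\Omega_2+\bar\Omega_2)+\bar{\mathcal S}\,\theta^1\wedge\theta^3+\mathcal S\,\theta^2\wedge\theta^3 . \end{aligned}$$ **Theorem.** To all $U$ and $Q$ as above one can assign a Cartan coframe $P=P(U,Q)$ over $(U,Q)$ such that the following hold. 1. There are smooth functions $\mathcal R_2,\bar{\mathcal R}_2,\mathcal R_3,\bar{\mathcal R}_3,\mathcal S_1,\bar{\mathcal S}_1,\mathcal S_2,\bar{\mathcal S}_2,\mathcal S_3,\bar{\mathcal S}_3$ on $P$ with $\mathcal S_1=\bar{\mathcal S}_1$ and $$\begin{aligned} d\mathcal R&=-\mathcal R(\Omega_2+3\bar\Omega_2)-\mathcal S\theta^1+\mathcal R_2\theta^2+\mathcal R_3\theta^3,\\ d\bar{\mathcal R}&=-\bar{\mathcal R}(\bar\Omega_2+3\Omega_2)-\bar{\mathcal S}\theta^2+\bar{\mathcal R}_2\theta^1+\bar{\mathcal R}_3\theta^3,\\ d\mathcal S&=-\mathcal S(2\Omega_2+3\bar\Omega_2)-i\mathcal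 R\bar\Omega_3+\mathcal S_1\theta^1+\mathcal S_2\theta^2+\mathcal S_3\theta^3,\\ d\bar{\mathcal S}&=-\bar{\mathcal S}(2\bar\Omega_2+3\Omega_2)+i\bar{\mathcal R}\Omega_3+\bar{\mathcal S}_2\theta^1+\bar{\mathcal S}_1\theta^2+\bar{\mathcal S}_3\theta^3 . \end{aligned}$$ 2. Let $H\subset SL(3,\mathbb R)$ be the group of upper triangular matrices. There is a smooth right action of $H$ on $P$ for which $\pi:P\to U$ is surjective and a principal $H$-bundle, and $$\omega=\begin{pmatrix}\frac13(2\Omega_2+\bar\Omega_2)&i\bar\Omega_3&-\frac12\Omega_4\\ \theta^1&\frac13(\bar\Omega_2-\Omega_2)&-\frac12\Omega_3\\ 2\theta^3&2i\theta^2&-\frac13(2\bar\Omega_2+\Omega_2)\end{pmatrix}$$ is an $\mathfrak{sl}(3,\mathbb R)$-valued Cartan connection on it, i.e. $\omega_u:T_uP\to\mathfrak{sl}(3,\mathbb R)$ is bijective for all $u\in P$, $R_h^*\omega=h^{-1}\omega h$ for $h\in H$, and $\omega(M^*)=M$ for the fundamental vector field $M^*$ of every $M$ in the Lie algebra of $H$.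 Its curvature is $$d\omega+\omega\wedge\omega=\begin{pmatrix}0&i\bar{\mathcal R}\theta^1\wedge\theta^3&-\frac12\bar{\mathcal S}\theta^1\wedge\theta^3-\frac12\mathcal S\theta^2\wedge\theta^3\\0&0&-\frac12\mathcal R\theta^2\wedge\theta^3\\0&0&0\end{pmatrix}.$$ 3. (Uniqueness.) If $\varphi:U'\to U$ is a point equivalence from $(U',Q')$ to $(U,Q)$ and $Y$ is any Cartan coframe over $(U',Q')$, there is exactly one smooth map $\Phi:Y\to P(U,Q)$ that covers $\varphi$ and pulls the eight 1-forms and the functions $\mathcal R,\bar{\mathcal R},\mathcal S,\bar{\mathcal S}$ of $P(U,Q)$ back to those of $Y$ (so $\Phi$ is a local diffeomorphism). If $\varphi$ is a diffeomorphism of $U'$ onto $U$ and $Y=P(U',Q')$, then $\Phi$ is a diffeomorphism of $P(U',Q')$ onto $P(U,Q)$. 4. (Coordinates.) Put $D=\partial_x+p\partial_y+Q\partial_p$ and $$w_1=D^2Q_{pp}-4DQ_{py}-DQ_{pp}\,Q_p+4Q_pQ_{py}-3Q_{pp}Q_y+6Q_{yy},\qquad w_2=Q_{pppp}.$$ The functions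 $x,y,p$ extend to coordinates $(x,y,p,\rho,\phi,\gamma,\bar\gamma,r)$, with $(x,y,p)\in U$, $\rho\ne0$ and the others arbitrary, on the open set $\{b\bar b>0\}\subset P$, in which $$\theta^1=\rho e^{i\phi}(\mu+\gamma\lambda),\qquad\theta^2=\rho e^{-i\phi}(\bar\mu+\bar\gamma\lambda),\qquad\theta^3=\rho^2\lambda,$$ $$\begin{aligned} \Omega_2={}&i\,d\phi+\tfrac{d\rho}{\rho}+\tfrac1{4i\rho^2}\big[6\gamma\bar\gamma i^2-6\bar\gamma iQ_p-Q_{pp}-4ir\rho\big]\theta^3-\tfrac{2i\bar\gamma}{\rho}e^{-i\phi}\theta^1-\tfrac{e^{i\phi}}{\rho}(i\gamma-Q_p)\theta^2,\\ \bar\Omega_2={}&-i\,d\phi+\tfrac{d\rho}{\rho}-\tfrac1{4i\rho^2}\big[6\gamma\bar\gamma i^2-2\bar\gamma iQ_p-Q_{pp}+4ir\rho\big]\theta^3+\tfrac{i\bar\gamma}{\rho}e^{-i\phi}\theta^1+\tfrac{e^{i\phi}}{\rho}(2i\gamma-Q_p)\theta^2,\\ \Omega_3={}&\tfrac{e^{i\phi}}{\rho}\Big[d\gamma-\tfrac1{6i^2\rho^2}\big(DQ_{pp}+6\gamma^2\bar\gamma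 i^3-6\gamma\bar\gamma i^2Q_p-3\gamma iQ_{pp}-4Q_{py}-6\bar\gamma iQ_y\big)\theta^3\\ &+\tfrac{e^{-i\phi}}{4i\rho}\big(2\gamma\bar\gamma i^2-2\bar\gamma iQ_p-Q_{pp}-4ir\rho\big)\theta^1+\tfrac{e^{i\phi}}{i\rho}\big(\gamma^2i^2-\gamma iQ_p-Q_y\big)\theta^2\Big],\\ \bar\Omega_3={}&\tfrac{e^{-i\phi}}{\rho}\Big[d\bar\gamma+\tfrac1{6i^2\rho^2}\big(6\gamma\bar\gamma^2i^3-6\bar\gamma^2i^2Q_p-3\bar\gamma iQ_{pp}-Q_{ppp}\big)\theta^3-\tfrac{e^{-i\phi}}{\rho}\bar\gamma^2i\,\theta^1\\ &-\tfrac{e^{i\phi}}{4i\rho}\big(2\gamma\bar\gamma i^2-2\bar\gamma iQ_p-Q_{pp}+4ir\rho\big)\theta^2\Big],\\ \Omega_4={}&-\tfrac{i}{2\rho^2}\bar\gamma\,d\gamma+\tfrac1{2\rho^2}(i\gamma-Q_p)\,d\bar\gamma-\tfrac{dr}{\rho}-\tfrac{r\,d\rho}{\rho^2}\\ &+\tfrac1{48i^2\rho^4}\big[8DQ_{ppp}-3Q_{pp}^2+8Q_pQ_{ppp}-12Q_{ppy}-12\gamma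 iQ_{ppp}+\bar\gamma(12iDQ_{pp}-24iQ_{py})-12\gamma\bar\gamma i^2Q_{pp}\\ &\quad+\bar\gamma^2(24i^2DQ_p+12i^2Q_p^2-48i^2Q_y)-48i^3\gamma\bar\gamma^2Q_p+36\gamma^2\bar\gamma^2i^4+48\bar\gamma r\rho i^2Q_p+48i^2\rho^2r^2\big]\theta^3\\ &-\tfrac{e^{-i\phi}}{12i\rho^3}\big[6\gamma\bar\gamma^2i^3-6\bar\gamma^2i^2Q_p+3\bar\gamma iQ_{pp}-Q_{ppp}-12\bar\gamma i^2r\rho\big]\theta^1\\ &-\tfrac{e^{i\phi}}{12i\rho^3}\big[DQ_{pp}-4Q_{py}-3i\gamma Q_{pp}+6i\bar\gamma(DQ_p-2Q_y)-6i^2\gamma\bar\gamma Q_p+6\gamma^2\bar\gamma i^3+12\gamma i^2r\rho\big]\theta^2, \end{aligned}$$ $$\mathcal R=-\frac{e^{2i\phi}}{6i^2\rho^4}w_1,\qquad \mathcal S=\frac{e^{i\phi}}{6i^2\rho^5}\big[\partial_pw_1+i\bar\gamma w_1\big],$$ $$\bar{\mathcal R}=-\frac{e^{-2i\phi}}{6i^2\rho^4}w_2,\qquad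 \bar{\mathcal S}=\frac{e^{-i\phi}}{6i^2\rho^5}\big[Dw_2+(2Q_p-i\gamma)w_2\big].$$ On all of $P$ one has $\mathcal R=-\dfrac{w_1}{6i^2\,b\,\bar b^3}$ and $\bar{\mathcal R}=-\dfrac{w_2}{6i^2\,b^3\,\bar b}$. -/

import Mathlib

open Set
open scoped ContDiff

noncomputable section

namespace PointODE

/-! ### Differential forms on coordinate spaces -/

/-- The first jet space, with coordinates `(x, y, p) = (z 0, z 1, z 2)`. -/
abbrev J1 := Fin 3 → ℝ

/-- The 8-dimensional coordinate space. -/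
abbrev R8 := Fin 8 → ℝ

/-- The value at a point of the exterior derivative of a 1-form (Mathlib's `extDeriv`), as a
function of two tangent vectors. -/
def d {E : Type*} [NormedAddCommGroup E] [NormedSpace ℝ E]
    (α : E → E →L[ℝ] ℝ) (u : E) : E → E → ℝ :=
  fun v w => extDeriv (fun u => ContinuousAlternatingMap.ofSubsingleton ℝ E ℝ (0 : Fin 1) (α u))
    u ![v, w]

/-- The wedge product of two covectors, as a function of two tangent vectors. -/
def wedge {E : Type*} [NormedAddCommGroup E] [NormedSpace ℝ E]
    (α β : E →L[ℝ] ℝ) : E → E → ℝ :=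
  fun v w => α v * β w - α w * β v

infixl:75 " ⋏ " => wedge

/-- The pull-back at `u` of a 1-form `α` by a map `f`. -/
def pull {E F : Type*} [NormedAddCommGroup E] [NormedSpace ℝ E]
    [NormedAddCommGroup F] [NormedSpace ℝ F]
    (f : E → F) (α : F → F →L[ℝ] ℝ) (u : E) : E →L[ℝ] ℝ :=
  (α (f u)).comp (fderiv ℝ f u)

/-- `f` restricts to a smooth diffeomorphism of `A` onto `B` (for open sets `A`, `B`). -/
def IsDiffeoOn {E F : Type*} [NormedAddCommGroup E] [NormedSpace ℝ E]
    [NormedAddCommGroup F] [NormedSpace ℝ F] (f : E → F) (A : Set E) (B : Set F) : Prop :=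
  ContDiffOn ℝ ∞ f A ∧ MapsTo f A B ∧
    ∃ g : F → E, ContDiffOn ℝ ∞ g B ∧ MapsTo g B A ∧ InvOn g f A B

/-! ### Second order ODEs and point equivalence

Throughout, `i` is a nonzero *real* number. -/

/-- `λ = -i (dy - p dx)`. -/
def lam (i : ℝ) (z : J1) : J1 →L[ℝ] ℝ :=
  (-i) • (ContinuousLinearMap.proj 1 - z 2 • ContinuousLinearMap.proj 0)

/-- `μ = dp - Q dx`. -/
def mu (Q : J1 → ℝ) (z : J1) : J1 →L[ℝ] ℝ :=
  ContinuousLinearMap.proj 2 - Q z • ContinuousLinearMap.proj 0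

/-- `μ̄ = dx`. -/
def mub (_ : J1) : J1 →L[ℝ] ℝ := ContinuousLinearMap.proj 0

/-- `φ` is a smooth map from `U'` to `U` which carries the equation `y'' = Q' (x, y, y')` on `U'`
to the equation `y'' = Q (x, y, y')` on `U`: it pulls `λ, μ, μ̄` back to
`A λ', B μ' + C λ', B̄ μ̄' + C̄ λ'` with `A B B̄ ≠ 0`. Such a map is a local diffeomorphism. -/
def IsPointMap (i : ℝ) (U' : Set J1) (Q' : J1 → ℝ) (U : Set J1) (Q : J1 → ℝ)
    (φ : J1 → J1) : Prop :=
  ContDiffOn ℝ ∞ φ U' ∧ MapsTo φ U' U ∧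
    ∃ A B Bb C Cb : J1 → ℝ, ∀ z ∈ U', A z ≠ 0 ∧ B z ≠ 0 ∧ Bb z ≠ 0 ∧
      pull φ (lam i) z = A z • lam i z ∧
      pull φ (mu Q) z = B z • mu Q' z + C z • lam i z ∧
      pull φ mub z = Bb z • mub z + Cb z • lam i z

/-! ### The bundle, the coframe and the structure equations -/

/-- An 8-dimensional manifold `P` (a subset of `R8`) with a projection `π` to the jet space, the
functions `a, b, b̄, c, c̄`, the 1-forms `θ¹, θ², θ³, Ω₂, Ω̄₂, Ω₃, Ω̄₃, Ω₄` and the functions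
`R, R̄, S, S̄`. -/
structure CartanData where
  P : Set R8
  π : R8 → J1
  (a b bb c cb : R8 → ℝ)
  (θ₁ θ₂ θ₃ Ω₂ Ω₂b Ω₃ Ω₃b Ω₄ : R8 → R8 →L[ℝ] ℝ)
  (R Rb S Sb : R8 → ℝ)

/-- `X` is an 8-manifold over `U`, with a coframe that extends the forms
`θ¹ = b μ + c λ`, `θ² = b̄ μ̄ + c̄ λ`, `θ³ = a λ` of the equation `y'' = Q (x, y, y')` and satisfies
the structure equations. -/
structure IsCartanCoframe (i : ℝ) (U : Set J1) (Q : J1 → ℝ) (X : CartanData) : Prop where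
  isOpen : IsOpen X.P
  smooth_proj : ContDiffOn ℝ ∞ X.π X.P
  mapsTo : MapsTo X.π X.P U
  smooth_fun : ∀ f ∈ [X.a, X.b, X.bb, X.c, X.cb, X.R, X.Rb, X.S, X.Sb], ContDiffOn ℝ ∞ f X.P
  smooth_form : ∀ α ∈ [X.θ₁, X.θ₂, X.θ₃, X.Ω₂, X.Ω₂b, X.Ω₃, X.Ω₃b, X.Ω₄], ContDiffOn ℝ ∞ α X.P
  ne_zero : ∀ u ∈ X.P, X.a u ≠ 0 ∧ X.b u ≠ 0 ∧ X.bb u ≠ 0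
  θ₁_eq : ∀ u ∈ X.P, X.θ₁ u = X.b u • pull X.π (mu Q) u + X.c u • pull X.π (lam i) u
  θ₂_eq : ∀ u ∈ X.P, X.θ₂ u = X.bb u • pull X.π mub u + X.cb u • pull X.π (lam i) u
  θ₃_eq : ∀ u ∈ X.P, X.θ₃ u = X.a u • pull X.π (lam i) u
  coframe : ∀ u ∈ X.P, LinearIndependent ℝ
    ![X.θ₁ u, X.θ₂ u, X.θ₃ u, X.Ω₂ u, X.Ω₂b u, X.Ω₃ u, X.Ω₃b u, X.Ω₄ u]
  d_θ₁ : ∀ u ∈ X.P, d X.θ₁ u = X.Ω₂ u ⋏ X.θ₁ u + X.Ω₃ u ⋏ X.θ₃ u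
  d_θ₂ : ∀ u ∈ X.P, d X.θ₂ u = X.Ω₂b u ⋏ X.θ₂ u + X.Ω₃b u ⋏ X.θ₃ u
  d_θ₃ : ∀ u ∈ X.P, d X.θ₃ u = i • (X.θ₁ u ⋏ X.θ₂ u) + (X.Ω₂ u + X.Ω₂b u) ⋏ X.θ₃ u
  d_Ω₂ : ∀ u ∈ X.P, d X.Ω₂ u =
    (2 * i) • (X.θ₁ u ⋏ X.Ω₃b u) + i • (X.θ₂ u ⋏ X.Ω₃ u) + X.Ω₄ u ⋏ X.θ₃ u
  d_Ω₂b : ∀ u ∈ X.P, d X.Ω₂b u =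
    (-(2 * i)) • (X.θ₂ u ⋏ X.Ω₃ u) - i • (X.θ₁ u ⋏ X.Ω₃b u) + X.Ω₄ u ⋏ X.θ₃ u
  d_Ω₃ : ∀ u ∈ X.P, d X.Ω₃ u =
    X.Ω₄ u ⋏ X.θ₁ u + X.Ω₃ u ⋏ X.Ω₂b u + X.R u • (X.θ₂ u ⋏ X.θ₃ u)
  d_Ω₃b : ∀ u ∈ X.P, d X.Ω₃b u =
    X.Ω₄ u ⋏ X.θ₂ u + X.Ω₃b u ⋏ X.Ω₂ u + X.Rb u • (X.θ₁ u ⋏ X.θ₃ u)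
  d_Ω₄ : ∀ u ∈ X.P, d X.Ω₄ u =
    i • (X.Ω₃ u ⋏ X.Ω₃b u) + X.Ω₄ u ⋏ (X.Ω₂ u + X.Ω₂b u)
      + X.Sb u • (X.θ₁ u ⋏ X.θ₃ u) + X.S u • (X.θ₂ u ⋏ X.θ₃ u)

/-- The equations for the differentials of `R, R̄, S, S̄`, with smooth coefficient functions
`R₂, R̄₂, R₃, R̄₃, S₁, S̄₁, S₂, S̄₂, S₃, S̄₃` on `P` such that `S₁ = S̄₁`. -/
def InvariantEquations (i : ℝ) (X : CartanData) : Prop :=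
  ∃ R₂ R₂b R₃ R₃b S₁ S₁b S₂ S₂b S₃ S₃b : R8 → ℝ,
    (∀ f ∈ [R₂, R₂b, R₃, R₃b, S₁, S₁b, S₂, S₂b, S₃, S₃b], ContDiffOn ℝ ∞ f X.P) ∧
    ∀ u ∈ X.P,
      fderiv ℝ X.R u = -(X.R u • (X.Ω₂ u + (3 : ℝ) • X.Ω₂b u)) - X.S u • X.θ₁ u
        + R₂ u • X.θ₂ u + R₃ u • X.θ₃ u ∧
      fderiv ℝ X.Rb u = -(X.Rb u • (X.Ω₂b u + (3 : ℝ) • X.Ω₂ u)) - X.Sb u • X.θ₂ u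
        + R₂b u • X.θ₁ u + R₃b u • X.θ₃ u ∧
      fderiv ℝ X.S u = -(X.S u • ((2 : ℝ) • X.Ω₂ u + (3 : ℝ) • X.Ω₂b u))
        - (i * X.R u) • X.Ω₃b u + S₁ u • X.θ₁ u + S₂ u • X.θ₂ u + S₃ u • X.θ₃ u ∧
      fderiv ℝ X.Sb u = -(X.Sb u • ((2 : ℝ) • X.Ω₂b u + (3 : ℝ) • X.Ω₂ u))
        + (i * X.Rb u) • X.Ω₃ u + S₂b u • X.θ₁ u + S₁b u • X.θ₂ u + S₃b u • X.θ₃ u ∧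
      S₁ u = S₁b u

/-- `Φ : P_Y → P_X` is smooth, covers `φ`, and pulls the forms and functions of `X` back to those
of `Y`. (If the forms are coframes, such a map is a local diffeomorphism.) -/
structure IsMorphism (Y X : CartanData) (φ : J1 → J1) (Φ : R8 → R8) : Prop where
  smooth : ContDiffOn ℝ ∞ Φ Y.P
  mapsTo : MapsTo Φ Y.P X.P
  proj : ∀ u ∈ Y.P, X.π (Φ u) = φ (Y.π u)
  θ₁ : ∀ u ∈ Y.P, pull Φ X.θ₁ u = Y.θ₁ u
  θ₂ : ∀ u ∈ Y.P, pull Φ X.θ₂ u = Y.θ₂ u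
  θ₃ : ∀ u ∈ Y.P, pull Φ X.θ₃ u = Y.θ₃ u
  Ω₂ : ∀ u ∈ Y.P, pull Φ X.Ω₂ u = Y.Ω₂ u
  Ω₂b : ∀ u ∈ Y.P, pull Φ X.Ω₂b u = Y.Ω₂b u
  Ω₃ : ∀ u ∈ Y.P, pull Φ X.Ω₃ u = Y.Ω₃ u
  Ω₃b : ∀ u ∈ Y.P, pull Φ X.Ω₃b u = Y.Ω₃b u
  Ω₄ : ∀ u ∈ Y.P, pull Φ X.Ω₄ u = Y.Ω₄ u
  R : ∀ u ∈ Y.P, X.R (Φ u) = Y.R u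
  Rb : ∀ u ∈ Y.P, X.Rb (Φ u) = Y.Rb u
  S : ∀ u ∈ Y.P, X.S (Φ u) = Y.S u
  Sb : ∀ u ∈ Y.P, X.Sb (Φ u) = Y.Sb u

/-! ### The `sl(3, ℝ)` Cartan connection -/

/-- The group of upper triangular matrices of determinant one, as a set of matrices. -/
def upperSL3 : Set (Matrix (Fin 3) (Fin 3) ℝ) :=
  {h | h.det = 1 ∧ ∀ j k, k < j → h j k = 0}

/-- The matrix of 1-forms built from the coframe, at a point. -/
def connForm (i : ℝ) (X : CartanData) (u : R8) : Matrix (Fin 3) (Fin 3) (R8 →L[ℝ] ℝ) :=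
  !![(1 / 3 : ℝ) • ((2 : ℝ) • X.Ω₂ u + X.Ω₂b u), i • X.Ω₃b u, (-1 / 2 : ℝ) • X.Ω₄ u;
     X.θ₁ u, (1 / 3 : ℝ) • (X.Ω₂b u - X.Ω₂ u), (-1 / 2 : ℝ) • X.Ω₃ u;
     (2 : ℝ) • X.θ₃ u, (2 * i) • X.θ₂ u, (-1 / 3 : ℝ) • ((2 : ℝ) • X.Ω₂b u + X.Ω₂ u)]

/-- The value of the matrix of 1-forms on a tangent vector. -/
def conn (i : ℝ) (X : CartanData) (u v : R8) : Matrix (Fin 3) (Fin 3) ℝ :=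
  (connForm i X u).map (fun α => α v)

/-- The curvature `dω + ω ∧ ω` at a point, as a matrix of 2-forms. -/
def curvature (i : ℝ) (X : CartanData) (u : R8) : Matrix (Fin 3) (Fin 3) (R8 → R8 → ℝ) :=
  fun j k => d (fun u => connForm i X u j k) u
    + ∑ l : Fin 3, (connForm i X u j l ⋏ connForm i X u l k)

open scoped Matrix.Norms.Elementwise in
/-- `π : P → U` is a principal bundle, for a smooth right action of the group `H` of upper
triangular matrices in `SL(3, ℝ)`, and the matrix `ω` of 1-forms is an `sl(3, ℝ)`-valued Cartan
connection on it: `ω` identifies every tangent space of `P` with `sl(3, ℝ)`, is `H`-equivariant,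
and reproduces the generators of the fundamental vector fields. -/
def IsCartanConnection (i : ℝ) (U : Set J1) (X : CartanData) : Prop :=
  X.π '' X.P = U ∧
  (∀ u ∈ X.P, BijOn (conn i X u) univ {M | M.trace = 0}) ∧
  ∃ act : R8 → Matrix (Fin 3) (Fin 3) ℝ → R8,
    ContDiffOn ℝ ∞ (fun q : R8 × Matrix (Fin 3) (Fin 3) ℝ => act q.1 q.2) (X.P ×ˢ upperSL3) ∧
    (∀ u ∈ X.P, ∀ h ∈ upperSL3, act u h ∈ X.P ∧ X.π (act u h) = X.π u) ∧
    (∀ u ∈ X.P, act u 1 = u) ∧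
    (∀ u ∈ X.P, ∀ g ∈ upperSL3, ∀ h ∈ upperSL3, act (act u g) h = act u (g * h)) ∧
    (∀ u ∈ X.P, ∀ v ∈ X.P, X.π u = X.π v → ∃! h, h ∈ upperSL3 ∧ act u h = v) ∧
    (∀ u ∈ X.P, ∀ h ∈ upperSL3, ∀ v : R8,
      conn i X (act u h) (fderiv ℝ (fun u => act u h) u v) = h⁻¹ * conn i X u v * h) ∧
    (∀ u ∈ X.P, ∀ M : Matrix (Fin 3) (Fin 3) ℝ, M.trace = 0 → (∀ j k, k < j → M j k = 0) →
      ∃ V : R8, HasDerivAt (fun t : ℝ => act u (NormedSpace.exp (t • M))) V 0 ∧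
        conn i X u V = M)

/-! ### The coordinate formulas -/

/-- Partial derivative with respect to the `k`-th coordinate of the jet space. -/
def pd (k : Fin 3) (f : J1 → ℝ) (z : J1) : ℝ := fderiv ℝ f z (Pi.single k 1)

/-- The total derivative `D = ∂_x + p ∂_y + Q ∂_p`. -/
def tot (Q f : J1 → ℝ) (z : J1) : ℝ := pd 0 f z + z 2 * pd 1 f z + Q z * pd 2 f z

/-- The relative invariant
`w₁ = D²Q_pp - 4 DQ_py - DQ_pp Q_p + 4 Q_p Q_py - 3 Q_pp Q_y + 6 Q_yy`. -/
def w₁ (Q : J1 → ℝ) (z : J1) : ℝ :=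
  tot Q (tot Q (pd 2 (pd 2 Q))) z - 4 * tot Q (pd 1 (pd 2 Q)) z
    - tot Q (pd 2 (pd 2 Q)) z * pd 2 Q z + 4 * pd 2 Q z * pd 1 (pd 2 Q) z
    - 3 * pd 2 (pd 2 Q) z * pd 1 Q z + 6 * pd 1 (pd 1 Q) z

/-- The relative invariant `w₂ = Q_pppp`. -/
def w₂ (Q : J1 → ℝ) (z : J1) : ℝ := pd 2 (pd 2 (pd 2 (pd 2 Q))) z

/-- The coordinate differentials of `R8`. The coordinates are
`(x, y, p, ρ, φ, γ, γ̄, r) = (w 0, …, w 7)`. -/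
def dc (k : Fin 8) : R8 →L[ℝ] ℝ := ContinuousLinearMap.proj k

/-- The point `(x, y, p)` of the jet space. -/
def base (w : R8) : J1 := ![w 0, w 1, w 2]

/-- `λ` in coordinates. -/
def cLam (i : ℝ) (w : R8) : R8 →L[ℝ] ℝ := (-i) • (dc 1 - w 2 • dc 0)

/-- `θ¹` in coordinates. -/
def cθ₁ (i : ℝ) (Q : J1 → ℝ) (w : R8) : R8 →L[ℝ] ℝ :=
  (w 3 * Real.exp (i * w 4)) • ((dc 2 - Q (base w) • dc 0) + w 5 • cLam i w)

/-- `θ²` in coordinates. -/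
def cθ₂ (i : ℝ) (w : R8) : R8 →L[ℝ] ℝ :=
  (w 3 * Real.exp (-i * w 4)) • (dc 0 + w 6 • cLam i w)

/-- `θ³` in coordinates. -/
def cθ₃ (i : ℝ) (w : R8) : R8 →L[ℝ] ℝ := (w 3 ^ 2) • cLam i w

/-- `Ω₂` in coordinates. -/
def cΩ₂ (i : ℝ) (Q : J1 → ℝ) (w : R8) : R8 →L[ℝ] ℝ :=
  let ρ := w 3; let γ := w 5; let γb := w 6; let r := w 7
  let e := Real.exp (i * w 4); let eb := Real.exp (-i * w 4)
  let Qp := pd 2 Q (base w); let Qpp := pd 2 (pd 2 Q) (base w)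
  i • dc 4 + (1 / ρ) • dc 3
    + (1 / (4 * i * ρ ^ 2) * (6 * γ * γb * i ^ 2 - 6 * γb * i * Qp - Qpp - 4 * i * r * ρ)) • cθ₃ i w
    - (2 * i * γb / ρ * eb) • cθ₁ i Q w
    - (e / ρ * (i * γ - Qp)) • cθ₂ i w

/-- `Ω̄₂` in coordinates. -/
def cΩ₂b (i : ℝ) (Q : J1 → ℝ) (w : R8) : R8 →L[ℝ] ℝ :=
  let ρ := w 3; let γ := w 5; let γb := w 6; let r := w 7
  let e := Real.exp (i * w 4); let eb := Real.exp (-i * w 4)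
  let Qp := pd 2 Q (base w); let Qpp := pd 2 (pd 2 Q) (base w)
  (-i) • dc 4 + (1 / ρ) • dc 3
    - (1 / (4 * i * ρ ^ 2) * (6 * γ * γb * i ^ 2 - 2 * γb * i * Qp - Qpp + 4 * i * r * ρ)) • cθ₃ i w
    + (i * γb / ρ * eb) • cθ₁ i Q w
    + (e / ρ * (2 * i * γ - Qp)) • cθ₂ i w

/-- `Ω₃` in coordinates. -/
def cΩ₃ (i : ℝ) (Q : J1 → ℝ) (w : R8) : R8 →L[ℝ] ℝ :=
  let ρ := w 3; let γ := w 5; let γb := w 6; let r := w 7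
  let e := Real.exp (i * w 4); let eb := Real.exp (-i * w 4)
  let Qp := pd 2 Q (base w); let Qpp := pd 2 (pd 2 Q) (base w)
  let Qy := pd 1 Q (base w); let Qpy := pd 1 (pd 2 Q) (base w)
  let DQpp := tot Q (pd 2 (pd 2 Q)) (base w)
  (e / ρ) • (dc 5
    - (1 / (6 * i ^ 2 * ρ ^ 2) * (DQpp + 6 * γ ^ 2 * γb * i ^ 3 - 6 * γ * γb * i ^ 2 * Qp
        - 3 * γ * i * Qpp - 4 * Qpy - 6 * γb * i * Qy)) • cθ₃ i w
    + (eb / (4 * i * ρ) * (2 * γ * γb * i ^ 2 - 2 * γb * i * Qp - Qpp - 4 * i * r * ρ)) • cθ₁ i Q w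
    + (e / (i * ρ) * (γ ^ 2 * i ^ 2 - γ * i * Qp - Qy)) • cθ₂ i w)

/-- `Ω̄₃` in coordinates. -/
def cΩ₃b (i : ℝ) (Q : J1 → ℝ) (w : R8) : R8 →L[ℝ] ℝ :=
  let ρ := w 3; let γ := w 5; let γb := w 6; let r := w 7
  let e := Real.exp (i * w 4); let eb := Real.exp (-i * w 4)
  let Qp := pd 2 Q (base w); let Qpp := pd 2 (pd 2 Q) (base w)
  let Qppp := pd 2 (pd 2 (pd 2 Q)) (base w)
  (eb / ρ) • (dc 6
    + (1 / (6 * i ^ 2 * ρ ^ 2) * (6 * γ * γb ^ 2 * i ^ 3 - 6 * γb ^ 2 * i ^ 2 * Qp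
        - 3 * γb * i * Qpp - Qppp)) • cθ₃ i w
    - (eb / ρ * γb ^ 2 * i) • cθ₁ i Q w
    - (e / (4 * i * ρ) * (2 * γ * γb * i ^ 2 - 2 * γb * i * Qp - Qpp + 4 * i * r * ρ)) • cθ₂ i w)

/-- `Ω₄` in coordinates. -/
def cΩ₄ (i : ℝ) (Q : J1 → ℝ) (w : R8) : R8 →L[ℝ] ℝ :=
  let ρ := w 3; let γ := w 5; let γb := w 6; let r := w 7
  let e := Real.exp (i * w 4); let eb := Real.exp (-i * w 4)
  let Qp := pd 2 Q (base w); let Qpp := pd 2 (pd 2 Q) (base w)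
  let Qppp := pd 2 (pd 2 (pd 2 Q)) (base w)
  let Qy := pd 1 Q (base w); let Qpy := pd 1 (pd 2 Q) (base w)
  let Qppy := pd 1 (pd 2 (pd 2 Q)) (base w)
  let DQp := tot Q (pd 2 Q) (base w)
  let DQpp := tot Q (pd 2 (pd 2 Q)) (base w)
  let DQppp := tot Q (pd 2 (pd 2 (pd 2 Q))) (base w)
  (-(i / (2 * ρ ^ 2) * γb)) • dc 5 + (1 / (2 * ρ ^ 2) * (i * γ - Qp)) • dc 6
    - (1 / ρ) • dc 7 - (r / ρ ^ 2) • dc 3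
    + (1 / (48 * i ^ 2 * ρ ^ 4) * (8 * DQppp - 3 * Qpp ^ 2 + 8 * Qp * Qppp - 12 * Qppy
        - 12 * γ * i * Qppp + γb * (12 * i * DQpp - 24 * i * Qpy) - 12 * γ * γb * i ^ 2 * Qpp
        + γb ^ 2 * (24 * i ^ 2 * DQp + 12 * i ^ 2 * Qp ^ 2 - 48 * i ^ 2 * Qy)
        - 48 * i ^ 3 * γ * γb ^ 2 * Qp + 36 * γ ^ 2 * γb ^ 2 * i ^ 4
        + 48 * γb * r * ρ * i ^ 2 * Qp + 48 * i ^ 2 * ρ ^ 2 * r ^ 2)) • cθ₃ i w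
    - (eb / (12 * i * ρ ^ 3) * (6 * γ * γb ^ 2 * i ^ 3 - 6 * γb ^ 2 * i ^ 2 * Qp
        + 3 * γb * i * Qpp - Qppp - 12 * γb * i ^ 2 * r * ρ)) • cθ₁ i Q w
    - (e / (12 * i * ρ ^ 3) * (DQpp - 4 * Qpy - 3 * i * γ * Qpp + 6 * i * γb * (DQp - 2 * Qy)
        - 6 * i ^ 2 * γ * γb * Qp + 6 * γ ^ 2 * γb * i ^ 3 + 12 * γ * i ^ 2 * r * ρ)) • cθ₂ i w

/-- The coordinate expressions for all forms and functions, on the set of all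
`(x, y, p, ρ, φ, γ, γ̄, r)` with `(x, y, p) ∈ U` and `ρ ≠ 0`. -/
def coordData (i : ℝ) (U : Set J1) (Q : J1 → ℝ) : CartanData where
  P := {w | base w ∈ U ∧ w 3 ≠ 0}
  π := base
  a w := w 3 ^ 2
  b w := w 3 * Real.exp (i * w 4)
  bb w := w 3 * Real.exp (-i * w 4)
  c w := w 3 * Real.exp (i * w 4) * w 5
  cb w := w 3 * Real.exp (-i * w 4) * w 6
  θ₁ := cθ₁ i Q
  θ₂ := cθ₂ i
  θ₃ := cθ₃ i
  Ω₂ := cΩ₂ i Q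
  Ω₂b := cΩ₂b i Q
  Ω₃ := cΩ₃ i Q
  Ω₃b := cΩ₃b i Q
  Ω₄ := cΩ₄ i Q
  R w := -(Real.exp (2 * i * w 4) / (6 * i ^ 2 * w 3 ^ 4)) * w₁ Q (base w)
  Rb w := -(Real.exp (-2 * i * w 4) / (6 * i ^ 2 * w 3 ^ 4)) * w₂ Q (base w)
  S w := Real.exp (i * w 4) / (6 * i ^ 2 * w 3 ^ 5)
    * (pd 2 (w₁ Q) (base w) + i * w 6 * w₁ Q (base w))
  Sb w := Real.exp (-i * w 4) / (6 * i ^ 2 * w 3 ^ 5)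
    * (tot Q (w₂ Q) (base w) + (2 * pd 2 Q (base w) - i * w 5) * w₂ Q (base w))

end PointODE

end

open PointODE

/-!
# The Cartan connection of a second order ordinary differential equation

*Existence.* The bundle is the product of `U` with the group `H` of upper triangular matrices of
determinant one (`total`, `bundle`), where `H` acts by right multiplication on the second factor.
Writing `F` for the `H`-valued coordinate (`fiberMat`), the connection is
`ω = F⁻¹ A F + F⁻¹ dF` (`cartanForm`), with `A` an explicit `sl(3, ℝ)`-valued form on the jet space
(`gauge`). Equivariance and the behaviour on fundamental vector fields hold for every form of this
shape, and injectivity on tangent spaces holds because `A` reproduces `λ, μ, μ̄` in its lower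
triangular entries. The curvature of `ω` is the conjugate by `F` of that of `A`
(`gauge_curvature`), and the curvature of `A` has only the three entries in `w₁`, `∂ₚ w₁`,
`w₂` and `D w₂` that the theorem allows (`d_gauge`). The eight forms of the coframe are read off
from the entries of `ω`, and the structure equations are the entries of the curvature equation.

The verification of `d_gauge` is an identity between polynomials in partial derivatives of `Q`. It
is carried out in the commutative algebra `SmoothFun U` of smooth functions on an open set of the
jet space, on which the partial derivatives `jd k` and the total derivative `jD q` are
derivations, so that `simp` with the commutation rules followed by `ring` decides it. A function
on the whole jet space is linked to its restriction by `Rep`.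

*Differentials of the curvature.* Since `R` and `S` are explicit multiples of `w₁` and of
`∂ₚ w₁ + i γ̄ w₁`, their covariant differentials vanish on vertical vectors, hence are combinations
of `θ¹, θ², θ³`. Equality of the two mixed coefficients `S₁` and `S̄₁` is the relation between
`∂ₚ² w₁` and `D² w₂` in `jd_jd_jw₁`.

*Uniqueness.* If `θ¹, θ², θ³` and `Ω₂ + Ω̄₂` are given, the structure equations determine the
remaining forms and functions: Cartan's lemma applied to the difference of each pair of equations
leaves combinations of `θ¹, θ², θ³`, which the later equations force to vanish (`forms_unique`).
For a Cartan coframe `Y` over the same equation, a map to the bundle that covers the projection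
and pulls back `θ¹, θ², θ³` correctly is fixed, up to its last coordinate, by the functions
`b, b̄, c, c̄`: the function `a` equals `b b̄` by the equation for `dθ³`, and the diagonal of `F` is
obtained by extracting a real cube root (`lift`). Changing the last coordinate changes
`Ω₂ + Ω̄₂` by a multiple of `θ³` (`sum_shift`), so exactly one choice of it pulls back
`Ω₂ + Ω̄₂` correctly (`exists_lift_sum`), and the rest follows from `forms_unique`. A point
equivalence turns a Cartan coframe over its source into one over its target
(`IsPointMap.exists_transport`), which reduces the general case to this one. For a diffeomorphism
the maps obtained from `φ` and `φ⁻¹` are inverse to each other by uniqueness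
(`exists_isomorphism`).

*Coordinates.* The chart `(x, y, p, ρ, φ, γ, γ̄, r)` is an explicit map into the bundle which
involves the cube root `e^{iφ/3}` (`chart`). That it pulls back `θ¹, θ², θ³` and `Ω₂, …, Ω₄`
to the stated expressions is a direct computation from `ω = F⁻¹ A F + F⁻¹ dF`.
-/

noncomputable section

namespace PointODE

/-! ### Exterior calculus of one-forms -/

section Calculus

variable {E F : Type*} [NormedAddCommGroup E] [NormedSpace ℝ E]
  [NormedAddCommGroup F] [NormedSpace ℝ F]

theorem two_le_infty : (2 : WithTop ℕ∞) ≤ ∞ := WithTop.coe_le_coe.2 (le_top : (2 : ℕ∞) ≤ ⊤)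

theorem wedge_apply (α β : E →L[ℝ] ℝ) (v w : E) : (α ⋏ β) v w = α v * β w - α w * β v := rfl

/-- The exterior derivative as the skew part of the derivative. -/
theorem d_apply {α : E → E →L[ℝ] ℝ} {u : E} (h : DifferentiableAt ℝ α u) (v w : E) :
    d α u v w = fderiv ℝ α u v w - fderiv ℝ α u w v := by
  have h1 : DifferentiableAt ℝ
      (fun u => ContinuousAlternatingMap.ofSubsingleton ℝ E ℝ (0 : Fin 1) (α u)) u :=
    (ContinuousAlternatingMap.ofSubsingletonLIE (𝕜 := ℝ) (E := E) (F := ℝ)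
      (0 : Fin 1)).differentiable.differentiableAt.comp u h
  have e (z : E) : (fun x => α x z) = fun x => (ContinuousLinearMap.apply ℝ ℝ z) (α x) := rfl
  have e2 (z : E) : fderiv ℝ (fun x => α x z) u = (ContinuousLinearMap.apply ℝ ℝ z).comp
      (fderiv ℝ α u) := by
    rw [e]; exact ((ContinuousLinearMap.apply ℝ ℝ z).hasFDerivAt.comp u h.hasFDerivAt).fderiv
  rw [d, extDeriv_apply h1]
  simp [Fin.sum_univ_two, Fin.removeNth, e2, sub_eq_add_neg]

theorem fderiv_form_apply {α : E → F →L[ℝ] ℝ} {u : E} (h : DifferentiableAt ℝ α u) (v : E) (w : F) :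
    fderiv ℝ (fun x => α x w) u v = fderiv ℝ α u v w := by
  have := ((ContinuousLinearMap.apply ℝ ℝ w).hasFDerivAt.comp u h.hasFDerivAt).fderiv
  exact congrArg (· v) this

theorem d_congr {α β : E → E →L[ℝ] ℝ} {u : E} (h : α =ᶠ[nhds u] β) : d α u = d β u := by
  have : (fun u => ContinuousAlternatingMap.ofSubsingleton ℝ E ℝ (0 : Fin 1) (α u)) =ᶠ[nhds u]
      fun u => ContinuousAlternatingMap.ofSubsingleton ℝ E ℝ (0 : Fin 1) (β u) := by
    filter_upwards [h] with x hx
    rw [hx]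
  funext v w
  rw [d, d, this.extDeriv_eq]

theorem d_pull {f : E → F} {α : F → F →L[ℝ] ℝ} {u : E} (hα : DifferentiableAt ℝ α (f u))
    (hf : ContDiffAt ℝ ∞ f u) (v w : E) :
    d (pull f α) u v w = d α (f u) (fderiv ℝ f u v) (fderiv ℝ f u w) := by
  have h1 : DifferentiableAt ℝ
      (fun u => ContinuousAlternatingMap.ofSubsingleton ℝ F ℝ (0 : Fin 1) (α u)) (f u) :=
    (ContinuousAlternatingMap.ofSubsingletonLIE (𝕜 := ℝ) (E := F) (F := ℝ)
      (0 : Fin 1)).differentiable.differentiableAt.comp _ hα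
  have := extDeriv_pullback h1 hf (by simpa using two_le_infty)
  have e : (fun u => ContinuousAlternatingMap.ofSubsingleton ℝ E ℝ (0 : Fin 1) (pull f α u)) =
    fun x => (ContinuousAlternatingMap.ofSubsingleton ℝ F ℝ (0 : Fin 1)
      (α (f x))).compContinuousLinearMap (fderiv ℝ f x) := by
    funext x; ext y; simp [pull]
  rw [d, e, this]
  simp only [d, ContinuousAlternatingMap.compContinuousLinearMap_apply]
  congr 1
  funext j; fin_cases j <;> rfl

theorem d_add {α β : E → E →L[ℝ] ℝ} {u : E} (hα : DifferentiableAt ℝ α u)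
    (hβ : DifferentiableAt ℝ β u) : d (fun x => α x + β x) u = d α u + d β u := by
  funext v w
  simp only [Pi.add_apply]
  rw [d_apply hα, d_apply hβ, d_apply (hα.fun_add hβ), fderiv_fun_add hα hβ]
  simp; ring

theorem d_sub {α β : E → E →L[ℝ] ℝ} {u : E} (hα : DifferentiableAt ℝ α u)
    (hβ : DifferentiableAt ℝ β u) : d (fun x => α x - β x) u = d α u - d β u := by
  funext v w
  simp only [Pi.sub_apply]
  rw [d_apply hα, d_apply hβ, d_apply (hα.fun_sub hβ), fderiv_fun_sub hα hβ]
  simp; ring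

theorem d_smul {f : E → ℝ} {α : E → E →L[ℝ] ℝ} {u : E} (hf : DifferentiableAt ℝ f u)
    (hα : DifferentiableAt ℝ α u) :
    d (fun x => f x • α x) u = fderiv ℝ f u ⋏ α u + f u • d α u := by
  funext v w
  simp only [Pi.add_apply, Pi.smul_apply, wedge_apply, smul_eq_mul]
  rw [d_apply hα, d_apply (hf.fun_smul hα), fderiv_fun_smul hf hα]
  simp; ring

theorem d_const_smul (c : ℝ) {α : E → E →L[ℝ] ℝ} {u : E} (hα : DifferentiableAt ℝ α u) :
    d (fun x => c • α x) u = c • d α u := by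
  funext v w
  simp only [Pi.smul_apply, smul_eq_mul]
  rw [d_apply hα, d_apply (hα.fun_const_smul c), fderiv_fun_const_smul hα]
  simp; ring

theorem d_const (α : E →L[ℝ] ℝ) (u : E) : d (fun _ => α) u = 0 := by
  funext v w
  rw [d_apply (differentiableAt_const α)]
  simp

/-- If `α` is pointwise proportional to `θ`, with no regularity assumed of the factor, then `dα` and
`dθ` are proportional on the kernel of `θ`. -/
theorem d_of_proportional {α θ : E → E →L[ℝ] ℝ} {u : E} (hα : DifferentiableAt ℝ α u)
    (hθ : DifferentiableAt ℝ θ u) (h : ∀ᶠ x in nhds u, ∃ β : ℝ, α x = β • θ x) {β : ℝ}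
    (hβ : α u = β • θ u) {v₀ : E} (h₀ : θ u v₀ ≠ 0) {v w : E} (hv : θ u v = 0) (hw : θ u w = 0) :
    d α u v w = β * d θ u v w := by
  have key (v w : E) (hv : θ u v = 0) : fderiv ℝ α u w v = β * fderiv ℝ θ u w v := by
    have e : (fun x => α x v * θ x v₀) =ᶠ[nhds u] fun x => α x v₀ * θ x v := by
      filter_upwards [h] with x ⟨b, hb⟩
      simp [hb]; ring
    have da (z : E) : HasFDerivAt (fun x => α x z)
        ((ContinuousLinearMap.apply ℝ ℝ z).comp (fderiv ℝ α u)) u :=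
      (ContinuousLinearMap.apply ℝ ℝ z).hasFDerivAt.comp u hα.hasFDerivAt
    have dt (z : E) : HasFDerivAt (fun x => θ x z)
        ((ContinuousLinearMap.apply ℝ ℝ z).comp (fderiv ℝ θ u)) u :=
      (ContinuousLinearMap.apply ℝ ℝ z).hasFDerivAt.comp u hθ.hasFDerivAt
    have h1 := ((da v).fun_mul (dt v₀)).fderiv
    have h2 := ((da v₀).fun_mul (dt v)).fderiv
    rw [e.fderiv_eq] at h1
    have := congrArg (· w) (h1.symm.trans h2)
    simp [hβ, hv] at this
    exact mul_right_cancel₀ h₀ (by linear_combination this)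
  rw [d_apply hα, d_apply hθ, key v w hv, key w v hw]
  ring

/-- Gauge covariance of curvature: the curvature of `W = g a f + g df`, where `g = f⁻¹`, is the
conjugate by `f` of the curvature of `a`. The values of the derivatives of `W` and `a` are
parameters, so that the conclusion is an identity in the algebra. -/
theorem gauge_curvature {A : Type*} [NormedRing A] [NormedAlgebra ℝ A] {f g : E → A}
    {a : E → E →L[ℝ] A} {W : E → E → A} {da dW : E → E → A} {u : E} (hf : ContDiffAt ℝ 2 f u)
    (hg : DifferentiableAt ℝ g u) (ha : DifferentiableAt ℝ a u)
    (hfg : ∀ᶠ x in nhds u, f x * g x = 1) (hgf : g u * f u = 1)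
    (hW : ∀ᶠ x in nhds u, ∀ w, W x w = g x * a x w * f x + g x * fderiv ℝ f x w)
    (hda : ∀ v w, fderiv ℝ (fun x => a x w) u v = da v w)
    (hdW : ∀ v w, fderiv ℝ (fun x => W x w) u v = dW v w) (v w : E) :
    dW v w - dW w v + (W u v * W u w - W u w * W u v)
      = g u * (da v w - da w v + (a u v * a u w - a u w * a u v)) * f u := by
  have hf1 : DifferentiableAt ℝ f u := hf.differentiableAt two_ne_zero
  have hf2 : DifferentiableAt ℝ (fderiv ℝ f) u :=
    (hf.fderiv_right (m := 1) (by norm_num)).differentiableAt one_ne_zero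
  have hsymm : ∀ v w, fderiv ℝ (fderiv ℝ f) u v w = fderiv ℝ (fderiv ℝ f) u w v :=
    fun v w => (hf.isSymmSndFDerivAt (by simp)).eq v w
  have hfgu : f u * g u = 1 := hfg.self_of_nhds
  have hdg (v : E) : fderiv ℝ g u v = - (g u * fderiv ℝ f u v * g u) := by
    have h1 := (hf1.hasFDerivAt.mul' hg.hasFDerivAt).fderiv
    have h2 : fderiv ℝ (f * g) u = 0 := by
      have : (f * g) =ᶠ[nhds u] fun _ => (1 : A) := hfg
      rw [this.fderiv_eq]; simp
    rw [h2] at h1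
    have h3 := congrArg (g u * · ) (congrArg (· v) h1)
    simp only [zero_apply, mul_zero, add_apply,
      smul_apply, smul_eq_mul, mul_add, ← mul_assoc, hgf, one_mul] at h3
    have h4 := eq_neg_of_add_eq_zero_left h3.symm
    rw [h4]; simp [mul_assoc]
  have h (v w : E) : dW v w =
      -(g u * fderiv ℝ f u v * g u) * a u w * f u + g u * da v w * f u
      + g u * a u w * fderiv ℝ f u v
      + -(g u * fderiv ℝ f u v * g u) * fderiv ℝ f u w + g u * fderiv ℝ (fderiv ℝ f) u v w := by
    have h1 : HasFDerivAt (fun x => a x w)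
        ((ContinuousLinearMap.apply ℝ A w).comp (fderiv ℝ a u)) u :=
      (ContinuousLinearMap.apply ℝ A w).hasFDerivAt.comp u ha.hasFDerivAt
    have h2 : HasFDerivAt (fun x => fderiv ℝ f x w)
        ((ContinuousLinearMap.apply ℝ A w).comp (fderiv ℝ (fderiv ℝ f) u)) u :=
      (ContinuousLinearMap.apply ℝ A w).hasFDerivAt.comp u hf2.hasFDerivAt
    have h3 := (((hg.hasFDerivAt.mul' h1).mul' hf1.hasFDerivAt).add
      (hg.hasFDerivAt.mul' h2)).fderiv
    have h4 : (fun x => W x w) =ᶠ[nhds u] fun x => g x * a x w * f x + g x * fderiv ℝ f x w := by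
      filter_upwards [hW] with x hx using hx w
    rw [← hdW, h4.fderiv_eq, ← hda, h1.fderiv]
    refine Eq.trans (congrArg (· v) h3) ?_
    simp [hdg]
    noncomm_ring
  have c1 (x : A) : f u * (g u * x) = x := by rw [← mul_assoc, hfgu, one_mul]
  rw [h, h, hsymm w v, hW.self_of_nhds, hW.self_of_nhds]
  simp only [mul_add, add_mul, mul_sub, sub_mul, neg_mul, mul_assoc, c1]
  abel

end Calculus

/-! ### The differential algebra of smooth functions on the jet space -/

section Jets

open TopologicalSpace (Opens)

/-- The algebra of smooth functions on an open subset of the jet space. -/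
def SmoothFun (U : Opens J1) : Subalgebra ℝ (U → ℝ) where
  carrier := {f | ∃ g : J1 → ℝ, ContDiffOn ℝ ∞ g U ∧ ∀ z : U, g z = f z}
  mul_mem' := by
    rintro _ _ ⟨g, hg, hg'⟩ ⟨h, hh, hh'⟩
    exact ⟨fun z => g z * h z, hg.mul hh, fun z => by simp [hg', hh']⟩
  add_mem' := by
    rintro _ _ ⟨g, hg, hg'⟩ ⟨h, hh, hh'⟩
    exact ⟨fun z => g z + h z, hg.add hh, fun z => by simp [hg', hh']⟩
  algebraMap_mem' r := ⟨fun _ => r, contDiffOn_const, fun _ => rfl⟩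

variable {U : Opens J1}

/-- The smooth function on `U` given by the values on `U` of a function on the jet space. -/
def toSmooth (g : J1 → ℝ) (hg : ContDiffOn ℝ ∞ g U) : SmoothFun U :=
  ⟨fun z => g z, g, hg, fun _ => rfl⟩

/-- An arbitrary extension of a smooth function on `U` to the whole jet space. -/
def ext (f : SmoothFun U) : J1 → ℝ := f.2.choose

theorem contDiffOn_ext (f : SmoothFun U) : ContDiffOn ℝ ∞ (ext f) U := f.2.choose_spec.1

theorem ext_apply (f : SmoothFun U) (z : U) : ext f z = f.1 z := f.2.choose_spec.2 z

/-- `Rep g f`: the function `g` on the jet space restricts to the smooth function `f` on `U`. -/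
def Rep (g : J1 → ℝ) (f : SmoothFun U) : Prop := ∀ z : U, g z = f.1 z

theorem rep_toSmooth (g : J1 → ℝ) (hg : ContDiffOn ℝ ∞ g U) : Rep g (toSmooth g hg) :=
  fun _ => rfl

theorem rep_ext (f : SmoothFun U) : Rep (ext f) f := ext_apply f

theorem Rep.eqOn {g : J1 → ℝ} {f : SmoothFun U} (h : Rep g f) : EqOn g (ext f) U :=
  fun z hz => (h ⟨z, hz⟩).trans (ext_apply f ⟨z, hz⟩).symm

theorem Rep.contDiffOn {g : J1 → ℝ} {f : SmoothFun U} (h : Rep g f) : ContDiffOn ℝ ∞ g U :=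
  (contDiffOn_ext f).congr h.eqOn

theorem contDiffAt_of_mem {E F : Type*} [NormedAddCommGroup E] [NormedSpace ℝ E]
    [NormedAddCommGroup F] [NormedSpace ℝ F] {V : Set E} (hV : IsOpen V) {f : E → F}
    (hf : ContDiffOn ℝ ∞ f V) {z : E} (hz : z ∈ V) : ContDiffAt ℝ ∞ f z :=
  hf.contDiffAt (hV.mem_nhds hz)

theorem differentiableAt_of_mem {E F : Type*} [NormedAddCommGroup E] [NormedSpace ℝ E]
    [NormedAddCommGroup F] [NormedSpace ℝ F] {V : Set E} (hV : IsOpen V) {f : E → F}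
    (hf : ContDiffOn ℝ ∞ f V) {z : E} (hz : z ∈ V) : DifferentiableAt ℝ f z :=
  (contDiffAt_of_mem hV hf hz).differentiableAt (by simp)

theorem contDiffOn_fderiv {E F : Type*} [NormedAddCommGroup E] [NormedSpace ℝ E]
    [NormedAddCommGroup F] [NormedSpace ℝ F] {V : Set E} (hV : IsOpen V) {f : E → F}
    (hf : ContDiffOn ℝ ∞ f V) : ContDiffOn ℝ ∞ (fderiv ℝ f) V :=
  hf.fderiv_of_isOpen hV (by simp)

theorem contDiffOn_pd {V : Set J1} (hV : IsOpen V) {f : J1 → ℝ} (hf : ContDiffOn ℝ ∞ f V)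
    (k : Fin 3) : ContDiffOn ℝ ∞ (pd k f) V :=
  (contDiffOn_fderiv hV hf).clm_apply contDiffOn_const

theorem pd_congr {V : Set J1} (hV : IsOpen V) {f g : J1 → ℝ} (h : EqOn f g V) (k : Fin 3) :
    EqOn (pd k f) (pd k g) V := fun z hz => by
  rw [pd, pd, (h.eventuallyEq_of_mem (hV.mem_nhds hz)).fderiv_eq]

theorem Rep.differentiableAt {g : J1 → ℝ} {f : SmoothFun U} (h : Rep g f) (z : U) :
    DifferentiableAt ℝ g z := differentiableAt_of_mem U.2 h.contDiffOn z.2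

theorem pd_add {f g : J1 → ℝ} {z : J1} (hf : DifferentiableAt ℝ f z) (hg : DifferentiableAt ℝ g z)
    (k : Fin 3) : pd k (fun z => f z + g z) z = pd k f z + pd k g z := by
  simp [pd, fderiv_fun_add hf hg]

theorem pd_mul {f g : J1 → ℝ} {z : J1} (hf : DifferentiableAt ℝ f z) (hg : DifferentiableAt ℝ g z)
    (k : Fin 3) : pd k (fun z => f z * g z) z = f z * pd k g z + g z * pd k f z := by
  simp [pd, fderiv_fun_mul hf hg]

/-- The partial derivative as a derivation of the algebra of smooth functions. -/
def jd (k : Fin 3) : Derivation ℝ (SmoothFun U) (SmoothFun U) :=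
  Derivation.mk'
    { toFun := fun f => toSmooth (pd k (ext f)) (contDiffOn_pd U.2 (contDiffOn_ext f) k)
      map_add' := fun f g => by
        refine Subtype.ext (funext fun z => ?_)
        have : EqOn (ext (f + g)) (fun z => ext f z + ext g z) U := fun z hz => by
          have h (f : SmoothFun U) := ext_apply f ⟨z, hz⟩
          simp only at h
          simp [h]
        exact (pd_congr U.2 this k z.2).trans
          (pd_add ((rep_ext f).differentiableAt z) ((rep_ext g).differentiableAt z) k)
      map_smul' := fun c f => by
        refine Subtype.ext (funext fun z => ?_)
        have : EqOn (ext (c • f)) (fun z => c * ext f z) U := fun z hz => by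
          have h (f : SmoothFun U) := ext_apply f ⟨z, hz⟩
          simp only at h
          simp [h]
        refine (pd_congr U.2 this k z.2).trans
          ((pd_mul (differentiableAt_const c) ((rep_ext f).differentiableAt z) k).trans ?_)
        simp [pd, toSmooth] }
    fun f g => by
      refine Subtype.ext (funext fun z => ?_)
      have : EqOn (ext (f * g)) (fun z => ext f z * ext g z) U := fun z hz => by
        have h (f : SmoothFun U) := ext_apply f ⟨z, hz⟩
        simp only at h
        simp [h]
      refine (pd_congr U.2 this k z.2).trans
        ((pd_mul ((rep_ext f).differentiableAt z) ((rep_ext g).differentiableAt z) k).trans ?_)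
      simp [toSmooth, ext_apply]

/-- The formal derivations compute the actual partial derivatives. The rules `Rep.pd` and `Rep.tot`
turn identities between derivatives of smooth functions into identities in the algebra. -/
theorem Rep.pd {g : J1 → ℝ} {f : SmoothFun U} (h : Rep g f) (k : Fin 3) :
    Rep (pd k g) (jd k f) := fun z => pd_congr U.2 h.eqOn k z.2

theorem Rep.add {g₁ g₂ : J1 → ℝ} {f₁ f₂ : SmoothFun U} (h₁ : Rep g₁ f₁) (h₂ : Rep g₂ f₂) :
    Rep (fun z => g₁ z + g₂ z) (f₁ + f₂) := fun z => congrArg₂ (· + ·) (h₁ z) (h₂ z)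

theorem Rep.sub {g₁ g₂ : J1 → ℝ} {f₁ f₂ : SmoothFun U} (h₁ : Rep g₁ f₁) (h₂ : Rep g₂ f₂) :
    Rep (fun z => g₁ z - g₂ z) (f₁ - f₂) := fun z => congrArg₂ (· - ·) (h₁ z) (h₂ z)

theorem Rep.mul {g₁ g₂ : J1 → ℝ} {f₁ f₂ : SmoothFun U} (h₁ : Rep g₁ f₁) (h₂ : Rep g₂ f₂) :
    Rep (fun z => g₁ z * g₂ z) (f₁ * f₂) := fun z => congrArg₂ (· * ·) (h₁ z) (h₂ z)

/-- Partial derivatives commute. -/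
theorem jd_comm (k l : Fin 3) (f : SmoothFun U) : jd k (jd l f) = jd l (jd k f) := by
  have key (z : U) (k l : Fin 3) : pd k (PointODE.pd l (ext f)) z =
      fderiv ℝ (fderiv ℝ (ext f)) z (Pi.single k 1) (Pi.single l 1) := by
    have h2 := differentiableAt_of_mem U.2 (contDiffOn_fderiv U.2 (contDiffOn_ext f)) z.2
    exact fderiv_form_apply h2 _ _
  refine Subtype.ext (funext fun z => ?_)
  rw [← ((rep_ext f).pd l).pd k z, ← ((rep_ext f).pd k).pd l z, key, key]
  exact ((contDiffAt_of_mem U.2 (contDiffOn_ext f) z.2).isSymmSndFDerivAt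
    (by simpa using two_le_infty)).eq _ _

/-- The coordinate functions of the jet space. -/
def jc (k : Fin 3) : SmoothFun U := toSmooth (fun z => z k) (by fun_prop)

theorem jd_jc (k l : Fin 3) : jd k (jc l : SmoothFun U) = if k = l then 1 else 0 := by
  refine Subtype.ext (funext fun z => ?_)
  have h : Rep (fun z => z l) (jc l : SmoothFun U) := fun _ => rfl
  rw [← h.pd k z, pd,
    (hasFDerivAt_apply (𝕜 := ℝ) l (z : J1)).fderiv]
  by_cases h : k = l
  · subst h; simp
  · simp [h, Ne.symm h]

/-- The total derivative `∂_x + p ∂_y + q ∂_p` as a derivation of the algebra of smooth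
functions. -/
def jD (q : SmoothFun U) : Derivation ℝ (SmoothFun U) (SmoothFun U) :=
  jd 0 + (jc 2 : SmoothFun U) • jd 1 + q • jd 2

theorem jD_apply (q f : SmoothFun U) : jD q f = jd 0 f + jc 2 * jd 1 f + q * jd 2 f := rfl

theorem Rep.tot {Q g : J1 → ℝ} {q f : SmoothFun U} (hq : Rep Q q) (h : Rep g f) :
    Rep (tot Q g) (jD q f) :=
  ((h.pd 0).add ((rep_toSmooth (fun z => z 2) (by fun_prop)).mul (h.pd 1))).add (hq.mul (h.pd 2))

/-- The commutator `[∂_p, D] = ∂_y + q_p ∂_p`. -/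
theorem jd_two_jD (q f : SmoothFun U) :
    jd 2 (jD q f) = jD q (jd 2 f) + jd 1 f + jd 2 q * jd 2 f := by
  simp only [jD_apply, map_add, Derivation.leibniz, smul_eq_mul, jd_jc, jd_comm 2 0, jd_comm 2 1]
  simp only [↓reduceIte]
  ring

/-- The commutator `[∂_y, D] = q_y ∂_p`. -/
theorem jd_one_jD (q f : SmoothFun U) : jd 1 (jD q f) = jD q (jd 1 f) + jd 1 q * jd 2 f := by
  simp only [jD_apply, map_add, Derivation.leibniz, smul_eq_mul, jd_jc, jd_comm 1 0, jd_comm 2 1]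
  simp
  ring

theorem jd_two_one (f : SmoothFun U) : jd 2 (jd 1 f) = jd 1 (jd 2 f) := jd_comm 2 1 f

/-- `w₁` as an element of the differential algebra. -/
def jw₁ (q : SmoothFun U) : SmoothFun U :=
  jD q (jD q (jd 2 (jd 2 q))) - 4 * jD q (jd 1 (jd 2 q)) - jD q (jd 2 (jd 2 q)) * jd 2 q
    + 4 * jd 2 q * jd 1 (jd 2 q) - 3 * jd 2 (jd 2 q) * jd 1 q + 6 * jd 1 (jd 1 q)

/-- `w₂` as an element of the differential algebra. -/
def jw₂ (q : SmoothFun U) : SmoothFun U := jd 2 (jd 2 (jd 2 (jd 2 q)))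

theorem rep_ofNat (n : ℕ) [n.AtLeastTwo] :
    Rep (U := U) (fun _ => (OfNat.ofNat n : ℝ)) (OfNat.ofNat n) := fun _ => rfl

theorem rep_w₁ {Q : J1 → ℝ} {q : SmoothFun U} (h : Rep Q q) : Rep (w₁ Q) (jw₁ q) :=
  (((((h.tot (h.tot ((h.pd 2).pd 2))).sub ((rep_ofNat 4).mul (h.tot ((h.pd 2).pd 1)))).sub
    ((h.tot ((h.pd 2).pd 2)).mul (h.pd 2))).add
    (((rep_ofNat 4).mul (h.pd 2)).mul ((h.pd 2).pd 1))).sub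
    (((rep_ofNat 3).mul ((h.pd 2).pd 2)).mul (h.pd 1))).add ((rep_ofNat 6).mul ((h.pd 1).pd 1))

theorem rep_w₂ {Q : J1 → ℝ} {q : SmoothFun U} (h : Rep Q q) : Rep (w₂ Q) (jw₂ q) :=
  (((h.pd 2).pd 2).pd 2).pd 2

theorem derivation_ofNat (δ : Derivation ℝ (SmoothFun U) (SmoothFun U)) (n : ℕ) [n.AtLeastTwo] :
    δ ofNat(n) = 0 :=
  (congrArg δ (Nat.cast_ofNat (R := SmoothFun U) (n := n)).symm).trans (δ.map_natCast n)

/-- The relation between the two relative invariants that makes the mixed coefficients `S₁` and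
`S̄₁` agree. -/
theorem jd_jd_jw₁ (q : SmoothFun U) : jd 2 (jd 2 (jw₁ q)) =
    jD q (jD q (jw₂ q)) + 3 * jd 2 q * jD q (jw₂ q) + 2 * jD q (jd 2 q) * jw₂ q
      + 2 * jd 2 q ^ 2 * jw₂ q - jd 1 q * jw₂ q := by
  simp only [jw₁, jw₂, map_add, map_sub, Derivation.leibniz, smul_eq_mul, jd_two_jD, jd_one_jD,
    jd_two_one, derivation_ofNat, mul_zero, add_zero]
  ring

end Jets

/-! ### The connection on the jet space in the gauge `b = b̄ = 1`, `γ = γ̄ = r = 0` -/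

section Gauge

open TopologicalSpace (Opens)

/-- The one-form `P μ̄ + L λ + M μ` on the jet space. -/
def frameForm (i : ℝ) (Q P L M : J1 → ℝ) (z : J1) : J1 →L[ℝ] ℝ :=
  P z • mub z + L z • lam i z + M z • mu Q z

theorem fderiv_eq_pd (f : J1 → ℝ) (z v : J1) :
    fderiv ℝ f z v = pd 0 f z * v 0 + pd 1 f z * v 1 + pd 2 f z * v 2 := by
  have hv : v = v 0 • Pi.single 0 1 + v 1 • Pi.single 1 1 + v 2 • Pi.single 2 1 := by
    ext k; fin_cases k <;> simp
  conv_lhs => rw [hv]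
  simp only [map_add, map_smul, smul_eq_mul, pd]
  ring

theorem mub_apply (z v : J1) : mub z v = v 0 := rfl

theorem lam_apply (i : ℝ) (z v : J1) : lam i z v = -i * (v 1 - z 2 * v 0) := by simp [lam]

theorem mu_apply (Q : J1 → ℝ) (z v : J1) : mu Q z v = v 2 - Q z * v 0 := by simp [mu]

/-- The differential of a function in the frame `μ̄, λ, μ`. -/
theorem fderiv_eq_frame {i : ℝ} (hi : i ≠ 0) (Q f : J1 → ℝ) (z v : J1) :
    fderiv ℝ f z v = tot Q f z * mub z v - pd 1 f z / i * lam i z v + pd 2 f z * mu Q z v := by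
  rw [fderiv_eq_pd, tot, mub_apply, lam_apply, mu_apply]
  field_simp
  ring

theorem differentiableAt_lam (i : ℝ) (z : J1) : DifferentiableAt ℝ (lam i) z := by
  unfold lam; fun_prop

theorem differentiableAt_mu {Q : J1 → ℝ} {z : J1} (hQ : DifferentiableAt ℝ Q z) :
    DifferentiableAt ℝ (mu Q) z := by
  unfold mu; fun_prop

theorem differentiableAt_mub (z : J1) : DifferentiableAt ℝ mub z := differentiableAt_const _

theorem d_mub (z : J1) : d mub z = 0 := d_const _ z

theorem d_lam (i : ℝ) (Q : J1 → ℝ) (z v w : J1) :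
    d (lam i) z v w = i * (mu Q z ⋏ mub z) v w := by
  have h1 : DifferentiableAt ℝ (fun z : J1 => z 2) z := by fun_prop
  have h2 : DifferentiableAt ℝ
    (fun z : J1 => z 2 • (ContinuousLinearMap.proj 0 : J1 →L[ℝ] ℝ)) z := by fun_prop
  have h3 : DifferentiableAt ℝ (fun z : J1 => (ContinuousLinearMap.proj 1 : J1 →L[ℝ] ℝ)
    - z 2 • ContinuousLinearMap.proj 0) z := by fun_prop
  have : lam i = fun z => (-i) • ((ContinuousLinearMap.proj 1 : J1 →L[ℝ] ℝ)
    - z 2 • ContinuousLinearMap.proj 0) := rfl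
  rw [this, d_const_smul _ h3, d_sub (differentiableAt_const _) h2, d_const,
    d_smul h1 (differentiableAt_const _), d_const, (hasFDerivAt_apply (𝕜 := ℝ) 2 z).fderiv]
  simp only [smul_zero, add_zero, zero_sub, Pi.smul_apply, Pi.neg_apply, wedge_apply, mu_apply,
    mub_apply, ContinuousLinearMap.proj_apply, smul_eq_mul]
  ring

theorem d_mu {i : ℝ} (hi : i ≠ 0) {Q : J1 → ℝ} {z : J1} (hQ : DifferentiableAt ℝ Q z) (v w : J1) :
    d (mu Q) z v w = -(pd 2 Q z) * (mu Q z ⋏ mub z) v w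
      + pd 1 Q z / i * (lam i z ⋏ mub z) v w := by
  have : mu Q = fun z => (ContinuousLinearMap.proj 2 : J1 →L[ℝ] ℝ)
    - Q z • ContinuousLinearMap.proj 0 := rfl
  rw [this, d_sub (differentiableAt_const _) (hQ.fun_smul (differentiableAt_const _)), d_const,
    d_smul hQ (differentiableAt_const _), d_const]
  rw [← this]
  simp only [smul_zero, add_zero, zero_sub, Pi.neg_apply, wedge_apply, fderiv_eq_frame hi Q,
    mub_apply, ContinuousLinearMap.proj_apply]
  ring

theorem d_frameForm {i : ℝ} (hi : i ≠ 0) {Q P L M : J1 → ℝ} {z : J1}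
    (hQ : DifferentiableAt ℝ Q z) (hP : DifferentiableAt ℝ P z) (hL : DifferentiableAt ℝ L z)
    (hM : DifferentiableAt ℝ M z) (v w : J1) :
    d (frameForm i Q P L M) z v w =
      (pd 2 P z + i * L z - pd 2 Q z * M z - tot Q M z) * (mu Q z ⋏ mub z) v w
      + (-(pd 1 P z / i) - tot Q L z + pd 1 Q z * M z / i) * (lam i z ⋏ mub z) v w
      + (pd 2 L z + pd 1 M z / i) * (mu Q z ⋏ lam i z) v w := by
  have h1 := hP.fun_smul (differentiableAt_mub z)
  have h2 := hL.fun_smul (differentiableAt_lam i z)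
  have h3 := hM.fun_smul (differentiableAt_mu hQ)
  have : frameForm i Q P L M = fun z => P z • mub z + L z • lam i z + M z • mu Q z := rfl
  rw [this, d_add (h1.fun_add h2) h3, d_add h1 h2, d_smul hP (differentiableAt_mub z),
    d_smul hL (differentiableAt_lam i z), d_smul hM (differentiableAt_mu hQ), d_mub]
  simp only [Pi.add_apply, Pi.smul_apply, d_lam i Q, d_mu hi hQ, smul_eq_mul, wedge_apply,
    fderiv_eq_frame hi Q]
  simp only [Pi.zero_apply]
  ring

/-- The coefficients of `μ̄` in the gauge form. -/
def gaugeP (i : ℝ) (Q : J1 → ℝ) (z : J1) : Matrix (Fin 3) (Fin 3) ℝ :=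
  !![1 / 3 * pd 2 Q z, 1 / 4 * pd 2 (pd 2 Q) z,
      1 / (24 * i) * (tot Q (pd 2 (pd 2 Q)) z - 4 * pd 1 (pd 2 Q) z);
    0, -2 / 3 * pd 2 Q z, 1 / (2 * i) * pd 1 Q z;
    0, 2 * i, 1 / 3 * pd 2 Q z]

/-- The coefficients of `λ` in the gauge form. -/
def gaugeL (i : ℝ) (Q : J1 → ℝ) (z : J1) : Matrix (Fin 3) (Fin 3) ℝ :=
  !![-1 / (12 * i) * pd 2 (pd 2 Q) z, -1 / (6 * i) * pd 2 (pd 2 (pd 2 Q)) z,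
      -1 / (96 * i ^ 2) * (8 * tot Q (pd 2 (pd 2 (pd 2 Q))) z - 3 * pd 2 (pd 2 Q) z ^ 2
        + 8 * pd 2 Q z * pd 2 (pd 2 (pd 2 Q)) z - 12 * pd 1 (pd 2 (pd 2 Q)) z);
    0, 1 / (6 * i) * pd 2 (pd 2 Q) z,
      1 / (12 * i ^ 2) * (tot Q (pd 2 (pd 2 Q)) z - 4 * pd 1 (pd 2 Q) z);
    2, 0, -1 / (12 * i) * pd 2 (pd 2 Q) z]

/-- The coefficients of `μ` in the gauge form. -/
def gaugeM (i : ℝ) (Q : J1 → ℝ) (z : J1) : Matrix (Fin 3) (Fin 3) ℝ :=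
  !![0, 0, -1 / (24 * i) * pd 2 (pd 2 (pd 2 Q)) z;
    1, 0, 1 / (8 * i) * pd 2 (pd 2 Q) z;
    0, 0, 0]

/-- The `sl(3, ℝ)`-valued form `P μ̄ + L λ + M μ` on the jet space: the Cartan connection in the
gauge `b = b̄ = 1`, `γ = γ̄ = r = 0`. -/
def gauge (i : ℝ) (Q : J1 → ℝ) (z : J1) : Matrix (Fin 3) (Fin 3) (J1 →L[ℝ] ℝ) :=
  fun j k => frameForm i Q (fun z => gaugeP i Q z j k) (fun z => gaugeL i Q z j k)
    (fun z => gaugeM i Q z j k) z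

/-- The coefficients of `μ ∧ λ` in the curvature of the gauge form. -/
def gaugeKmu (i : ℝ) (Q : J1 → ℝ) (z : J1) : Matrix (Fin 3) (Fin 3) ℝ :=
  !![0, -(1 / (6 * i)) * w₂ Q z,
      -(1 / (12 * i ^ 2)) * (tot Q (w₂ Q) z + 2 * pd 2 Q z * w₂ Q z); 0, 0, 0; 0, 0, 0]

/-- The coefficients of `μ̄ ∧ λ` in the curvature of the gauge form. -/
def gaugeKx (i : ℝ) (Q : J1 → ℝ) (z : J1) : Matrix (Fin 3) (Fin 3) ℝ :=
  !![0, 0, -(1 / (12 * i ^ 2)) * pd 2 (w₁ Q) z; 0, 0, 1 / (12 * i ^ 2) * w₁ Q z; 0, 0, 0]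

variable {U : Opens J1}

/-- `gaugeP` as a matrix of elements of the differential algebra. -/
def jgaugeP (i : ℝ) (q : SmoothFun U) : Matrix (Fin 3) (Fin 3) (SmoothFun U) :=
  !![(1 / 3 : ℝ) • jd 2 q, (1 / 4 : ℝ) • jd 2 (jd 2 q),
      (1 / (24 * i)) • (jD q (jd 2 (jd 2 q)) - (4 : ℝ) • jd 1 (jd 2 q));
    0, (-2 / 3 : ℝ) • jd 2 q, (1 / (2 * i)) • jd 1 q;
    0, algebraMap ℝ _ (2 * i), (1 / 3 : ℝ) • jd 2 q]

/-- `gaugeL` as a matrix of elements of the differential algebra. -/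
def jgaugeL (i : ℝ) (q : SmoothFun U) : Matrix (Fin 3) (Fin 3) (SmoothFun U) :=
  !![(-1 / (12 * i)) • jd 2 (jd 2 q), (-1 / (6 * i)) • jd 2 (jd 2 (jd 2 q)),
      (-1 / (96 * i ^ 2)) • ((8 : ℝ) • jD q (jd 2 (jd 2 (jd 2 q)))
        - (3 : ℝ) • (jd 2 (jd 2 q) * jd 2 (jd 2 q))
        + (8 : ℝ) • (jd 2 q * jd 2 (jd 2 (jd 2 q))) - (12 : ℝ) • jd 1 (jd 2 (jd 2 q)));
    0, (1 / (6 * i)) • jd 2 (jd 2 q),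
      (1 / (12 * i ^ 2)) • (jD q (jd 2 (jd 2 q)) - (4 : ℝ) • jd 1 (jd 2 q));
    algebraMap ℝ _ 2, 0, (-1 / (12 * i)) • jd 2 (jd 2 q)]

/-- `gaugeM` as a matrix of elements of the differential algebra. -/
def jgaugeM (i : ℝ) (q : SmoothFun U) : Matrix (Fin 3) (Fin 3) (SmoothFun U) :=
  !![0, 0, (-1 / (24 * i)) • jd 2 (jd 2 (jd 2 q));
    1, 0, (1 / (8 * i)) • jd 2 (jd 2 q);
    0, 0, 0]

variable {Q : J1 → ℝ} {q : SmoothFun U}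

theorem rep_gaugeP (i : ℝ) (h : Rep Q q) (j k : Fin 3) :
    Rep (fun z => gaugeP i Q z j k) (jgaugeP i q j k) := by
  intro z
  fin_cases j <;> fin_cases k <;>
    simp [gaugeP, jgaugeP, h.pd 2 z, (h.pd 2).pd 2 z, (h.pd 2).pd 1 z, h.pd 1 z,
      h.tot ((h.pd 2).pd 2) z, Algebra.algebraMap_eq_smul_one]

theorem rep_gaugeL (i : ℝ) (h : Rep Q q) (j k : Fin 3) :
    Rep (fun z => gaugeL i Q z j k) (jgaugeL i q j k) := by
  intro z
  fin_cases j <;> fin_cases k <;>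
    simp [gaugeL, jgaugeL, h.pd 2 z, (h.pd 2).pd 2 z, (h.pd 2).pd 1 z, ((h.pd 2).pd 2).pd 2 z,
      ((h.pd 2).pd 2).pd 1 z, h.tot (((h.pd 2).pd 2).pd 2) z, mul_assoc,
      h.tot ((h.pd 2).pd 2) z, Algebra.algebraMap_eq_smul_one, pow_two]

theorem rep_gaugeM (i : ℝ) (h : Rep Q q) (j k : Fin 3) :
    Rep (fun z => gaugeM i Q z j k) (jgaugeM i q j k) := by
  intro z
  fin_cases j <;> fin_cases k <;>
    simp [gaugeM, jgaugeM, (h.pd 2).pd 2 z, ((h.pd 2).pd 2).pd 2 z]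

/-- The gauge form has no curvature component along `μ ∧ μ̄`. -/
theorem gauge_curvature_mu_mub {i : ℝ} (hi : i ≠ 0) (h : Rep Q q) (z : U) (j k : Fin 3) :
    pd 2 (fun z => gaugeP i Q z j k) z + i * gaugeL i Q z j k - pd 2 Q z * gaugeM i Q z j k
      - tot Q (fun z => gaugeM i Q z j k) z
      + ∑ l, (gaugeM i Q z j l * gaugeP i Q z l k - gaugeP i Q z j l * gaugeM i Q z l k) = 0 := by
  have hP (j k) : gaugeP i Q z j k = _ := rep_gaugeP i h j k z
  have hL (j k) : gaugeL i Q z j k = _ := rep_gaugeL i h j k z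
  have hM (j k) : gaugeM i Q z j k = _ := rep_gaugeM i h j k z
  simp only [(rep_gaugeP i h j k).pd 2 z, h.tot (rep_gaugeM i h j k) z, h.pd 2 z, hP, hL, hM]
  fin_cases j <;> fin_cases k <;>
    simp [jgaugeP, jgaugeL, jgaugeM, Fin.sum_univ_three, jd_two_jD, jd_two_one,
      Algebra.algebraMap_eq_smul_one] <;> field_simp <;> ring

theorem ofNat_apply (n : ℕ) [n.AtLeastTwo] (z : U) : (ofNat(n) : SmoothFun U).1 z = ofNat(n) := rfl

set_option maxHeartbeats 1000000 in
/-- The curvature component along `λ ∧ μ̄`; this is where `w₁` appears. -/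
theorem gauge_curvature_lam_mub {i : ℝ} (hi : i ≠ 0) (h : Rep Q q) (z : U) (j k : Fin 3) :
    -(pd 1 (fun z => gaugeP i Q z j k) z / i) - tot Q (fun z => gaugeL i Q z j k) z
      + pd 1 Q z * gaugeM i Q z j k / i
      + ∑ l, (gaugeL i Q z j l * gaugeP i Q z l k - gaugeP i Q z j l * gaugeL i Q z l k)
      = -gaugeKx i Q z j k := by
  have hP (j k) : gaugeP i Q z j k = _ := rep_gaugeP i h j k z
  have hL (j k) : gaugeL i Q z j k = _ := rep_gaugeL i h j k z
  have hM (j k) : gaugeM i Q z j k = _ := rep_gaugeM i h j k z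
  simp only [(rep_gaugeP i h j k).pd 1 z, h.tot (rep_gaugeL i h j k) z, h.pd 1 z, hP, hL, hM,
    gaugeKx, (rep_w₁ h).pd 2 z, rep_w₁ h z]
  fin_cases j <;> fin_cases k <;>
    simp [jgaugeP, jgaugeL, jgaugeM, Fin.sum_univ_three, jd_two_jD, jd_one_jD, jd_two_one,
      Algebra.algebraMap_eq_smul_one, jw₁, derivation_ofNat, ofNat_apply] <;> field_simp <;> ring

/-- The curvature component along `μ ∧ λ`; this is where `w₂` appears. -/
theorem gauge_curvature_mu_lam {i : ℝ} (hi : i ≠ 0) (h : Rep Q q) (z : U) (j k : Fin 3) :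
    pd 2 (fun z => gaugeL i Q z j k) z + pd 1 (fun z => gaugeM i Q z j k) z / i
      + ∑ l, (gaugeM i Q z j l * gaugeL i Q z l k - gaugeL i Q z j l * gaugeM i Q z l k)
      = gaugeKmu i Q z j k := by
  have hL (j k) : gaugeL i Q z j k = _ := rep_gaugeL i h j k z
  have hM (j k) : gaugeM i Q z j k = _ := rep_gaugeM i h j k z
  simp only [(rep_gaugeM i h j k).pd 1 z, (rep_gaugeL i h j k).pd 2 z, hL, hM,
    gaugeKmu, h.tot (rep_w₂ h) z, rep_w₂ h z, h.pd 2 z]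
  fin_cases j <;> fin_cases k <;>
    simp [jgaugeL, jgaugeM, Fin.sum_univ_three, jd_two_jD, jd_two_one,
      Algebra.algebraMap_eq_smul_one, jw₂] <;> field_simp <;> ring

theorem contDiffOn_mu {V : Set J1} (hQ : ContDiffOn ℝ ∞ Q V) : ContDiffOn ℝ ∞ (mu Q) V :=
  contDiffOn_const.sub (hQ.smul contDiffOn_const)

theorem contDiff_lam (i : ℝ) : ContDiff ℝ ∞ (lam i) := by
  unfold lam; fun_prop

theorem contDiff_mub : ContDiff ℝ ∞ mub := contDiff_const

theorem contDiffOn_gauge (i : ℝ) (h : Rep Q q) (j k : Fin 3) :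
    ContDiffOn ℝ ∞ (fun z => gauge i Q z j k) U :=
  (((rep_gaugeP i h j k).contDiffOn.smul contDiff_mub.contDiffOn).add
    ((rep_gaugeL i h j k).contDiffOn.smul (contDiff_lam i).contDiffOn)).add
    ((rep_gaugeM i h j k).contDiffOn.smul (contDiffOn_mu h.contDiffOn))

/-- The curvature of the gauge form. -/
theorem d_gauge {i : ℝ} (hi : i ≠ 0) (h : Rep Q q) (z : U) (j k : Fin 3) (v w : J1) :
    d (fun z => gauge i Q z j k) z v w
      + ∑ l, (gauge i Q z j l v * gauge i Q z l k w - gauge i Q z j l w * gauge i Q z l k v) =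
    gaugeKmu i Q z j k * (mu Q z ⋏ lam i z) v w + gaugeKx i Q z j k * (mub z ⋏ lam i z) v w := by
  have e : d (fun z => gauge i Q z j k) z v w = _ := d_frameForm hi (h.differentiableAt z)
    ((rep_gaugeP i h j k).differentiableAt z) ((rep_gaugeL i h j k).differentiableAt z)
    ((rep_gaugeM i h j k).differentiableAt z) v w
  have h1 := gauge_curvature_mu_mub hi h z j k
  have h2 := gauge_curvature_lam_mub hi h z j k
  have h3 := gauge_curvature_mu_lam hi h z j k
  rw [e]
  simp only [Fin.sum_univ_three, gauge, frameForm, add_apply, smul_apply, smul_eq_mul,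
    wedge_apply] at h1 h2 h3 ⊢
  linear_combination (mu Q z v * mub z w - mu Q z w * mub z v) * h1
    + (lam i z v * mub z w - lam i z w * mub z v) * h2
    + (mu Q z v * lam i z w - mu Q z w * lam i z v) * h3

end Gauge

/-! ### Matrix-valued functions -/

section MatrixCalculus

variable {E : Type*} [NormedAddCommGroup E] [NormedSpace ℝ E] {n : Type*} [Fintype n]
  [DecidableEq n]

open scoped Matrix.Norms.Operator

/-- Matrices as functions of two indices, as a topological isomorphism. -/
def matrixEquiv (n : Type*) [Fintype n] [DecidableEq n] : (n → n → ℝ) ≃L[ℝ] Matrix n n ℝ :=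
  LinearEquiv.toContinuousLinearEquiv (Matrix.ofLinearEquiv ℝ)

theorem contDiffAt_matrix {f : E → Matrix n n ℝ} {u : E} {m : WithTop ℕ∞}
    (h : ∀ j k, ContDiffAt ℝ m (fun x => f x j k) u) : ContDiffAt ℝ m f u :=
  (matrixEquiv n).contDiff.contDiffAt.comp u
    (contDiffAt_pi.2 fun j => contDiffAt_pi.2 fun k => h j k)

theorem differentiableAt_matrix {f : E → Matrix n n ℝ} {u : E}
    (h : ∀ j k, DifferentiableAt ℝ (fun x => f x j k) u) : DifferentiableAt ℝ f u :=
  (matrixEquiv n).differentiableAt.comp u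
    (differentiableAt_pi.2 fun j => differentiableAt_pi.2 fun k => h j k)

theorem fderiv_matrix_apply {f : E → Matrix n n ℝ} {u : E} (h : DifferentiableAt ℝ f u) (v : E)
    (j k : n) : fderiv ℝ f u v j k = fderiv ℝ (fun x => f x j k) u v := by
  let e : Matrix n n ℝ →L[ℝ] ℝ := (ContinuousLinearMap.proj k).comp
    ((ContinuousLinearMap.proj j : (n → n → ℝ) →L[ℝ] n → ℝ).comp
      (matrixEquiv n).symm.toContinuousLinearMap)
  exact (congrArg (· v) (e.hasFDerivAt.comp u h.hasFDerivAt).fderiv).symm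

/-- The differential at zero of the exponential map of matrices. -/
theorem hasDerivAt_exp_entry (M : Matrix n n ℝ) (j k : n) :
    HasDerivAt (fun t : ℝ => NormedSpace.exp (t • M) j k) (M j k) 0 := by
  have h : HasDerivAt (fun t : ℝ => NormedSpace.exp (t • M)) M 0 := by
    have := hasDerivAt_exp_smul_const (𝕂 := ℝ) M (0 : ℝ)
    rw [zero_smul, NormedSpace.exp_zero, one_mul] at this
    exact this
  let e : Matrix n n ℝ →L[ℝ] ℝ := (ContinuousLinearMap.proj k).comp
    ((ContinuousLinearMap.proj j : (n → n → ℝ) →L[ℝ] n → ℝ).comp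
      (matrixEquiv n).symm.toContinuousLinearMap)
  exact e.hasFDerivAt.comp_hasDerivAt _ h

end MatrixCalculus

/-! ### The bundle -/

section Bundle

/-- The projection to the jet space as a linear map. -/
def baseL : R8 →L[ℝ] J1 := ContinuousLinearMap.pi ![dc 0, dc 1, dc 2]

theorem base_eq : base = baseL := by
  funext w k; fin_cases k <;> rfl

theorem hasFDerivAt_base (w : R8) : HasFDerivAt base baseL w := base_eq ▸ baseL.hasFDerivAt

theorem contDiff_base : ContDiff ℝ ∞ base := base_eq ▸ baseL.contDiff

/-- The upper triangular matrix of determinant one with the fibre coordinates of `u` as entries. -/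
def fiberMat (u : R8) : Matrix (Fin 3) (Fin 3) ℝ :=
  !![u 3, u 5, u 7; 0, u 4, u 6; 0, 0, (u 3 * u 4)⁻¹]

/-- The inverse of `fiberMat u`. -/
def fiberInv (u : R8) : Matrix (Fin 3) (Fin 3) ℝ :=
  !![(u 3)⁻¹, -(u 5 * (u 3 * u 4)⁻¹), u 5 * u 6 - u 7 * u 4; 0, (u 4)⁻¹, -(u 6 * u 3);
    0, 0, u 3 * u 4]

/-- The differential of `fiberMat`. -/
def dFiber (u : R8) : Matrix (Fin 3) (Fin 3) (R8 →L[ℝ] ℝ) :=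
  !![dc 3, dc 5, dc 7; 0, dc 4, dc 6; 0, 0, -((u 3 * u 4) ^ 2)⁻¹ • (u 3 • dc 4 + u 4 • dc 3)]

theorem fiberMat_mul_fiberInv {u : R8} (h3 : u 3 ≠ 0) (h4 : u 4 ≠ 0) :
    fiberMat u * fiberInv u = 1 := by
  ext j k
  fin_cases j <;> fin_cases k <;>
    simp [fiberMat, fiberInv, Matrix.mul_apply, Fin.sum_univ_three, h3, h4] <;> field_simp <;> ring

theorem fiberInv_mul_fiberMat {u : R8} (h3 : u 3 ≠ 0) (h4 : u 4 ≠ 0) :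
    fiberInv u * fiberMat u = 1 :=
  mul_eq_one_comm.1 (fiberMat_mul_fiberInv h3 h4)

theorem hasFDerivAt_coord (k : Fin 8) (u : R8) : HasFDerivAt (fun u : R8 => u k) (dc k) u :=
  (dc k).hasFDerivAt

theorem hasFDerivAt_fiberMat {u : R8} (h3 : u 3 ≠ 0) (h4 : u 4 ≠ 0) (j k : Fin 3) :
    HasFDerivAt (fun u => fiberMat u j k) (dFiber u j k) u := by
  fin_cases j <;> fin_cases k
  all_goals first
    | exact hasFDerivAt_const _ _
    | exact hasFDerivAt_coord _ _
    | exact (hasDerivAt_inv (mul_ne_zero h3 h4)).comp_hasFDerivAt u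
        ((hasFDerivAt_coord 3 u).fun_mul (hasFDerivAt_coord 4 u))

variable (i : ℝ) (Q : J1 → ℝ)

/-- The matrix of one-forms `F⁻¹ A F + F⁻¹ dF`, where `F = fiberMat` and `A` is the gauge form on
the jet space. -/
def cartanForm (u : R8) : Matrix (Fin 3) (Fin 3) (R8 →L[ℝ] ℝ) :=
  fun j k => ∑ l, fiberInv u j l •
    ((∑ m, fiberMat u m k • (gauge i Q (base u) l m).comp baseL) + dFiber u l k)

/-- The values of a matrix of one-forms on a vector. -/
def evalM {E : Type*} [NormedAddCommGroup E] [NormedSpace ℝ E]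
    (A : Matrix (Fin 3) (Fin 3) (E →L[ℝ] ℝ)) (v : E) : Matrix (Fin 3) (Fin 3) ℝ :=
  A.map fun α => α v

theorem evalM_cartanForm (u v : R8) : evalM (cartanForm i Q u) v =
    fiberInv u * (evalM (gauge i Q (base u)) (baseL v) * fiberMat u + evalM (dFiber u) v) := by
  ext j k
  simp [evalM, cartanForm, Matrix.mul_apply, mul_comm, mul_add]

/-- The total space over `U`: the points `u` with `(u 0, u 1, u 2)` in `U` and `fiberMat u`
invertible. -/
def total (U : Set J1) : Set R8 := {u | base u ∈ U ∧ u 3 ≠ 0 ∧ u 4 ≠ 0}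

theorem isOpen_total {U : Set J1} (hU : IsOpen U) : IsOpen (total U) :=
  (hU.preimage contDiff_base.continuous).inter
    ((isOpen_ne.preimage (continuous_apply 3)).inter (isOpen_ne.preimage (continuous_apply 4)))

/-- The Cartan coframe `P (U, Q)`: its manifold is `U` times the group `H` of upper triangular
matrices, its forms are read off from the entries of `cartanForm`, and `R, R̄, S, S̄` from the
curvature of `cartanForm`. -/
def bundle (i : ℝ) (U : Set J1) (Q : J1 → ℝ) : CartanData where
  P := total U
  π := base
  a u := u 3 ^ 2 * u 4
  b u := u 3 * (u 4)⁻¹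
  bb u := u 3 * u 4 ^ 2
  c u := -2 * u 6 * u 3 ^ 2
  cb u := i⁻¹ * (u 5 * u 3 * u 4)
  θ₁ u := cartanForm i Q u 1 0
  θ₂ u := (2 * i)⁻¹ • cartanForm i Q u 2 1
  θ₃ u := (1 / 2 : ℝ) • cartanForm i Q u 2 0
  Ω₂ u := cartanForm i Q u 0 0 - cartanForm i Q u 1 1
  Ω₂b u := cartanForm i Q u 1 1 - cartanForm i Q u 2 2
  Ω₃ u := (-2 : ℝ) • cartanForm i Q u 1 2
  Ω₃b u := i⁻¹ • cartanForm i Q u 0 1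
  Ω₄ u := (-2 : ℝ) • cartanForm i Q u 0 2
  R u := -(1 / (6 * i ^ 2)) * ((u 3)⁻¹ ^ 4 * (u 4)⁻¹ ^ 5) * w₁ Q (base u)
  Rb u := -(1 / (6 * i ^ 2)) * ((u 3)⁻¹ ^ 4 * u 4) * w₂ Q (base u)
  S u := 1 / (6 * i ^ 2) * ((u 3)⁻¹ ^ 5 * (u 4)⁻¹ ^ 4)
    * (pd 2 (w₁ Q) (base u) + u 5 * (u 4)⁻¹ * w₁ Q (base u))
  Sb u := 1 / (6 * i ^ 2) * ((u 3)⁻¹ ^ 5 * (u 4)⁻¹)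
    * (tot Q (w₂ Q) (base u) + (2 * pd 2 Q (base u) + 2 * i * (u 6 * u 3 * u 4)) * w₂ Q (base u))

variable {i Q} {U : Set J1}

theorem rep_of_contDiffOn (hU : IsOpen U) (hQ : ContDiffOn ℝ ∞ Q U) :
    Rep Q (toSmooth (U := ⟨U, hU⟩) Q hQ) := rep_toSmooth Q hQ

theorem contDiffOn_coord (k : Fin 8) (V : Set R8) : ContDiffOn ℝ ∞ (fun u : R8 => u k) V :=
  (dc k).contDiff.contDiffOn

theorem contDiffOn_inv_three : ContDiffOn ℝ ∞ (fun u : R8 => (u 3)⁻¹) (total U) :=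
  (contDiffOn_coord 3 _).inv fun _ h => h.2.1

theorem contDiffOn_inv_four : ContDiffOn ℝ ∞ (fun u : R8 => (u 4)⁻¹) (total U) :=
  (contDiffOn_coord 4 _).inv fun _ h => h.2.2

theorem contDiffOn_inv_mul : ContDiffOn ℝ ∞ (fun u : R8 => (u 3 * u 4)⁻¹) (total U) :=
  ((contDiffOn_coord 3 _).mul (contDiffOn_coord 4 _)).inv fun _ h => mul_ne_zero h.2.1 h.2.2

theorem contDiffOn_comp_base {F : Type*} [NormedAddCommGroup F] [NormedSpace ℝ F] {f : J1 → F}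
    (hf : ContDiffOn ℝ ∞ f U) : ContDiffOn ℝ ∞ (fun u : R8 => f (base u)) (total U) :=
  hf.comp contDiff_base.contDiffOn fun _ h => h.1

theorem contDiffOn_fiberMat (j k : Fin 3) :
    ContDiffOn ℝ ∞ (fun u => fiberMat u j k) (total U) := by
  fin_cases j <;> fin_cases k <;> first
    | exact contDiffOn_const
    | exact contDiffOn_coord _ _
    | exact contDiffOn_inv_mul

theorem contDiffOn_fiberInv (j k : Fin 3) :
    ContDiffOn ℝ ∞ (fun u => fiberInv u j k) (total U) := by
  fin_cases j <;> fin_cases k <;> first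
    | exact contDiffOn_const
    | exact contDiffOn_inv_three
    | exact contDiffOn_inv_four
    | exact (contDiffOn_coord 3 _).mul (contDiffOn_coord 4 _)
    | exact ((contDiffOn_coord 5 _).mul contDiffOn_inv_mul).neg
    | exact ((contDiffOn_coord 6 _).mul (contDiffOn_coord 3 _)).neg
    | exact ((contDiffOn_coord 5 _).mul (contDiffOn_coord 6 _)).sub
        ((contDiffOn_coord 7 _).mul (contDiffOn_coord 4 _))

theorem contDiffOn_dFiber (j k : Fin 3) :
    ContDiffOn ℝ ∞ (fun u => dFiber u j k) (total U) := by
  fin_cases j <;> fin_cases k <;> first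
    | exact contDiffOn_const
    | exact (((((contDiffOn_coord 3 _).mul (contDiffOn_coord 4 _)).pow 2).inv
        fun _ h => pow_ne_zero _ (mul_ne_zero h.2.1 h.2.2)).neg).smul
        (((contDiffOn_coord 3 _).smul contDiffOn_const).add
          ((contDiffOn_coord 4 _).smul contDiffOn_const))

theorem contDiffOn_gauge_base (hU : IsOpen U) (hQ : ContDiffOn ℝ ∞ Q U) (j k : Fin 3) :
    ContDiffOn ℝ ∞ (fun u : R8 => (gauge i Q (base u) j k).comp baseL) (total U) :=
  (contDiffOn_comp_base (contDiffOn_gauge i (rep_of_contDiffOn hU hQ) j k)).clm_comp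
    contDiffOn_const

theorem contDiffOn_cartanForm (hU : IsOpen U) (hQ : ContDiffOn ℝ ∞ Q U) (j k : Fin 3) :
    ContDiffOn ℝ ∞ (fun u => cartanForm i Q u j k) (total U) :=
  ContDiffOn.sum fun _ _ => (contDiffOn_fiberInv _ _).smul
    ((ContDiffOn.sum fun _ _ => (contDiffOn_fiberMat _ _).smul
      (contDiffOn_gauge_base hU hQ _ _)).add (contDiffOn_dFiber _ _))

/-- The curvature of the gauge form, pulled back to the bundle. -/
def pulledCurvature (i : ℝ) (Q : J1 → ℝ) (u v w : R8) : Matrix (Fin 3) (Fin 3) ℝ := fun j k =>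
  gaugeKmu i Q (base u) j k * (mu Q (base u) ⋏ lam i (base u)) (baseL v) (baseL w)
    + gaugeKx i Q (base u) j k * (mub (base u) ⋏ lam i (base u)) (baseL v) (baseL w)

open scoped Matrix.Norms.Operator in
/-- The curvature of `cartanForm` is the curvature of the gauge form, conjugated by `fiberMat`. -/
theorem curvature_cartanForm (hi : i ≠ 0) (hU : IsOpen U) (hQ : ContDiffOn ℝ ∞ Q U) {u : R8}
    (hu : u ∈ total U) (j k : Fin 3) (v w : R8) :
    d (fun u => cartanForm i Q u j k) u v w + ∑ l, (cartanForm i Q u j l v * cartanForm i Q u l k w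
        - cartanForm i Q u j l w * cartanForm i Q u l k v) =
      (fiberInv u * pulledCurvature i Q u v w * fiberMat u) j k := by
  have hP := isOpen_total hU
  have hq := rep_of_contDiffOn hU hQ
  have hnhds : ∀ᶠ x in nhds u, x ∈ total U := hP.mem_nhds hu
  have hf : ContDiffAt ℝ 2 fiberMat u := contDiffAt_matrix fun j k =>
    (contDiffAt_of_mem hP (contDiffOn_fiberMat j k) hu).of_le two_le_infty
  have hg : DifferentiableAt ℝ fiberInv u := differentiableAt_matrix fun j k =>
    differentiableAt_of_mem hP (contDiffOn_fiberInv j k) hu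
  have hdf {x : R8} (hx : x ∈ total U) (v : R8) : fderiv ℝ fiberMat x v = evalM (dFiber x) v := by
    ext j k
    rw [fderiv_matrix_apply (differentiableAt_matrix fun j k =>
      (hasFDerivAt_fiberMat hx.2.1 hx.2.2 j k).differentiableAt),
      (hasFDerivAt_fiberMat hx.2.1 hx.2.2 j k).fderiv]
    rfl
  let a : R8 → R8 →L[ℝ] Matrix (Fin 3) (Fin 3) ℝ := fun x =>
    (matrixEquiv (Fin 3)).toContinuousLinearMap.comp
      (ContinuousLinearMap.pi fun j => ContinuousLinearMap.pi fun k =>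
        (gauge i Q (base x) j k).comp baseL)
  have hga (j k : Fin 3) := contDiffOn_gauge_base (i := i) hU hQ j k
  have hav (v : R8) (j k : Fin 3) : ContDiffOn ℝ ∞ (fun x => a x v j k) (total U) :=
    (hga j k).clm_apply contDiffOn_const
  have ha : DifferentiableAt ℝ a u := by
    refine differentiableAt_of_mem hP (contDiffOn_clm_apply.2 fun v x hx => ?_) hu
    exact (contDiffAt_matrix fun j k => contDiffAt_of_mem hP (hav v j k) hx).contDiffWithinAt
  have hcd (j k : Fin 3) := differentiableAt_of_mem hP (contDiffOn_cartanForm (i := i) hU hQ j k) hu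
  have key := gauge_curvature (W := fun x w => evalM (cartanForm i Q x) w)
    (da := fun v w j k => fderiv ℝ (fun z => gauge i Q z j k) (base u) (baseL v) (baseL w))
    (dW := fun v w j k => fderiv ℝ (fun x => cartanForm i Q x j k) u v w) hf hg ha
    (by filter_upwards [hnhds] with x hx using fiberMat_mul_fiberInv hx.2.1 hx.2.2)
    (fiberInv_mul_fiberMat hu.2.1 hu.2.2)
    (by
      filter_upwards [hnhds] with x hx w
      have h1 : fiberInv x * (evalM (gauge i Q (base x)) (baseL w) * fiberMat x
          + evalM (dFiber x) w) = fiberInv x * evalM (gauge i Q (base x)) (baseL w) * fiberMat x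
          + fiberInv x * evalM (dFiber x) w := by rw [mul_add, mul_assoc]
      exact (evalM_cartanForm i Q x w).trans (h1.trans (congrArg (fun Y => fiberInv x *
        evalM (gauge i Q (base x)) (baseL w) * fiberMat x + fiberInv x * Y) (hdf hx w).symm)))
    (fun v w => by
      funext j k
      refine (fderiv_matrix_apply (differentiableAt_matrix fun j k =>
        differentiableAt_of_mem hP (hav w j k) hu) v j k).trans ?_
      have h2 := differentiableAt_of_mem hU (contDiffOn_gauge i hq j k) hu.1
      have h3 : HasFDerivAt (fun x => gauge i Q (base x) j k)
        ((fderiv ℝ (fun z => gauge i Q z j k) (base u)).comp baseL) u :=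
        h2.hasFDerivAt.comp u (hasFDerivAt_base u)
      exact (fderiv_form_apply h3.differentiableAt v (baseL w)).trans (by rw [h3.fderiv]; rfl))
    (fun v w => by
      funext j k
      refine (fderiv_matrix_apply (f := fun x => evalM (cartanForm i Q x) w)
        (differentiableAt_matrix fun j k => (hcd j k).clm_apply (differentiableAt_const w))
        v j k).trans ?_
      exact fderiv_form_apply (hcd j k) v w) v w
  have key' := congrFun (congrFun key j) k
  rw [d_apply (hcd j k)]
  simp only [Finset.sum_sub_distrib]
  refine Eq.trans key' (congrFun (congrFun
    (congrArg (fun X => fiberInv u * X * fiberMat u) ?_) j) k)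
  ext j k
  have h4 := d_gauge hi hq ⟨base u, hu.1⟩ j k (baseL v) (baseL w)
  rw [d_apply (differentiableAt_of_mem hU (contDiffOn_gauge i hq j k) hu.1)] at h4
  simp only [Finset.sum_sub_distrib] at h4
  exact h4

end Bundle

/-! ### The structure equations -/

section Structure

variable {i : ℝ} {Q : J1 → ℝ} {U : Set J1}

theorem gauge_apply (i : ℝ) (Q : J1 → ℝ) (z v : J1) (j k : Fin 3) :
    gauge i Q z j k v = gaugeP i Q z j k * mub z v + gaugeL i Q z j k * lam i z v
      + gaugeM i Q z j k * mu Q z v := rfl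

theorem cartanForm_apply (i : ℝ) (Q : J1 → ℝ) (u v : R8) (j k : Fin 3) :
    cartanForm i Q u j k v = ∑ l, fiberInv u j l *
      ((∑ m, fiberMat u m k * gauge i Q (base u) l m (baseL v)) + dFiber u l k v) := by
  simp [cartanForm, mul_add]

theorem pull_base (α : J1 → J1 →L[ℝ] ℝ) (u v : R8) :
    pull base α u v = α (base u) (baseL v) := by
  rw [pull, (hasFDerivAt_base u).fderiv]; rfl

theorem cartanForm_one_zero (u v : R8) : cartanForm i Q u 1 0 v =
    (bundle i U Q).b u * mu Q (base u) (baseL v)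
      + (bundle i U Q).c u * lam i (base u) (baseL v) := by
  simp [cartanForm_apply, Fin.sum_univ_three, fiberInv, fiberMat, dFiber, gauge_apply, gaugeP,
    gaugeL, gaugeM, bundle]
  ring

theorem cartanForm_two_one {u : R8} (h3 : u 3 ≠ 0) (h4 : u 4 ≠ 0) (hi : i ≠ 0) (v : R8) :
    cartanForm i Q u 2 1 v = 2 * i * ((bundle i U Q).bb u * mub (base u) (baseL v)
      + (bundle i U Q).cb u * lam i (base u) (baseL v)) := by
  simp [cartanForm_apply, Fin.sum_univ_three, fiberInv, fiberMat, dFiber, gauge_apply, gaugeP,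
    gaugeL, gaugeM, bundle]
  field_simp
  ring

theorem cartanForm_two_zero (u v : R8) : cartanForm i Q u 2 0 v =
    2 * ((bundle i U Q).a u * lam i (base u) (baseL v)) := by
  simp [cartanForm_apply, Fin.sum_univ_three, fiberInv, fiberMat, dFiber, gauge_apply, gaugeP,
    gaugeL, gaugeM, bundle]
  ring

/-- The connection takes values in `sl(3, ℝ)`. -/
theorem trace_cartanForm {u : R8} (h3 : u 3 ≠ 0) (h4 : u 4 ≠ 0) (v : R8) :
    cartanForm i Q u 0 0 v + cartanForm i Q u 1 1 v + cartanForm i Q u 2 2 v = 0 := by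
  simp [cartanForm_apply, Fin.sum_univ_three, fiberInv, fiberMat, dFiber, gauge_apply, gaugeP,
    gaugeL, gaugeM, dc]
  field_simp
  ring

/-- The curvature in terms of the coframe. -/
theorem conj_pulledCurvature (hi : i ≠ 0) {u : R8} (h3 : u 3 ≠ 0) (h4 : u 4 ≠ 0) (v w : R8) :
    fiberInv u * pulledCurvature i Q u v w * fiberMat u =
      let X := bundle i U Q
      !![0, i * X.Rb u * (X.θ₁ u ⋏ X.θ₃ u) v w,
          -1 / 2 * X.Sb u * (X.θ₁ u ⋏ X.θ₃ u) v w + -1 / 2 * X.S u * (X.θ₂ u ⋏ X.θ₃ u) v w;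
        0, 0, -1 / 2 * X.R u * (X.θ₂ u ⋏ X.θ₃ u) v w;
        0, 0, 0] := by
  have e1 (v : R8) : (bundle i U Q).θ₁ u v = _ := cartanForm_one_zero (U := U) u v
  have e2 (v : R8) : (bundle i U Q).θ₂ u v = _ :=
    congrArg ((2 * i)⁻¹ * ·) (cartanForm_two_one (U := U) h3 h4 hi v)
  have e3 (v : R8) : (bundle i U Q).θ₃ u v = _ :=
    congrArg ((1 / 2 : ℝ) * ·) (cartanForm_two_zero (U := U) u v)
  ext j k
  simp only [wedge_apply, e1, e2, e3, Matrix.mul_apply, Fin.sum_univ_three, pulledCurvature]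
  fin_cases j <;> fin_cases k <;>
    simp [fiberInv, fiberMat, gaugeKmu, gaugeKx, bundle] <;> field_simp <;> ring

theorem contDiffOn_of_rep {f : J1 → ℝ} (hU : IsOpen U)
    {q : SmoothFun ⟨U, hU⟩} (h : Rep f q) :
    ContDiffOn ℝ ∞ (fun u : R8 => f (base u)) (total U) := contDiffOn_comp_base h.contDiffOn

theorem connForm_bundle (hi : i ≠ 0) {u : R8} (hu : u ∈ total U) :
    connForm i (bundle i U Q) u = cartanForm i Q u := by
  have ht := fun v => trace_cartanForm (i := i) (Q := Q) hu.2.1 hu.2.2 v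
  ext j k v
  fin_cases j <;> fin_cases k <;> simp [connForm, bundle] <;> first
    | (field_simp; done)
    | linear_combination (-1 / 3 : ℝ) * ht v

/-- Covectors without a common zero are linearly independent and their values can be prescribed. -/
theorem coframe_of_injective {f : Fin 8 → R8 →L[ℝ] ℝ} (h : ∀ v, (∀ k, f k v = 0) → v = 0) :
    LinearIndependent ℝ f ∧ ∀ c : Fin 8 → ℝ, ∃ v, ∀ k, f k v = c k := by
  let T : R8 →ₗ[ℝ] R8 := LinearMap.pi fun k => (f k).toLinearMap
  have hT : Function.Injective T := (injective_iff_map_eq_zero T).2 fun v hv =>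
    h v fun k => congrFun hv k
  have hs : ∀ c : Fin 8 → ℝ, ∃ v, ∀ k, f k v = c k := fun c =>
    let ⟨v, hv⟩ := LinearMap.injective_iff_surjective.1 hT c
    ⟨v, fun k => congrFun hv k⟩
  refine ⟨Fintype.linearIndependent_iff.2 fun g hg k => ?_, hs⟩
  obtain ⟨v, hv⟩ := hs (Pi.single k 1)
  have := congrArg (· v) hg
  simpa [hv, Pi.single_apply] using this

theorem baseL_apply (v : R8) : baseL v = ![v 0, v 1, v 2] := (congrFun base_eq v).symm

/-- The coframe of the bundle as a family. -/
def coframeOf (X : CartanData) (u : R8) : Fin 8 → R8 →L[ℝ] ℝ :=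
  ![X.θ₁ u, X.θ₂ u, X.θ₃ u, X.Ω₂ u, X.Ω₂b u, X.Ω₃ u, X.Ω₃b u, X.Ω₄ u]

theorem cartanForm_eq_zero_of_coframe (hi : i ≠ 0) {u v : R8} (hu : u ∈ total U)
    (h : ∀ k, coframeOf (bundle i U Q) u k v = 0) : evalM (cartanForm i Q u) v = 0 := by
  have ht := trace_cartanForm (i := i) (Q := Q) hu.2.1 hu.2.2 v
  have h0 := h 0; have h1 := h 1; have h2 := h 2; have h3 := h 3; have h4 := h 4
  have h5 := h 5; have h6 := h 6; have h7 := h 7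
  simp [coframeOf, bundle, hi] at h0 h1 h2 h3 h4 h5 h6 h7
  ext j k
  fin_cases j <;> fin_cases k <;> simp [evalM] <;> linarith

/-- The connection is injective on tangent spaces: `θ¹, θ², θ³` detect the horizontal directions,
and the remaining entries are the Maurer-Cartan form of the fibre. -/
theorem eq_zero_of_cartanForm (hi : i ≠ 0) {u v : R8} (hu : u ∈ total U)
    (h : evalM (cartanForm i Q u) v = 0) : v = 0 := by
  obtain ⟨hz, h3, h4⟩ := hu
  have e (j k) : cartanForm i Q u j k v = 0 := congrFun (congrFun h j) k
  have e20 := e 2 0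
  have e21 := e 2 1
  have e10 := e 1 0
  rw [cartanForm_two_zero (U := U)] at e20
  rw [cartanForm_two_one (U := U) h3 h4 hi] at e21
  rw [cartanForm_one_zero (U := U)] at e10
  have l0 : lam i (base u) (baseL v) = 0 := by
    simpa [bundle, h3, h4] using e20
  have x0 : mub (base u) (baseL v) = 0 := by
    simpa [bundle, h3, h4, hi, l0] using e21
  have m0 : mu Q (base u) (baseL v) = 0 := by
    simpa [bundle, h3, h4, l0] using e10
  have hg : evalM (gauge i Q (base u)) (baseL v) = 0 := by
    ext j k
    simp [evalM, gauge_apply, l0, x0, m0]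
  have hd : evalM (dFiber u) v = 0 := by
    rw [evalM_cartanForm, hg, zero_mul, zero_add] at h
    have := congrArg (fiberMat u * ·) h
    simpa [← mul_assoc, fiberMat_mul_fiberInv h3 h4] using this
  have d (j k) : dFiber u j k v = 0 := congrFun (congrFun hd j) k
  rw [mub_apply, baseL_apply] at x0
  rw [lam_apply, baseL_apply] at l0
  rw [mu_apply, baseL_apply] at m0
  simp [hi] at x0 l0 m0
  simp [x0] at l0 m0
  ext k
  fin_cases k
  exacts [x0, l0, m0, d 0 0, d 1 1, d 0 1, d 1 2, d 0 2]

theorem coframe_bundle (hi : i ≠ 0) {u : R8} (hu : u ∈ total U) :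
    LinearIndependent ℝ (coframeOf (bundle i U Q) u) ∧
      ∀ c : Fin 8 → ℝ, ∃ v, ∀ k, coframeOf (bundle i U Q) u k v = c k :=
  coframe_of_injective fun _ h =>
    eq_zero_of_cartanForm hi hu (cartanForm_eq_zero_of_coframe hi hu h)

theorem bundle_θ₁ (u : R8) : (bundle i U Q).θ₁ u = cartanForm i Q u 1 0 := rfl
theorem bundle_θ₂ (u : R8) : (bundle i U Q).θ₂ u = (2 * i)⁻¹ • cartanForm i Q u 2 1 := rfl
theorem bundle_θ₃ (u : R8) : (bundle i U Q).θ₃ u = (1 / 2 : ℝ) • cartanForm i Q u 2 0 := rfl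
theorem bundle_Ω₂ (u : R8) :
    (bundle i U Q).Ω₂ u = cartanForm i Q u 0 0 - cartanForm i Q u 1 1 := rfl
theorem bundle_Ω₂b (u : R8) :
    (bundle i U Q).Ω₂b u = cartanForm i Q u 1 1 - cartanForm i Q u 2 2 := rfl
theorem bundle_Ω₃ (u : R8) : (bundle i U Q).Ω₃ u = (-2 : ℝ) • cartanForm i Q u 1 2 := rfl
theorem bundle_Ω₃b (u : R8) : (bundle i U Q).Ω₃b u = i⁻¹ • cartanForm i Q u 0 1 := rfl
theorem bundle_Ω₄ (u : R8) : (bundle i U Q).Ω₄ u = (-2 : ℝ) • cartanForm i Q u 0 2 := rfl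

set_option linter.unusedSimpArgs false in
theorem isCartanCoframe_bundle (hi : i ≠ 0) (hU : IsOpen U) (hQ : ContDiffOn ℝ ∞ Q U) :
    IsCartanCoframe i U Q (bundle i U Q) := by
  have hP := isOpen_total hU
  have hq := rep_of_contDiffOn hU hQ
  have hc (j k : Fin 3) := contDiffOn_cartanForm (i := i) hU hQ j k
  have x (k : Fin 8) : ContDiffOn ℝ ∞ (fun u : R8 => u k) (total U) := contDiffOn_coord k _
  have y3 : ContDiffOn ℝ ∞ (fun u : R8 => (u 3)⁻¹) (total U) := contDiffOn_inv_three
  have y4 : ContDiffOn ℝ ∞ (fun u : R8 => (u 4)⁻¹) (total U) := contDiffOn_inv_four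
  have hw1 := contDiffOn_of_rep hU (rep_w₁ hq)
  have hw1p := contDiffOn_of_rep hU ((rep_w₁ hq).pd 2)
  have hw2 := contDiffOn_of_rep hU (rep_w₂ hq)
  have hDw2 := contDiffOn_of_rep hU (hq.tot (rep_w₂ hq))
  have hQp := contDiffOn_of_rep hU (hq.pd 2)
  have c {r : ℝ} : ContDiffOn ℝ ∞ (fun _ : R8 => r) (total U) := contDiffOn_const
  have da {u : R8} (hu : u ∈ total U) (j k : Fin 3) := differentiableAt_of_mem hP (hc j k) hu
  have hii : i * i⁻¹ = 1 := mul_inv_cancel₀ hi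
  -- The structure equations are the entries of the curvature equation.
  have curv {u : R8} (hu : u ∈ total U) (j k : Fin 3) (v w : R8) :=
    (curvature_cartanForm hi hU hQ hu j k v w).trans
      (congrFun (congrFun (conj_pulledCurvature (U := U) hi hu.2.1 hu.2.2 v w) j) k)
  refine
    { isOpen := hP
      smooth_proj := contDiff_base.contDiffOn
      mapsTo := fun u hu => hu.1
      smooth_fun := ?_
      smooth_form := ?_
      ne_zero := fun u hu => ⟨mul_ne_zero (pow_ne_zero _ hu.2.1) hu.2.2,
        mul_ne_zero hu.2.1 (inv_ne_zero hu.2.2), mul_ne_zero hu.2.1 (pow_ne_zero _ hu.2.2)⟩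
      θ₁_eq := fun u hu => ?_
      θ₂_eq := fun u hu => ?_
      θ₃_eq := fun u hu => ?_
      coframe := fun u hu => (coframe_bundle hi hu).1
      d_θ₁ := fun u hu => ?_
      d_θ₂ := fun u hu => ?_
      d_θ₃ := fun u hu => ?_
      d_Ω₂ := fun u hu => ?_
      d_Ω₂b := fun u hu => ?_
      d_Ω₃ := fun u hu => ?_
      d_Ω₃b := fun u hu => ?_
      d_Ω₄ := fun u hu => ?_ }
  · simp only [List.mem_cons, List.not_mem_nil, or_false, forall_eq_or_imp, forall_eq]
    exact ⟨((x 3).pow 2).mul (x 4), (x 3).mul y4, (x 3).mul ((x 4).pow 2),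
      (c.mul (x 6)).mul ((x 3).pow 2), c.mul (((x 5).mul (x 3)).mul (x 4)),
      (c.mul ((y3.pow 4).mul (y4.pow 5))).mul hw1, (c.mul ((y3.pow 4).mul (x 4))).mul hw2,
      (c.mul ((y3.pow 5).mul (y4.pow 4))).mul (hw1p.add (((x 5).mul y4).mul hw1)),
      (c.mul ((y3.pow 5).mul y4)).mul (hDw2.add
        (((c.mul hQp).add (c.mul (((x 6).mul (x 3)).mul (x 4)))).mul hw2))⟩
  · simp only [List.mem_cons, List.not_mem_nil, or_false, forall_eq_or_imp, forall_eq]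
    exact ⟨hc 1 0, (hc 2 1).const_smul _, (hc 2 0).const_smul _, (hc 0 0).sub (hc 1 1),
      (hc 1 1).sub (hc 2 2), (hc 1 2).const_smul _, (hc 0 1).const_smul _, (hc 0 2).const_smul _⟩
  · ext v
    simp only [add_apply, smul_apply, smul_eq_mul]
    erw [pull_base, pull_base]
    exact cartanForm_one_zero u v
  · ext v
    simp only [add_apply, smul_apply, smul_eq_mul]
    erw [pull_base, pull_base]
    refine (congrArg ((2 * i)⁻¹ * ·) (cartanForm_two_one (U := U) hu.2.1 hu.2.2 hi v)).trans ?_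
    field_simp
  · ext v
    simp only [smul_apply, smul_eq_mul]
    erw [pull_base]
    refine (congrArg ((1 / 2 : ℝ) * ·) (cartanForm_two_zero (U := U) u v)).trans ?_
    field_simp
  · funext v w
    have h0 := curv hu 1 0 v w
    simp [Fin.sum_univ_three] at h0
    change d (fun u => cartanForm i Q u 1 0) u v w = _
    simp only [bundle_θ₁, bundle_θ₂, bundle_θ₃, bundle_Ω₂, bundle_Ω₂b, bundle_Ω₃, bundle_Ω₃b,
      bundle_Ω₄, wedge_apply, Pi.add_apply, Pi.sub_apply, Pi.smul_apply, add_apply, sub_apply,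
      smul_apply, smul_eq_mul]
    linear_combination h0
  · funext v w
    have h0 := curv hu 2 1 v w
    simp [Fin.sum_univ_three, wedge_apply, bundle_θ₁, bundle_θ₂, bundle_θ₃] at h0
    change d (fun u => (2 * i)⁻¹ • cartanForm i Q u 2 1) u v w = _
    rw [d_const_smul _ (da hu 2 1)]
    simp only [bundle_θ₁, bundle_θ₂, bundle_θ₃, bundle_Ω₂, bundle_Ω₂b, bundle_Ω₃, bundle_Ω₃b,
      bundle_Ω₄, wedge_apply, Pi.add_apply, Pi.sub_apply, Pi.smul_apply, add_apply, sub_apply,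
      smul_apply, smul_eq_mul]
    linear_combination (2 * i)⁻¹ * h0
  · funext v w
    have h0 := curv hu 2 0 v w
    simp [Fin.sum_univ_three, wedge_apply, bundle_θ₁, bundle_θ₂, bundle_θ₃] at h0
    change d (fun u => (1 / 2 : ℝ) • cartanForm i Q u 2 0) u v w = _
    rw [d_const_smul _ (da hu 2 0)]
    simp only [bundle_θ₁, bundle_θ₂, bundle_θ₃, bundle_Ω₂, bundle_Ω₂b, bundle_Ω₃, bundle_Ω₃b,
      bundle_Ω₄, wedge_apply, Pi.add_apply, Pi.sub_apply, Pi.smul_apply, add_apply, sub_apply,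
      smul_apply, smul_eq_mul]
    linear_combination 1 / 2 * h0 - 1 / 2 * (cartanForm i Q u 1 0 v * cartanForm i Q u 2 1 w -
        cartanForm i Q u 1 0 w * cartanForm i Q u 2 1 v) * hii
  · funext v w
    have h0 := curv hu 0 0 v w
    simp [Fin.sum_univ_three, wedge_apply, bundle_θ₁, bundle_θ₂, bundle_θ₃] at h0
    have h1 := curv hu 1 1 v w
    simp [Fin.sum_univ_three, wedge_apply, bundle_θ₁, bundle_θ₂, bundle_θ₃] at h1
    change d (fun u => cartanForm i Q u 0 0 - cartanForm i Q u 1 1) u v w = _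
    rw [d_sub (da hu 0 0) (da hu 1 1)]
    simp only [bundle_θ₁, bundle_θ₂, bundle_θ₃, bundle_Ω₂, bundle_Ω₂b, bundle_Ω₃, bundle_Ω₃b,
      bundle_Ω₄, wedge_apply, Pi.add_apply, Pi.sub_apply, Pi.smul_apply, add_apply, sub_apply,
      smul_apply, smul_eq_mul]
    linear_combination h0 - h1 - (2 * (cartanForm i Q u 1 0 v * cartanForm i Q u 0 1 w -
        cartanForm i Q u 1 0 w * cartanForm i Q u 0 1 v)
      - (cartanForm i Q u 2 1 v * cartanForm i Q u 1 2 w -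
          cartanForm i Q u 2 1 w * cartanForm i Q u 1 2 v)) * hii
  · funext v w
    have h0 := curv hu 1 1 v w
    simp [Fin.sum_univ_three, wedge_apply, bundle_θ₁, bundle_θ₂, bundle_θ₃] at h0
    have h1 := curv hu 2 2 v w
    simp [Fin.sum_univ_three, wedge_apply, bundle_θ₁, bundle_θ₂, bundle_θ₃] at h1
    change d (fun u => cartanForm i Q u 1 1 - cartanForm i Q u 2 2) u v w = _
    rw [d_sub (da hu 1 1) (da hu 2 2)]
    simp only [bundle_θ₁, bundle_θ₂, bundle_θ₃, bundle_Ω₂, bundle_Ω₂b, bundle_Ω₃, bundle_Ω₃b,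
      bundle_Ω₄, wedge_apply, Pi.add_apply, Pi.sub_apply, Pi.smul_apply, add_apply, sub_apply,
      smul_apply, smul_eq_mul]
    linear_combination h0 - h1 - (2 * (cartanForm i Q u 2 1 v * cartanForm i Q u 1 2 w -
        cartanForm i Q u 2 1 w * cartanForm i Q u 1 2 v)
      - (cartanForm i Q u 1 0 v * cartanForm i Q u 0 1 w -
          cartanForm i Q u 1 0 w * cartanForm i Q u 0 1 v)) * hii
  · funext v w
    have h0 := curv hu 1 2 v w
    simp [Fin.sum_univ_three, wedge_apply, bundle_θ₁, bundle_θ₂, bundle_θ₃] at h0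
    change d (fun u => (-2 : ℝ) • cartanForm i Q u 1 2) u v w = _
    rw [d_const_smul _ (da hu 1 2)]
    simp only [bundle_θ₁, bundle_θ₂, bundle_θ₃, bundle_Ω₂, bundle_Ω₂b, bundle_Ω₃, bundle_Ω₃b,
      bundle_Ω₄, wedge_apply, Pi.add_apply, Pi.sub_apply, Pi.smul_apply, add_apply, sub_apply,
      smul_apply, smul_eq_mul]
    linear_combination -2 * h0
  · funext v w
    have h0 := curv hu 0 1 v w
    simp [Fin.sum_univ_three, wedge_apply, bundle_θ₁, bundle_θ₂, bundle_θ₃] at h0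
    change d (fun u => i⁻¹ • cartanForm i Q u 0 1) u v w = _
    rw [d_const_smul _ (da hu 0 1)]
    simp only [bundle_θ₁, bundle_θ₂, bundle_θ₃, bundle_Ω₂, bundle_Ω₂b, bundle_Ω₃, bundle_Ω₃b,
      bundle_Ω₄, wedge_apply, Pi.add_apply, Pi.sub_apply, Pi.smul_apply, add_apply, sub_apply,
      smul_apply, smul_eq_mul]
    linear_combination i⁻¹ * h0 +
        (bundle i U Q).Rb u * (1 / 2 * (cartanForm i Q u 1 0 v * cartanForm i Q u 2 0 w -
        cartanForm i Q u 1 0 w * cartanForm i Q u 2 0 v)) * hii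
  · funext v w
    have h0 := curv hu 0 2 v w
    simp [Fin.sum_univ_three, wedge_apply, bundle_θ₁, bundle_θ₂, bundle_θ₃] at h0
    change d (fun u => (-2 : ℝ) • cartanForm i Q u 0 2) u v w = _
    rw [d_const_smul _ (da hu 0 2)]
    simp only [bundle_θ₁, bundle_θ₂, bundle_θ₃, bundle_Ω₂, bundle_Ω₂b, bundle_Ω₃, bundle_Ω₃b,
      bundle_Ω₄, wedge_apply, Pi.add_apply, Pi.sub_apply, Pi.smul_apply, add_apply, sub_apply,
      smul_apply, smul_eq_mul]
    linear_combination -2 * h0 + 2 * (cartanForm i Q u 1 2 v * cartanForm i Q u 0 1 w -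
        cartanForm i Q u 1 2 w * cartanForm i Q u 0 1 v) * hii

end Structure

/-! ### The Cartan connection -/

section Connection

variable {i : ℝ} {Q : J1 → ℝ} {U : Set J1}

theorem curvature_bundle (hi : i ≠ 0) (hU : IsOpen U) (hQ : ContDiffOn ℝ ∞ Q U) {u : R8}
    (hu : u ∈ total U) :
    let X := bundle i U Q
    curvature i X u =
      !![0, (i * X.Rb u) • (X.θ₁ u ⋏ X.θ₃ u),
          (-1 / 2 * X.Sb u) • (X.θ₁ u ⋏ X.θ₃ u) + (-1 / 2 * X.S u) • (X.θ₂ u ⋏ X.θ₃ u);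
        0, 0, (-1 / 2 * X.R u) • (X.θ₂ u ⋏ X.θ₃ u);
        0, 0, 0] := by
  intro X
  have h1 (j k : Fin 3) : d (fun u => connForm i X u j k) u
      = d (fun u => cartanForm i Q u j k) u := by
    refine d_congr ?_
    filter_upwards [(isOpen_total hU).mem_nhds hu] with x hx
    exact congrFun (congrFun (connForm_bundle hi hx) j) k
  have h2 (j k : Fin 3) (v w : R8) := (curvature_cartanForm hi hU hQ hu j k v w).trans
      (congrFun (congrFun (conj_pulledCurvature (U := U) hi hu.2.1 hu.2.2 v w) j) k)
  ext j k v w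
  have h3 : curvature i X u j k v w = d (fun u => cartanForm i Q u j k) u v w
      + ∑ l, (cartanForm i Q u j l v * cartanForm i Q u l k w
        - cartanForm i Q u j l w * cartanForm i Q u l k v) := by
    rw [curvature, h1, connForm_bundle hi hu]
    simp [Finset.sum_apply, wedge_apply]
  rw [h3, h2]
  fin_cases j <;> fin_cases k <;> simp [X]

/-- The point of the total space over `z` with fibre coordinates the entries of `M`. -/
def pt (z : J1) (M : Matrix (Fin 3) (Fin 3) ℝ) : R8 :=
  ![z 0, z 1, z 2, M 0 0, M 1 1, M 0 1, M 1 2, M 0 2]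

theorem base_pt (z : J1) (M : Matrix (Fin 3) (Fin 3) ℝ) : base (pt z M) = z := by
  ext k; fin_cases k <;> rfl

theorem pt_base_fiberMat (u : R8) : pt (base u) (fiberMat u) = u := by
  ext k; fin_cases k <;> rfl

theorem diag_of_mem_upperSL3 {h : Matrix (Fin 3) (Fin 3) ℝ} (hh : h ∈ upperSL3) :
    h 0 0 * h 1 1 * h 2 2 = 1 := by
  have h1 := hh.1
  rw [Matrix.det_fin_three, hh.2 1 0 (by decide), hh.2 2 0 (by decide), hh.2 2 1 (by decide)] at h1
  linarith

theorem fiberMat_pt (z : J1) {M : Matrix (Fin 3) (Fin 3) ℝ} (hM : M ∈ upperSL3) :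
    fiberMat (pt z M) = M := by
  have h1 := diag_of_mem_upperSL3 hM
  have h2 : (M 0 0 * M 1 1)⁻¹ = M 2 2 := inv_eq_of_mul_eq_one_right h1
  ext j k
  fin_cases j <;> fin_cases k
  exacts [rfl, rfl, rfl, (hM.2 1 0 (by decide)).symm, rfl, rfl, (hM.2 2 0 (by decide)).symm,
    (hM.2 2 1 (by decide)).symm, h2]

theorem pt_mem_total {z : J1} (hz : z ∈ U) {M : Matrix (Fin 3) (Fin 3) ℝ} (hM : M ∈ upperSL3) :
    pt z M ∈ total U := by
  have h1 := diag_of_mem_upperSL3 hM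
  refine ⟨(base_pt z M).symm ▸ hz, fun h => ?_, fun h => ?_⟩
  · change M 0 0 = 0 at h
    simp [h] at h1
  · change M 1 1 = 0 at h
    simp [h] at h1

theorem fiberMat_mem {u : R8} (h3 : u 3 ≠ 0) (h4 : u 4 ≠ 0) : fiberMat u ∈ upperSL3 := by
  refine ⟨?_, fun j k hjk => ?_⟩
  · rw [Matrix.det_fin_three]
    simp [fiberMat]
    field_simp
  · fin_cases j <;> fin_cases k <;> first | rfl | exact absurd hjk (by decide)

theorem mul_mem_upperSL3 {g h : Matrix (Fin 3) (Fin 3) ℝ} (hg : g ∈ upperSL3)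
    (hh : h ∈ upperSL3) : g * h ∈ upperSL3 := by
  refine ⟨by rw [Matrix.det_mul, hg.1, hh.1, one_mul], fun j k hjk => ?_⟩
  rw [Matrix.mul_apply]
  refine Finset.sum_eq_zero fun l _ => ?_
  rcases lt_or_ge l j with h1 | h1
  · rw [hg.2 j l h1, zero_mul]
  · rw [hh.2 l k (hjk.trans_le h1), mul_zero]

theorem fiberInv_mem {u : R8} (h3 : u 3 ≠ 0) (h4 : u 4 ≠ 0) : fiberInv u ∈ upperSL3 := by
  refine ⟨?_, fun j k hjk => ?_⟩
  · rw [Matrix.det_fin_three]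
    simp [fiberInv]
    field_simp
  · fin_cases j <;> fin_cases k <;> first | rfl | exact absurd hjk (by decide)

theorem inv_fiberMat {u : R8} (h3 : u 3 ≠ 0) (h4 : u 4 ≠ 0) : (fiberMat u)⁻¹ = fiberInv u :=
  Matrix.inv_eq_left_inv (fiberInv_mul_fiberMat h3 h4)

/-- The right action of the group of upper triangular matrices: multiplication in the fibres. -/
def act (u : R8) (h : Matrix (Fin 3) (Fin 3) ℝ) : R8 := pt (base u) (fiberMat u * h)

theorem fiberMat_act {u : R8} (hu : u ∈ total U) {h : Matrix (Fin 3) (Fin 3) ℝ}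
    (hh : h ∈ upperSL3) : fiberMat (act u h) = fiberMat u * h :=
  fiberMat_pt _ (mul_mem_upperSL3 (fiberMat_mem hu.2.1 hu.2.2) hh)

theorem base_act (u : R8) (h : Matrix (Fin 3) (Fin 3) ℝ) : base (act u h) = base u := base_pt _ _

theorem act_mem {u : R8} (hu : u ∈ total U) {h : Matrix (Fin 3) (Fin 3) ℝ}
    (hh : h ∈ upperSL3) : act u h ∈ total U :=
  pt_mem_total hu.1 (mul_mem_upperSL3 (fiberMat_mem hu.2.1 hu.2.2) hh)

open scoped Matrix.Norms.Elementwise in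
theorem contDiffOn_act : ContDiffOn ℝ ∞
    (fun q : R8 × Matrix (Fin 3) (Fin 3) ℝ => act q.1 q.2) (total U ×ˢ upperSL3) := by
  have hx (k : Fin 8) : ContDiffOn ℝ ∞ (fun q : R8 × Matrix (Fin 3) (Fin 3) ℝ => q.1 k)
      (total U ×ˢ upperSL3) :=
    (contDiffOn_coord k (total U)).comp contDiff_fst.contDiffOn fun q hq => hq.1
  have hM (j k : Fin 3) : ContDiffOn ℝ ∞
      (fun q : R8 × Matrix (Fin 3) (Fin 3) ℝ => (fiberMat q.1 * q.2) j k)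
      (total U ×ˢ upperSL3) := by
    simp only [Matrix.mul_apply]
    refine ContDiffOn.sum fun l _ => ContDiffOn.mul ?_ ?_
    · exact (contDiffOn_fiberMat j l).comp contDiff_fst.contDiffOn fun q hq => hq.1
    · exact ((contDiff_apply_apply ℝ ℝ l k).comp contDiff_snd).contDiffOn
  refine contDiffOn_pi.2 fun k => ?_
  fin_cases k
  exacts [hx 0, hx 1, hx 2, hM 0 0, hM 1 1, hM 0 1, hM 1 2, hM 0 2]

/-- The pull-back of `dFiber` is the differential of the pull-back of `fiberMat`. -/
theorem evalM_dFiber_comp {E : Type*} [NormedAddCommGroup E] [NormedSpace ℝ E] {Φ : E → R8} {x : E}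
    (hΦ : DifferentiableAt ℝ Φ x) (h3 : Φ x 3 ≠ 0) (h4 : Φ x 4 ≠ 0) (v : E) (j k : Fin 3) :
    evalM (dFiber (Φ x)) (fderiv ℝ Φ x v) j k = fderiv ℝ (fun y => fiberMat (Φ y) j k) x v := by
  have := ((hasFDerivAt_fiberMat h3 h4 j k).comp x hΦ.hasFDerivAt).fderiv
  exact (congrArg (· v) this).symm

theorem baseL_fderiv {E : Type*} [NormedAddCommGroup E] [NormedSpace ℝ E] {Φ : E → R8} {x : E}
    (hΦ : DifferentiableAt ℝ Φ x) (v : E) :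
    baseL (fderiv ℝ Φ x v) = fderiv ℝ (fun y => base (Φ y)) x v := by
  have := ((hasFDerivAt_base (Φ x)).comp x hΦ.hasFDerivAt).fderiv
  exact (congrArg (· v) this).symm

open scoped Matrix.Norms.Elementwise in
theorem differentiableAt_act (hU : IsOpen U) {u : R8} (hu : u ∈ total U)
    {h : Matrix (Fin 3) (Fin 3) ℝ} (hh : h ∈ upperSL3) :
    DifferentiableAt ℝ (fun u => act u h) u := by
  refine differentiableAt_of_mem (isOpen_total hU) ?_ hu
  exact contDiffOn_act.comp (contDiff_prodMk_left h).contDiffOn fun x hx => ⟨hx, hh⟩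

/-- Equivariance of the connection under the right action. -/
theorem cartanForm_act (hU : IsOpen U) {u : R8} (hu : u ∈ total U)
    {h : Matrix (Fin 3) (Fin 3) ℝ} (hh : h ∈ upperSL3) (v : R8) :
    evalM (cartanForm i Q (act u h)) (fderiv ℝ (fun u => act u h) u v)
      = h⁻¹ * evalM (cartanForm i Q u) v * h := by
  have hd := differentiableAt_act hU hu hh
  have hm := act_mem hu hh
  have h1 : evalM (dFiber (act u h)) (fderiv ℝ (fun u => act u h) u v)
      = evalM (dFiber u) v * h := by
    ext j k
    rw [evalM_dFiber_comp hd hm.2.1 hm.2.2]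
    have e : (fun y => fiberMat (act y h) j k) =ᶠ[nhds u]
        fun y => ∑ l, fiberMat y j l * h l k := by
      filter_upwards [(isOpen_total hU).mem_nhds hu] with y hy
      rw [fiberMat_act hy hh, Matrix.mul_apply]
    rw [e.fderiv_eq, (HasFDerivAt.fun_sum fun l _ =>
      (hasFDerivAt_fiberMat hu.2.1 hu.2.2 j l).mul_const (h l k)).fderiv]
    simp [Matrix.mul_apply, evalM, mul_comm]
  have h2 : baseL (fderiv ℝ (fun u => act u h) u v) = baseL v := by
    rw [baseL_fderiv hd]
    simp only [base_act]
    rw [(hasFDerivAt_base u).fderiv]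
  rw [evalM_cartanForm, evalM_cartanForm, h1, h2, base_act, ← inv_fiberMat hm.2.1 hm.2.2,
    fiberMat_act hu hh, Matrix.mul_inv_rev, inv_fiberMat hu.2.1 hu.2.2]
  simp only [mul_assoc, add_mul]

theorem isCartanConnection_bundle (hi : i ≠ 0) (hU : IsOpen U) :
    IsCartanConnection i U (bundle i U Q) := by
  have hconn {u : R8} (hu : u ∈ total U) (v : R8) :
      conn i (bundle i U Q) u v = evalM (cartanForm i Q u) v := by
    rw [conn, connForm_bundle hi hu]; rfl
  have hone : (1 : Matrix (Fin 3) (Fin 3) ℝ) ∈ upperSL3 :=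
    ⟨Matrix.det_one, fun j k h => Matrix.one_apply_ne h.ne'⟩
  refine ⟨?_, fun u hu => ⟨fun v _ => ?_, fun v _ w _ hvw => ?_, fun M hM => ?_⟩, act,
    contDiffOn_act, fun u hu h hh => ⟨act_mem hu hh, base_act u h⟩, fun u hu => ?_,
    fun u hu g hg h hh => ?_, fun u hu v hv huv => ?_, fun u hu h hh v => ?_,
    fun u hu M hM hM' => ⟨pt 0 (fiberMat u * M), ?_, ?_⟩⟩
  · ext z
    exact ⟨fun ⟨u, hu, h⟩ => h ▸ hu.1, fun hz => ⟨pt z 1, pt_mem_total hz hone, base_pt z 1⟩⟩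
  · rw [mem_ofPred_eq, hconn hu, Matrix.trace_fin_three]
    exact trace_cartanForm hu.2.1 hu.2.2 v
  · rw [hconn hu, hconn hu] at hvw
    refine sub_eq_zero.1 (eq_zero_of_cartanForm hi (Q := Q) hu ?_)
    ext j k
    have := congrFun (congrFun hvw j) k
    simpa [evalM, sub_eq_zero] using this
  · obtain ⟨v, hv⟩ := (coframe_bundle (Q := Q) hi hu).2
      ![M 1 0, (2 * i)⁻¹ * M 2 1, 1 / 2 * M 2 0, M 0 0 - M 1 1, M 1 1 - M 2 2, -2 * M 1 2,
        i⁻¹ * M 0 1, -2 * M 0 2]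
    refine ⟨v, mem_univ v, ?_⟩
    rw [hconn hu]
    have ht := trace_cartanForm (i := i) (Q := Q) hu.2.1 hu.2.2 v
    rw [mem_ofPred_eq, Matrix.trace_fin_three] at hM
    have h0 := hv 0; have h1 := hv 1; have h2 := hv 2; have h3 := hv 3; have h4 := hv 4
    have h5 := hv 5; have h6 := hv 6; have h7 := hv 7
    simp [coframeOf, bundle, hi] at h0 h1 h2 h3 h4 h5 h6 h7
    ext j k
    fin_cases j <;> fin_cases k <;> simp [evalM] <;> linarith
  · rw [act, mul_one, pt_base_fiberMat]
  · rw [act, base_act, fiberMat_act hu hg, mul_assoc, ← act]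
  · refine ⟨fiberInv u * fiberMat v, ⟨mul_mem_upperSL3 (fiberInv_mem hu.2.1 hu.2.2)
      (fiberMat_mem hv.2.1 hv.2.2), ?_⟩, fun h hh => ?_⟩
    · rw [act, ← mul_assoc, fiberMat_mul_fiberInv hu.2.1 hu.2.2, one_mul]
      exact (congrArg (pt · (fiberMat v)) huv).trans (pt_base_fiberMat v)
    · rw [← hh.2, fiberMat_act hu hh.1, ← mul_assoc, fiberInv_mul_fiberMat hu.2.1 hu.2.2, one_mul]
  · rw [hconn hu, hconn (act_mem hu hh), cartanForm_act hU hu hh]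
  · have hM (j k : Fin 3) : HasDerivAt (fun t : ℝ => (fiberMat u * NormedSpace.exp (t • M)) j k)
        ((fiberMat u * M) j k) 0 := by
      simp only [Matrix.mul_apply]
      exact HasDerivAt.fun_sum fun l _ => (hasDerivAt_exp_entry M l k).const_mul _
    refine hasDerivAt_pi.2 fun k => ?_
    fin_cases k
    exacts [hasDerivAt_const _ _, hasDerivAt_const _ _, hasDerivAt_const _ _, hM 0 0, hM 1 1,
      hM 0 1, hM 1 2, hM 0 2]
  · rw [hconn hu, evalM_cartanForm]
    have hb : baseL (pt 0 (fiberMat u * M)) = 0 := by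
      rw [← base_eq, base_pt]
    have hg : evalM (gauge i Q (base u)) 0 = 0 := by ext j k; simp [evalM]
    have hd : evalM (dFiber u) (pt 0 (fiberMat u * M)) = fiberMat u * M := by
      have m10 := hM' 1 0 (by decide)
      have m20 := hM' 2 0 (by decide)
      have m21 := hM' 2 1 (by decide)
      have h3 := hu.2.1
      have h4 := hu.2.2
      rw [Matrix.trace_fin_three] at hM
      have m22 : M 2 2 = -(M 0 0 + M 1 1) := by linarith
      ext j k
      fin_cases j <;> fin_cases k <;>
        simp [evalM, dFiber, dc, pt, Matrix.mul_apply, Fin.sum_univ_three, fiberMat, m10, m20, m21,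
          m22]
      field_simp
    rw [hb, hg, zero_mul, zero_add, hd, ← mul_assoc, fiberInv_mul_fiberMat hu.2.1 hu.2.2, one_mul]

end Connection

/-! ### The differentials of the curvature coefficients -/

section Invariants

variable {i : ℝ} {Q : J1 → ℝ} {U : Set J1}

/-- The horizontal lift of the vector with `μ = 1`, `μ̄ = λ = 0`. -/
def muVec : R8 := ![0, 0, 1, 0, 0, 0, 0, 0]

/-- The horizontal lift of the total derivative, the vector with `μ̄ = 1`, `μ = λ = 0`. -/
def totVec (Q : J1 → ℝ) (u : R8) : R8 := ![1, u 2, Q (base u), 0, 0, 0, 0, 0]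

/-- The horizontal lift of the vector with `λ = 1`, `μ = μ̄ = 0`. -/
def lamVec (i : ℝ) : R8 := ![0, -i⁻¹, 0, 0, 0, 0, 0, 0]

theorem mub_baseL (u v : R8) : mub (base u) (baseL v) = v 0 := by simp [mub_apply, baseL_apply]

theorem lam_baseL (u v : R8) : lam i (base u) (baseL v) = -i * (v 1 - u 2 * v 0) := by
  simp [lam_apply, baseL_apply, base]

theorem mu_baseL (u v : R8) : mu Q (base u) (baseL v) = v 2 - Q (base u) * v 0 := by
  simp [mu_apply, baseL_apply]

theorem bundle_θ₁_apply (u v : R8) : (bundle i U Q).θ₁ u v =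
    (bundle i U Q).b u * mu Q (base u) (baseL v)
      + (bundle i U Q).c u * lam i (base u) (baseL v) := cartanForm_one_zero u v

theorem bundle_θ₂_apply (hi : i ≠ 0) {u : R8} (hu : u ∈ total U) (v : R8) :
    (bundle i U Q).θ₂ u v = (bundle i U Q).bb u * mub (base u) (baseL v)
      + (bundle i U Q).cb u * lam i (base u) (baseL v) := by
  refine (congrArg ((2 * i)⁻¹ * ·) (cartanForm_two_one (U := U) hu.2.1 hu.2.2 hi v)).trans ?_
  field_simp

theorem bundle_θ₃_apply (u v : R8) : (bundle i U Q).θ₃ u v =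
    (bundle i U Q).a u * lam i (base u) (baseL v) := by
  refine (congrArg ((1 / 2 : ℝ) * ·) (cartanForm_two_zero (U := U) u v)).trans ?_
  ring

/-- A covector that vanishes on the vertical vectors, in terms of `θ¹, θ², θ³`. -/
theorem horizontal_eq (hi : i ≠ 0) {u : R8} (hu : u ∈ total U) {E : R8 →L[ℝ] ℝ}
    (hE : ∀ v, baseL v = 0 → E v = 0) :
    let X := bundle i U Q
    E = (E muVec / X.b u) • X.θ₁ u + (E (totVec Q u) / X.bb u) • X.θ₂ u
      + ((E (lamVec i) - E muVec / X.b u * X.c u - E (totVec Q u) / X.bb u * X.cb u) / X.a u)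
        • X.θ₃ u := by
  intro X
  have hb : X.b u ≠ 0 := mul_ne_zero hu.2.1 (inv_ne_zero hu.2.2)
  have hbb : X.bb u ≠ 0 := mul_ne_zero hu.2.1 (pow_ne_zero _ hu.2.2)
  have ha : X.a u ≠ 0 := mul_ne_zero (pow_ne_zero _ hu.2.1) hu.2.2
  ext v
  have h := hE (v - (mu Q (base u) (baseL v) • muVec + mub (base u) (baseL v) • totVec Q u
    + lam i (base u) (baseL v) • lamVec i)) (by
      rw [mu_baseL, mub_baseL, lam_baseL, baseL_apply]
      ext k
      fin_cases k <;> simp [muVec, totVec, lamVec] <;> field_simp <;> ring)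
  simp only [map_sub, map_add, map_smul, smul_eq_mul] at h
  simp only [add_apply, smul_apply, smul_eq_mul]
  rw [show X.θ₁ u v = _ from bundle_θ₁_apply u v, show X.θ₂ u v = _ from bundle_θ₂_apply hi hu v,
    show X.θ₃ u v = _ from bundle_θ₃_apply u v]
  change _ = E muVec / X.b u * (X.b u * _ + X.c u * _)
    + E (totVec Q u) / X.bb u * (X.bb u * _ + X.cb u * _) + _ / X.a u * (X.a u * _)
  field_simp
  linear_combination (X.b u * X.bb u) * h

theorem hasFDerivAt_inv_coord {k : Fin 8} {u : R8} (h : u k ≠ 0) :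
    HasFDerivAt (fun u : R8 => (u k)⁻¹) (-(u k ^ 2)⁻¹ • dc k) u :=
  (hasDerivAt_inv h).comp_hasFDerivAt u (hasFDerivAt_coord k u)

theorem hasFDerivAt_comp_base {f : J1 → ℝ} {u : R8} (hf : DifferentiableAt ℝ f (base u)) :
    HasFDerivAt (fun u => f (base u)) ((fderiv ℝ f (base u)).comp baseL) u :=
  hf.hasFDerivAt.comp u (hasFDerivAt_base u)

theorem fderiv_R {u : R8} (v : R8) (h3 : u 3 ≠ 0) (h4 : u 4 ≠ 0)
    (hw : DifferentiableAt ℝ (w₁ Q) (base u)) :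
    fderiv ℝ (bundle i U Q).R u v = -(1 / (6 * i ^ 2)) * ((u 3)⁻¹ ^ 4 * (u 4)⁻¹ ^ 5) *
      (fderiv ℝ (w₁ Q) (base u) (baseL v) - (4 * v 3 / u 3 + 5 * v 4 / u 4) * w₁ Q (base u)) := by
  have h := (((((hasFDerivAt_inv_coord h3).pow 4).fun_mul
    ((hasFDerivAt_inv_coord h4).pow 5)).const_mul (-(1 / (6 * i ^ 2)))).fun_mul
      (hasFDerivAt_comp_base hw)).fderiv
  refine (congrArg (· v) h).trans ?_
  simp [dc]
  field_simp
  ring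

theorem fderiv_Rb {u : R8} (v : R8) (h3 : u 3 ≠ 0) (h4 : u 4 ≠ 0)
    (hw : DifferentiableAt ℝ (w₂ Q) (base u)) :
    fderiv ℝ (bundle i U Q).Rb u v = -(1 / (6 * i ^ 2)) * ((u 3)⁻¹ ^ 4 * u 4) *
      (fderiv ℝ (w₂ Q) (base u) (baseL v) - (4 * v 3 / u 3 - v 4 / u 4) * w₂ Q (base u)) := by
  have h := (((((hasFDerivAt_inv_coord h3).pow 4).fun_mul
    (hasFDerivAt_coord 4 u)).const_mul (-(1 / (6 * i ^ 2)))).fun_mul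
      (hasFDerivAt_comp_base hw)).fderiv
  refine (congrArg (· v) h).trans ?_
  simp [dc]
  field_simp
  ring

theorem fderiv_S {u : R8} (v : R8) (h3 : u 3 ≠ 0) (h4 : u 4 ≠ 0)
    (hw : DifferentiableAt ℝ (w₁ Q) (base u)) (hw' : DifferentiableAt ℝ (pd 2 (w₁ Q)) (base u)) :
    fderiv ℝ (bundle i U Q).S u v = 1 / (6 * i ^ 2) * ((u 3)⁻¹ ^ 5 * (u 4)⁻¹ ^ 4) *
      (fderiv ℝ (pd 2 (w₁ Q)) (base u) (baseL v)
        + u 5 / u 4 * fderiv ℝ (w₁ Q) (base u) (baseL v)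
        + (v 5 / u 4 - u 5 * v 4 / u 4 ^ 2) * w₁ Q (base u)
        - (5 * v 3 / u 3 + 4 * v 4 / u 4)
          * (pd 2 (w₁ Q) (base u) + u 5 / u 4 * w₁ Q (base u))) := by
  have h := (((((hasFDerivAt_inv_coord h3).pow 5).fun_mul
    ((hasFDerivAt_inv_coord h4).pow 4)).const_mul (1 / (6 * i ^ 2))).fun_mul
      ((hasFDerivAt_comp_base hw').fun_add (((hasFDerivAt_coord 5 u).fun_mul
        (hasFDerivAt_inv_coord h4)).fun_mul (hasFDerivAt_comp_base hw)))).fderiv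
  refine (congrArg (· v) h).trans ?_
  simp [dc]
  field_simp
  ring

theorem fderiv_Sb {u : R8} (v : R8) (h3 : u 3 ≠ 0) (h4 : u 4 ≠ 0)
    (hQ : DifferentiableAt ℝ (pd 2 Q) (base u))
    (hw : DifferentiableAt ℝ (w₂ Q) (base u)) (hw' : DifferentiableAt ℝ (tot Q (w₂ Q)) (base u)) :
    fderiv ℝ (bundle i U Q).Sb u v = 1 / (6 * i ^ 2) * ((u 3)⁻¹ ^ 5 * (u 4)⁻¹) *
      (fderiv ℝ (tot Q (w₂ Q)) (base u) (baseL v)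
        + (2 * pd 2 Q (base u) + 2 * i * (u 6 * u 3 * u 4))
          * fderiv ℝ (w₂ Q) (base u) (baseL v)
        + (2 * fderiv ℝ (pd 2 Q) (base u) (baseL v)
          + 2 * i * (v 6 * u 3 * u 4 + u 6 * v 3 * u 4 + u 6 * u 3 * v 4)) * w₂ Q (base u)
        - (5 * v 3 / u 3 + v 4 / u 4) * (tot Q (w₂ Q) (base u)
          + (2 * pd 2 Q (base u) + 2 * i * (u 6 * u 3 * u 4)) * w₂ Q (base u))) := by
  have h := (((((hasFDerivAt_inv_coord h3).pow 5).fun_mul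
    (hasFDerivAt_inv_coord h4)).const_mul (1 / (6 * i ^ 2))).fun_mul
      ((hasFDerivAt_comp_base hw').fun_add ((((hasFDerivAt_comp_base hQ).const_mul 2).fun_add
        ((((hasFDerivAt_coord 6 u).fun_mul (hasFDerivAt_coord 3 u)).fun_mul
          (hasFDerivAt_coord 4 u)).const_mul (2 * i))).fun_mul (hasFDerivAt_comp_base hw)))).fderiv
  refine (congrArg (· v) h).trans ?_
  simp [dc]
  field_simp
  ring

/-- The connection on vertical vectors is the Maurer-Cartan form of the fibre. -/
theorem cartanForm_vertical {u v : R8} (h3 : u 3 ≠ 0) (h4 : u 4 ≠ 0) (hv : baseL v = 0) :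
    cartanForm i Q u 0 0 v = v 3 / u 3 ∧ cartanForm i Q u 1 1 v = v 4 / u 4 ∧
      cartanForm i Q u 2 2 v = -(v 3 / u 3 + v 4 / u 4) ∧
      cartanForm i Q u 0 1 v = (v 5 - u 5 * v 4 / u 4) / u 3 ∧
      cartanForm i Q u 1 2 v = (v 6 + u 6 * (v 3 / u 3 + v 4 / u 4)) / u 4 ∧
      cartanForm i Q u 1 0 v = 0 ∧ cartanForm i Q u 2 1 v = 0 := by
  refine ⟨?_, ?_, ?_, ?_, ?_, ?_, ?_⟩ <;>
    simp [cartanForm_apply, Fin.sum_univ_three, fiberInv, fiberMat, dFiber, hv, dc] <;>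
    field_simp <;> ring

theorem fderiv_muVec (hi : i ≠ 0) (f : J1 → ℝ) (u : R8) :
    fderiv ℝ f (base u) (baseL muVec) = pd 2 f (base u) := by
  rw [fderiv_eq_frame hi (fun _ => 0), mub_baseL, lam_baseL, mu_baseL]
  simp [muVec]

theorem fderiv_totVec (hi : i ≠ 0) (f : J1 → ℝ) (u : R8) :
    fderiv ℝ f (base u) (baseL (totVec Q u)) = tot Q f (base u) := by
  rw [fderiv_eq_frame hi Q, mub_baseL, lam_baseL, mu_baseL]
  simp [totVec]

theorem frame_muVec (u : R8) : mub (base u) (baseL muVec) = 0 ∧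
    lam i (base u) (baseL muVec) = 0 ∧ mu Q (base u) (baseL muVec) = 1 := by
  rw [mub_baseL, lam_baseL, mu_baseL]
  simp [muVec]

theorem frame_totVec (u : R8) : mub (base u) (baseL (totVec Q u)) = 1 ∧
    lam i (base u) (baseL (totVec Q u)) = 0 ∧ mu Q (base u) (baseL (totVec Q u)) = 0 := by
  rw [mub_baseL, lam_baseL, mu_baseL]
  simp [totVec]

theorem contDiffOn_totVec (hQ : ContDiffOn ℝ ∞ Q U) : ContDiffOn ℝ ∞ (totVec Q) (total U) := by
  refine contDiffOn_pi.2 fun k => ?_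
  fin_cases k
  exacts [contDiffOn_const, contDiffOn_coord 2 _, contDiffOn_comp_base hQ, contDiffOn_const,
    contDiffOn_const, contDiffOn_const, contDiffOn_const, contDiffOn_const]

/-- The values of the connection on the horizontal lift of `μ = 1`. -/
theorem cartanForm_muVec {u : R8} (h3 : u 3 ≠ 0) (h4 : u 4 ≠ 0) :
    cartanForm i Q u 0 0 muVec = -(u 5 / u 4) ∧ cartanForm i Q u 1 1 muVec = u 5 / u 4 ∧
      cartanForm i Q u 2 2 muVec = 0 ∧ cartanForm i Q u 1 0 muVec = u 3 / u 4 ∧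
      cartanForm i Q u 0 1 muVec = -(u 5 ^ 2 / (u 3 * u 4)) ∧ cartanForm i Q u 2 1 muVec = 0 := by
  obtain ⟨h, h', h''⟩ := frame_muVec (i := i) (Q := Q) u
  refine ⟨?_, ?_, ?_, ?_, ?_, ?_⟩ <;>
    simp only [cartanForm_apply, Fin.sum_univ_three, gauge_apply, h, h', h''] <;>
    simp [fiberInv, fiberMat, dFiber, gaugeM, dc, muVec] <;> field_simp

/-- The values of the connection on the horizontal lift of the total derivative. -/
theorem cartanForm_totVec {u : R8} (h3 : u 3 ≠ 0) (h4 : u 4 ≠ 0) (hi : i ≠ 0) :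
    cartanForm i Q u 0 0 (totVec Q u) = 1 / 3 * pd 2 Q (base u) ∧
      cartanForm i Q u 1 1 (totVec Q u) =
        -2 / 3 * pd 2 Q (base u) - 2 * i * (u 6 * u 3 * u 4) ∧
      cartanForm i Q u 2 2 (totVec Q u) =
        1 / 3 * pd 2 Q (base u) + 2 * i * (u 6 * u 3 * u 4) ∧
      cartanForm i Q u 1 0 (totVec Q u) = 0 ∧
      cartanForm i Q u 1 2 (totVec Q u) = -2 / 3 * pd 2 Q (base u) * u 6 / u 4
        + 1 / (2 * i) * pd 1 Q (base u) / (u 3 * u 4 ^ 2)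
        - u 6 * u 3 * (2 * i * u 6 + 1 / 3 * pd 2 Q (base u) / (u 3 * u 4)) ∧
      cartanForm i Q u 2 1 (totVec Q u) = 2 * i * (u 3 * u 4 ^ 2) := by
  obtain ⟨h, h', h''⟩ := frame_totVec (i := i) (Q := Q) u
  refine ⟨?_, ?_, ?_, ?_, ?_, ?_⟩ <;>
    simp only [cartanForm_apply, Fin.sum_univ_three, gauge_apply, h, h', h''] <;>
    simp [fiberInv, fiberMat, dFiber, gaugeP, dc, totVec] <;> field_simp <;> ring

theorem invariantEquations_bundle (hi : i ≠ 0) (hU : IsOpen U) (hQ : ContDiffOn ℝ ∞ Q U) :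
    InvariantEquations i (bundle i U Q) := by
  have hX := isCartanCoframe_bundle hi hU hQ
  have hP := isOpen_total hU
  have hq := rep_of_contDiffOn hU hQ
  have dw1 {u} (hu : u ∈ total U) := (rep_w₁ hq).differentiableAt ⟨base u, hu.1⟩
  have dw1p {u} (hu : u ∈ total U) := ((rep_w₁ hq).pd 2).differentiableAt ⟨base u, hu.1⟩
  have dw2 {u} (hu : u ∈ total U) := (rep_w₂ hq).differentiableAt ⟨base u, hu.1⟩
  have dDw2 {u} (hu : u ∈ total U) := (hq.tot (rep_w₂ hq)).differentiableAt ⟨base u, hu.1⟩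
  have dQp {u} (hu : u ∈ total U) := (hq.pd 2).differentiableAt ⟨base u, hu.1⟩
  set X := bundle i U Q with hXdef
  have sf := hX.smooth_fun
  have so := hX.smooth_form
  simp only [List.mem_cons, List.not_mem_nil, or_false, forall_eq_or_imp, forall_eq] at sf so
  obtain ⟨sa, sb, sbb, sc, scb, sR, sRb, sS, sSb⟩ := sf
  obtain ⟨s1, s2, s3, t2, t2b, t3, t3b, -⟩ := so
  have c {r : ℝ} : ContDiffOn ℝ ∞ (fun _ : R8 => r) (total U) := contDiffOn_const
  have bne {u} (hu : u ∈ total U) : X.b u ≠ 0 := (hX.ne_zero u hu).2.1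
  have bbne {u} (hu : u ∈ total U) : X.bb u ≠ 0 := (hX.ne_zero u hu).2.2
  have ane {u} (hu : u ∈ total U) : X.a u ≠ 0 := (hX.ne_zero u hu).1
  -- The differentials of `R, R̄, S, S̄`, corrected so as to vanish on vertical vectors.
  let ER : R8 → R8 →L[ℝ] ℝ := fun u =>
    fderiv ℝ X.R u + X.R u • (X.Ω₂ u + (3 : ℝ) • X.Ω₂b u) + X.S u • X.θ₁ u
  let ERb : R8 → R8 →L[ℝ] ℝ := fun u =>
    fderiv ℝ X.Rb u + X.Rb u • (X.Ω₂b u + (3 : ℝ) • X.Ω₂ u) + X.Sb u • X.θ₂ u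
  let ES : R8 → R8 →L[ℝ] ℝ := fun u =>
    fderiv ℝ X.S u + X.S u • ((2 : ℝ) • X.Ω₂ u + (3 : ℝ) • X.Ω₂b u) + (i * X.R u) • X.Ω₃b u
  let ESb : R8 → R8 →L[ℝ] ℝ := fun u =>
    fderiv ℝ X.Sb u + X.Sb u • ((2 : ℝ) • X.Ω₂b u + (3 : ℝ) • X.Ω₂ u) - (i * X.Rb u) • X.Ω₃ u
  have sER : ContDiffOn ℝ ∞ ER (total U) :=
    ((contDiffOn_fderiv hP sR).add (sR.smul (t2.add (t2b.const_smul _)))).add (sS.smul s1)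
  have sERb : ContDiffOn ℝ ∞ ERb (total U) :=
    ((contDiffOn_fderiv hP sRb).add (sRb.smul (t2b.add (t2.const_smul _)))).add (sSb.smul s2)
  have sES : ContDiffOn ℝ ∞ ES (total U) :=
    ((contDiffOn_fderiv hP sS).add (sS.smul ((t2.const_smul _).add (t2b.const_smul _)))).add
      ((c.mul sR).smul t3b)
  have sESb : ContDiffOn ℝ ∞ ESb (total U) :=
    ((contDiffOn_fderiv hP sSb).add (sSb.smul ((t2b.const_smul _).add (t2.const_smul _)))).sub
      ((c.mul sRb).smul t3)
  -- The coefficients of `θ¹, θ², θ³` in a horizontal form `E`.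
  let k1 : (R8 → R8 →L[ℝ] ℝ) → R8 → ℝ := fun E u => E u muVec / X.b u
  let k2 : (R8 → R8 →L[ℝ] ℝ) → R8 → ℝ := fun E u => E u (totVec Q u) / X.bb u
  let k3 : (R8 → R8 →L[ℝ] ℝ) → R8 → ℝ := fun E u =>
    (E u (lamVec i) - k1 E u * X.c u - k2 E u * X.cb u) / X.a u
  have sk1 {E} (hE : ContDiffOn ℝ ∞ E (total U)) : ContDiffOn ℝ ∞ (k1 E) (total U) :=
    (hE.clm_apply contDiffOn_const).div sb fun _ => bne
  have sk2 {E} (hE : ContDiffOn ℝ ∞ E (total U)) : ContDiffOn ℝ ∞ (k2 E) (total U) :=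
    (hE.clm_apply (contDiffOn_totVec hQ)).div sbb fun _ => bbne
  have sk3 {E} (hE : ContDiffOn ℝ ∞ E (total U)) : ContDiffOn ℝ ∞ (k3 E) (total U) :=
    (((hE.clm_apply contDiffOn_const).sub ((sk1 hE).mul sc)).sub ((sk2 hE).mul scb)).div sa
      fun _ => ane
  have hii : i * i⁻¹ = 1 := mul_inv_cancel₀ hi
  refine ⟨k2 ER, k1 ERb, k3 ER, k3 ERb, k1 ES, k2 ESb, k2 ES, k1 ESb, k3 ES, k3 ESb, ?_,
    fun u hu => ?_⟩
  · simp only [List.mem_cons, List.not_mem_nil, or_false, forall_eq_or_imp, forall_eq]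
    exact ⟨sk2 sER, sk1 sERb, sk3 sER, sk3 sERb, sk1 sES, sk2 sESb, sk2 sES, sk1 sESb, sk3 sES,
      sk3 sESb⟩
  obtain ⟨hz, h3, h4⟩ := id hu
  have hR : X.R u = -(1 / (6 * i ^ 2)) * ((u 3)⁻¹ ^ 4 * (u 4)⁻¹ ^ 5) * w₁ Q (base u) := rfl
  have hRb : X.Rb u = -(1 / (6 * i ^ 2)) * ((u 3)⁻¹ ^ 4 * u 4) * w₂ Q (base u) := rfl
  have hS : X.S u = 1 / (6 * i ^ 2) * ((u 3)⁻¹ ^ 5 * (u 4)⁻¹ ^ 4)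
    * (pd 2 (w₁ Q) (base u) + u 5 * (u 4)⁻¹ * w₁ Q (base u)) := rfl
  have hSb : X.Sb u = 1 / (6 * i ^ 2) * ((u 3)⁻¹ ^ 5 * (u 4)⁻¹) * (tot Q (w₂ Q) (base u)
    + (2 * pd 2 Q (base u) + 2 * i * (u 6 * u 3 * u 4)) * w₂ Q (base u)) := rfl
  have vR : ∀ v, baseL v = 0 → ER u v = 0 := fun v hv => by
    obtain ⟨e00, e11, e22, -, -, e10, -⟩ := cartanForm_vertical (i := i) (Q := Q) h3 h4 hv
    simp only [ER, add_apply, smul_apply, smul_eq_mul, hXdef, bundle_Ω₂, bundle_Ω₂b, bundle_θ₁,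
      sub_apply, e00, e11, e22, e10, fderiv_R v h3 h4 (dw1 hu), hv, map_zero]
    rw [← hXdef, hR]
    field_simp
    ring
  have vRb : ∀ v, baseL v = 0 → ERb u v = 0 := fun v hv => by
    obtain ⟨e00, e11, e22, -, -, -, e21⟩ := cartanForm_vertical (i := i) (Q := Q) h3 h4 hv
    simp only [ERb, add_apply, smul_apply, smul_eq_mul, hXdef, bundle_Ω₂, bundle_Ω₂b, bundle_θ₂,
      sub_apply, e00, e11, e22, e21, fderiv_Rb v h3 h4 (dw2 hu), hv, map_zero]
    rw [← hXdef, hRb]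
    field_simp
    ring
  have vS : ∀ v, baseL v = 0 → ES u v = 0 := fun v hv => by
    obtain ⟨e00, e11, e22, e01, -, -, -⟩ := cartanForm_vertical (i := i) (Q := Q) h3 h4 hv
    simp only [ES, add_apply, smul_apply, smul_eq_mul, hXdef, bundle_Ω₂, bundle_Ω₂b, bundle_Ω₃b,
      sub_apply, e00, e11, e22, e01, fderiv_S v h3 h4 (dw1 hu) (dw1p hu), hv, map_zero]
    rw [← hXdef, hR, hS]
    field_simp
    ring
  have vSb : ∀ v, baseL v = 0 → ESb u v = 0 := fun v hv => by
    obtain ⟨e00, e11, e22, -, e12, -, -⟩ := cartanForm_vertical (i := i) (Q := Q) h3 h4 hv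
    simp only [ESb, add_apply, smul_apply, smul_eq_mul, hXdef, bundle_Ω₂, bundle_Ω₂b, bundle_Ω₃,
      sub_apply, e00, e11, e22, e12, fderiv_Sb v h3 h4 (dQp hu) (dw2 hu) (dDw2 hu), hv, map_zero]
    rw [← hXdef, hRb, hSb]
    field_simp
    ring
  have mR : ER u muVec = 0 := by
    obtain ⟨e00, e11, e22, e10, -, -⟩ := cartanForm_muVec (i := i) (Q := Q) h3 h4
    simp only [ER, add_apply, smul_apply, smul_eq_mul, hXdef, bundle_Ω₂, bundle_Ω₂b, bundle_θ₁,
      sub_apply, e00, e11, e22, e10, fderiv_R _ h3 h4 (dw1 hu), fderiv_muVec hi]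
    rw [← hXdef, hR, hS]
    simp only [muVec, Matrix.cons_val]
    field_simp
    ring
  have tRb : ERb u (totVec Q u) = 0 := by
    obtain ⟨e00, e11, e22, -, -, e21⟩ := cartanForm_totVec (Q := Q) h3 h4 hi
    simp only [ERb, add_apply, smul_apply, smul_eq_mul, hXdef, bundle_Ω₂, bundle_Ω₂b, bundle_θ₂,
      sub_apply, e00, e11, e22, e21, fderiv_Rb _ h3 h4 (dw2 hu), fderiv_totVec hi]
    rw [← hXdef, hRb, hSb]
    simp only [totVec, Matrix.cons_val]
    field_simp
    ring
  have eR := horizontal_eq (Q := Q) hi hu vR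
  have eRb := horizontal_eq (Q := Q) hi hu vRb
  have eS := horizontal_eq (Q := Q) hi hu vS
  have eSb := horizontal_eq (Q := Q) hi hu vSb
  have zR : k1 ER u = 0 := by simp only [k1, mR, zero_div]
  have zRb : k2 ERb u = 0 := by simp only [k2, tRb, zero_div]
  refine ⟨?_, ?_, ?_, ?_, ?_⟩
  · change ER u = k1 ER u • X.θ₁ u + k2 ER u • X.θ₂ u + k3 ER u • X.θ₃ u at eR
    rw [zR, zero_smul, zero_add] at eR
    rw [add_assoc, ← eR]
    simp only [ER]
    abel
  · change ERb u = k1 ERb u • X.θ₁ u + k2 ERb u • X.θ₂ u + k3 ERb u • X.θ₃ u at eRb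
    rw [zRb, zero_smul, add_zero] at eRb
    rw [add_assoc, ← eRb]
    simp only [ERb]
    abel
  · change ES u = k1 ES u • X.θ₁ u + k2 ES u • X.θ₂ u + k3 ES u • X.θ₃ u at eS
    rw [add_assoc, add_assoc, ← add_assoc (k1 ES u • _), ← eS]
    simp only [ES]
    abel
  · change ESb u = k1 ESb u • X.θ₁ u + k2 ESb u • X.θ₂ u + k3 ESb u • X.θ₃ u at eSb
    rw [add_assoc, add_assoc, ← add_assoc (k1 ESb u • _), ← eSb]
    simp only [ESb]
    abel
  -- The coefficients `S₁` and `S̄₁` agree by the relation between `w₁` and `w₂`.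
  · have hw : pd 2 (pd 2 (w₁ Q)) (base u) = tot Q (tot Q (w₂ Q)) (base u)
        + 3 * pd 2 Q (base u) * tot Q (w₂ Q) (base u) + 2 * tot Q (pd 2 Q) (base u) * w₂ Q (base u)
        + 2 * pd 2 Q (base u) ^ 2 * w₂ Q (base u) - pd 1 Q (base u) * w₂ Q (base u) := by
      let z : (⟨U, hU⟩ : TopologicalSpace.Opens J1) := ⟨base u, hz⟩
      have h := congrFun (congrArg Subtype.val (jd_jd_jw₁ (toSmooth (U := ⟨U, hU⟩) Q hQ))) z
      rw [(((rep_w₁ hq).pd 2).pd 2 z : pd 2 (pd 2 (w₁ Q)) (base u) = _), h,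
        (hq.tot (hq.tot (rep_w₂ hq)) z : tot Q (tot Q (w₂ Q)) (base u) = _),
        (hq.tot (rep_w₂ hq) z : tot Q (w₂ Q) (base u) = _), (hq.pd 2 z : pd 2 Q (base u) = _),
        (hq.tot (hq.pd 2) z : tot Q (pd 2 Q) (base u) = _), (rep_w₂ hq z : w₂ Q (base u) = _),
        (hq.pd 1 z : pd 1 Q (base u) = _)]
      rfl
    obtain ⟨m00, m11, m22, -, m01, -⟩ := cartanForm_muVec (i := i) (Q := Q) h3 h4
    obtain ⟨e00, e11, e22, -, e12, -⟩ := cartanForm_totVec (Q := Q) h3 h4 hi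
    have hb : X.b u = u 3 * (u 4)⁻¹ := rfl
    have hbb : X.bb u = u 3 * u 4 ^ 2 := rfl
    simp only [k1, k2, ES, ESb, add_apply, smul_apply, smul_eq_mul, hXdef, bundle_Ω₂, bundle_Ω₂b,
      bundle_Ω₃b, bundle_Ω₃, sub_apply, m00, m11, m22, m01, e00, e11, e22, e12,
      fderiv_S _ h3 h4 (dw1 hu) (dw1p hu), fderiv_Sb _ h3 h4 (dQp hu) (dw2 hu) (dDw2 hu),
      fderiv_muVec hi, fderiv_totVec hi]
    rw [← hXdef, hR, hS, hRb, hSb, hb, hbb]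
    simp only [totVec, muVec, Matrix.cons_val]
    rw [hw]
    field_simp
    ring

end Invariants

/-! ### The coordinates on the part of the bundle where `b b̄` is positive -/

section Chart

variable {i : ℝ} {Q : J1 → ℝ} {U : Set J1}

/-- The cube root `e^{iφ/3}` of `e^{iφ}`. It enters because the entries of `fiberMat` are the
cube roots of Laurent monomials in `b` and `b̄`. -/
def cubeRoot (i : ℝ) (w : R8) : ℝ := Real.exp (i / 3 * w 4)

/-- The chart: the point of the bundle with coordinates `(x, y, p, ρ, φ, γ, γ̄, r)`. The fibre
coordinates are forced by `b = ρ e^{iφ}`, `b̄ = ρ e^{-iφ}`, `c = b γ`, `c̄ = b̄ γ̄`, except for the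
last one, which is normalized by the `θ³`-component of `Ω₂ + Ω̄₂`. -/
def chart (i : ℝ) (Q : J1 → ℝ) (w : R8) : R8 :=
  ![w 0, w 1, w 2, w 3 * cubeRoot i w, (cubeRoot i w)⁻¹ ^ 2, i * w 6 * (cubeRoot i w)⁻¹ ^ 2,
    -1 / 2 * (w 5 * (w 3)⁻¹ * cubeRoot i w),
    1 / 4 * (cubeRoot i w * (w 3)⁻¹ * (2 * (w 7 * w 3) - i * (w 5 * w 6)
      + w 6 * pd 2 Q (base w)))]

/-- The value of the differential of `chart` on a vector. -/
def chartD (i : ℝ) (Q : J1 → ℝ) (w v : R8) : R8 :=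
  let T := cubeRoot i w
  ![v 0, v 1, v 2, T * (v 3 + i / 3 * w 3 * v 4), -(2 * i / 3) * T⁻¹ ^ 2 * v 4,
    i * T⁻¹ ^ 2 * (v 6 - 2 * i / 3 * w 6 * v 4),
    -1 / 2 * (T / w 3) * (v 5 + i / 3 * w 5 * v 4 - w 5 * v 3 / w 3),
    1 / 4 * (T / w 3) * (2 * (v 7 * w 3 + w 7 * v 3) - i * (v 5 * w 6 + w 5 * v 6)
      + v 6 * pd 2 Q (base w) + w 6 * fderiv ℝ (pd 2 Q) (base w) (baseL v)
      + (i / 3 * v 4 - v 3 / w 3) * (2 * (w 7 * w 3) - i * (w 5 * w 6) + w 6 * pd 2 Q (base w)))]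

theorem cubeRoot_pos (i : ℝ) (w : R8) : 0 < cubeRoot i w := Real.exp_pos _

theorem exp_eq_cubeRoot (i : ℝ) (w : R8) : Real.exp (i * w 4) = cubeRoot i w ^ 3 := by
  rw [cubeRoot, ← Real.exp_nat_mul]
  congr 1
  push_cast
  ring

theorem exp_neg_eq_cubeRoot (i : ℝ) (w : R8) : Real.exp (-(i * w 4)) = (cubeRoot i w ^ 3)⁻¹ := by
  rw [← exp_eq_cubeRoot, ← Real.exp_neg]

theorem hasFDerivAt_cubeRoot (i : ℝ) (w : R8) :
    HasFDerivAt (cubeRoot i) ((cubeRoot i w) • (i / 3) • dc 4) w :=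
  ((hasFDerivAt_coord 4 w).const_mul (i / 3)).exp

theorem fderiv_chart {w : R8} (hw : w 3 ≠ 0) (hQ : DifferentiableAt ℝ (pd 2 Q) (base w)) :
    DifferentiableAt ℝ (chart i Q) w ∧ ∀ v, fderiv ℝ (chart i Q) w v = chartD i Q w v := by
  have x (k : Fin 8) := hasFDerivAt_coord k w
  have T := hasFDerivAt_cubeRoot i w
  have hT := (cubeRoot_pos i w).ne'
  have Ti : HasFDerivAt (fun w => (cubeRoot i w)⁻¹) _ w := (hasDerivAt_inv hT).comp_hasFDerivAt w T
  have ri := hasFDerivAt_inv_coord hw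
  have hq := hasFDerivAt_comp_base hQ
  have h5 := ((x 6).const_mul i).fun_mul (Ti.pow 2)
  have h6 := (((x 5).fun_mul ri).fun_mul T).const_mul (-1 / 2)
  have h7 := ((T.fun_mul ri).fun_mul (((((x 7).fun_mul (x 3)).const_mul 2).fun_sub
    (((x 5).fun_mul (x 6)).const_mul i)).fun_add ((x 6).fun_mul hq))).const_mul (1 / 4)
  have hd : DifferentiableAt ℝ (chart i Q) w := by
    refine differentiableAt_pi.2 fun k => ?_
    fin_cases k
    exacts [(x 0).differentiableAt, (x 1).differentiableAt, (x 2).differentiableAt,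
      ((x 3).fun_mul T).differentiableAt, (Ti.pow 2).differentiableAt, h5.differentiableAt,
      h6.differentiableAt, h7.differentiableAt]
  refine ⟨hd, fun v => funext fun k => ?_⟩
  have e : fderiv ℝ (chart i Q) w v k = fderiv ℝ (fun w => chart i Q w k) w v := by
    exact (congrArg (· v) ((hasFDerivAt_apply (𝕜 := ℝ) k _).comp w hd.hasFDerivAt).fderiv).symm
  rw [e]
  fin_cases k
  · exact congrArg (· v) (x 0).fderiv
  · exact congrArg (· v) (x 1).fderiv
  · exact congrArg (· v) (x 2).fderiv
  · refine (congrArg (· v) ((x 3).fun_mul T).fderiv).trans ?_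
    simp [chartD, dc]
    ring
  · refine (congrArg (· v) (Ti.pow 2).fderiv).trans ?_
    simp [chartD, dc]
    field_simp
  · refine (congrArg (· v) h5.fderiv).trans ?_
    simp [chartD, dc]
    field_simp
    ring
  · refine (congrArg (· v) h6.fderiv).trans ?_
    simp [chartD, dc]
    field_simp
    ring
  · refine (congrArg (· v) h7.fderiv).trans ?_
    simp [chartD, dc]
    field_simp
    ring

theorem base_chart (w : R8) : base (chart i Q w) = base w := by
  ext k; fin_cases k <;> rfl

theorem chart_mem_total {w : R8} (hw : w ∈ (coordData i U Q).P) : chart i Q w ∈ total U := by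
  have hT := (cubeRoot_pos i w).ne'
  exact ⟨(base_chart (i := i) (Q := Q) w).symm ▸ hw.1, mul_ne_zero hw.2 hT,
    pow_ne_zero _ (inv_ne_zero hT)⟩

theorem fderiv_pd_frame (hi : i ≠ 0) (w v : R8) :
    fderiv ℝ (pd 2 Q) (base w) (baseL v) = tot Q (pd 2 Q) (base w) * v 0
      + pd 1 (pd 2 Q) (base w) * (v 1 - w 2 * v 0)
      + pd 2 (pd 2 Q) (base w) * (v 2 - Q (base w) * v 0) := by
  rw [fderiv_eq_frame hi Q, mub_baseL, lam_baseL, mu_baseL]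
  field_simp
  ring

theorem baseL_chartD (w v : R8) : baseL (chartD i Q w v) = baseL v := by
  ext k; fin_cases k <;> rfl

set_option linter.unusedSimpArgs false in
theorem isMorphism_chart (hi : i ≠ 0) (hU : IsOpen U) (hQ : ContDiffOn ℝ ∞ Q U) :
    IsMorphism (coordData i U Q) (bundle i U Q) id (chart i Q) := by
  have hq := rep_of_contDiffOn hU hQ
  have hQp : ContDiffOn ℝ ∞ (pd 2 Q) U := (hq.pd 2).contDiffOn
  have hT (w : R8) := (cubeRoot_pos i w).ne'
  have dQ {w : R8} (hw : w ∈ (coordData i U Q).P) := differentiableAt_of_mem hU hQp hw.1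
  -- The values of the pulled back connection.
  have e {w : R8} (hw : w ∈ (coordData i U Q).P) (v : R8) (j k : Fin 3) :
      cartanForm i Q (chart i Q w) j k (fderiv ℝ (chart i Q) w v) =
        ∑ l, fiberInv (chart i Q w) j l * ((∑ m, fiberMat (chart i Q w) m k *
          (gaugeP i Q (base w) l m * v 0 + gaugeL i Q (base w) l m * (-i * (v 1 - w 2 * v 0))
            + gaugeM i Q (base w) l m * (v 2 - Q (base w) * v 0)))
              + dFiber (chart i Q w) l k (chartD i Q w v)) := by
    rw [(fderiv_chart hw.2 (dQ hw)).2, cartanForm_apply]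
    simp only [gauge_apply, base_chart, baseL_chartD, mub_baseL, lam_baseL, mu_baseL]
  refine
    { smooth := ?_
      mapsTo := fun w hw => chart_mem_total hw
      proj := fun w _ => base_chart w
      θ₁ := fun w hw => ?_
      θ₂ := fun w hw => ?_
      θ₃ := fun w hw => ?_
      Ω₂ := fun w hw => ?_
      Ω₂b := fun w hw => ?_
      Ω₃ := fun w hw => ?_
      Ω₃b := fun w hw => ?_
      Ω₄ := fun w hw => ?_
      R := fun w hw => ?_
      Rb := fun w hw => ?_
      S := fun w hw => ?_
      Sb := fun w hw => ?_ }
  · have x (k : Fin 8) : ContDiffOn ℝ ∞ (fun w : R8 => w k) (coordData i U Q).P :=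
      contDiffOn_coord k _
    have c {r : ℝ} : ContDiffOn ℝ ∞ (fun _ : R8 => r) (coordData i U Q).P := contDiffOn_const
    have T : ContDiffOn ℝ ∞ (cubeRoot i) (coordData i U Q).P := (c.mul (x 4)).exp
    have Ti := (T.inv fun w _ => hT w).pow 2
    have y3 := (x 3).inv fun w (hw : w ∈ (coordData i U Q).P) => hw.2
    have q : ContDiffOn ℝ ∞ (fun w : R8 => pd 2 Q (base w)) (coordData i U Q).P :=
      hQp.comp contDiff_base.contDiffOn fun w hw => hw.1
    refine contDiffOn_pi.2 fun k => ?_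
    fin_cases k
    exacts [x 0, x 1, x 2, (x 3).mul T, Ti, (c.mul (x 6)).mul Ti, c.mul (((x 5).mul y3).mul T),
      c.mul ((T.mul y3).mul (((c.mul ((x 7).mul (x 3))).sub (c.mul ((x 5).mul (x 6)))).add
        ((x 6).mul q)))]
  · ext v
    have h3 := hw.2
    have hT := hT w
    refine (e hw v 1 0).trans ?_
    change _ = cθ₁ i Q w v
    simp [Fin.sum_univ_three, fiberInv, fiberMat, dFiber, gaugeP, gaugeL, gaugeM, chart, chartD, dc,
      cθ₁, cθ₁, cθ₂, cθ₃, cLam, exp_eq_cubeRoot, exp_neg_eq_cubeRoot]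
    field_simp
  · ext v
    have h3 := hw.2
    have hT := hT w
    refine (congrArg ((2 * i)⁻¹ * ·) (e hw v 2 1)).trans ?_
    change _ = cθ₂ i w v
    simp [Fin.sum_univ_three, fiberInv, fiberMat, dFiber, gaugeP, gaugeL, gaugeM, chart, chartD, dc,
      cθ₂, cθ₁, cθ₂, cθ₃, cLam, exp_eq_cubeRoot, exp_neg_eq_cubeRoot]
    field_simp
    ring
  · ext v
    have h3 := hw.2
    have hT := hT w
    refine (congrArg ((1 / 2 : ℝ) * ·) (e hw v 2 0)).trans ?_
    change _ = cθ₃ i w v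
    simp [Fin.sum_univ_three, fiberInv, fiberMat, dFiber, gaugeP, gaugeL, gaugeM, chart, chartD, dc,
      cθ₃, cθ₁, cθ₂, cθ₃, cLam, exp_eq_cubeRoot, exp_neg_eq_cubeRoot]
    field_simp
  · ext v
    have h3 := hw.2
    have hT := hT w
    refine (congrArg₂ (· - ·) (e hw v 0 0) (e hw v 1 1)).trans ?_
    change _ = cΩ₂ i Q w v
    simp [Fin.sum_univ_three, fiberInv, fiberMat, dFiber, gaugeP, gaugeL, gaugeM, chart, chartD, dc,
      cΩ₂, cθ₁, cθ₂, cθ₃, cLam, exp_eq_cubeRoot, exp_neg_eq_cubeRoot]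
    field_simp
    ring
  · ext v
    have h3 := hw.2
    have hT := hT w
    refine (congrArg₂ (· - ·) (e hw v 1 1) (e hw v 2 2)).trans ?_
    change _ = cΩ₂b i Q w v
    simp [Fin.sum_univ_three, fiberInv, fiberMat, dFiber, gaugeP, gaugeL, gaugeM, chart, chartD, dc,
      cΩ₂b, cθ₁, cθ₂, cθ₃, cLam, exp_eq_cubeRoot, exp_neg_eq_cubeRoot]
    field_simp
    ring
  · ext v
    have h3 := hw.2
    have hT := hT w
    refine (congrArg ((-2 : ℝ) * ·) (e hw v 1 2)).trans ?_
    change _ = cΩ₃ i Q w v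
    simp [Fin.sum_univ_three, fiberInv, fiberMat, dFiber, gaugeP, gaugeL, gaugeM, chart, chartD, dc,
      cΩ₃, cθ₁, cθ₂, cθ₃, cLam, exp_eq_cubeRoot, exp_neg_eq_cubeRoot]
    field_simp
    ring
  · ext v
    have h3 := hw.2
    have hT := hT w
    refine (congrArg (i⁻¹ * ·) (e hw v 0 1)).trans ?_
    change _ = cΩ₃b i Q w v
    simp [Fin.sum_univ_three, fiberInv, fiberMat, dFiber, gaugeP, gaugeL, gaugeM, chart, chartD, dc,
      cΩ₃b, cθ₁, cθ₂, cθ₃, cLam, exp_eq_cubeRoot, exp_neg_eq_cubeRoot]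
    field_simp
    ring
  · ext v
    have h3 := hw.2
    have hT := hT w
    refine (congrArg ((-2 : ℝ) * ·) (e hw v 0 2)).trans ?_
    change _ = cΩ₄ i Q w v
    simp [Fin.sum_univ_three, fiberInv, fiberMat, dFiber, gaugeP, gaugeL, gaugeM, chart, chartD, dc,
      cΩ₄, cθ₁, cθ₂, cθ₃, cLam, exp_eq_cubeRoot, exp_neg_eq_cubeRoot,
      fderiv_pd_frame hi]
    field_simp
    ring
  all_goals
    have h3 := hw.2
    have hT := hT w
    have e2 : Real.exp (2 * i * w 4) = cubeRoot i w ^ 6 := by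
      rw [mul_assoc, two_mul, Real.exp_add, exp_eq_cubeRoot]
      ring
    have e2' : Real.exp (-2 * i * w 4) = (cubeRoot i w ^ 6)⁻¹ := by
      rw [← e2, ← Real.exp_neg]
      congr 1
      ring
  · change -(1 / (6 * i ^ 2)) * ((w 3 * cubeRoot i w)⁻¹ ^ 4 * ((cubeRoot i w)⁻¹ ^ 2)⁻¹ ^ 5) *
      w₁ Q (base (chart i Q w))
        = -(Real.exp (2 * i * w 4) / (6 * i ^ 2 * w 3 ^ 4)) * w₁ Q (base w)
    rw [base_chart, e2]
    field_simp
  · change -(1 / (6 * i ^ 2)) * ((w 3 * cubeRoot i w)⁻¹ ^ 4 * (cubeRoot i w)⁻¹ ^ 2) *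
      w₂ Q (base (chart i Q w))
        = -(Real.exp (-2 * i * w 4) / (6 * i ^ 2 * w 3 ^ 4)) * w₂ Q (base w)
    rw [base_chart, e2']
    field_simp
  · change 1 / (6 * i ^ 2) * ((w 3 * cubeRoot i w)⁻¹ ^ 5 * ((cubeRoot i w)⁻¹ ^ 2)⁻¹ ^ 4) *
      (pd 2 (w₁ Q) (base (chart i Q w)) + i * w 6 * (cubeRoot i w)⁻¹ ^ 2 *
        ((cubeRoot i w)⁻¹ ^ 2)⁻¹ * w₁ Q (base (chart i Q w)))
        = Real.exp (i * w 4) / (6 * i ^ 2 * w 3 ^ 5)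
          * (pd 2 (w₁ Q) (base w) + i * w 6 * w₁ Q (base w))
    rw [base_chart, exp_eq_cubeRoot]
    field_simp
  · change 1 / (6 * i ^ 2) * ((w 3 * cubeRoot i w)⁻¹ ^ 5 * ((cubeRoot i w)⁻¹ ^ 2)⁻¹) *
      (tot Q (w₂ Q) (base (chart i Q w)) + (2 * pd 2 Q (base (chart i Q w)) + 2 * i *
        (-1 / 2 * (w 5 * (w 3)⁻¹ * cubeRoot i w) * (w 3 * cubeRoot i w) * (cubeRoot i w)⁻¹ ^ 2)) *
        w₂ Q (base (chart i Q w)))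
        = Real.exp (-i * w 4) / (6 * i ^ 2 * w 3 ^ 5)
          * (tot Q (w₂ Q) (base w) + (2 * pd 2 Q (base w) - i * w 5) * w₂ Q (base w))
    rw [base_chart, neg_mul, exp_neg_eq_cubeRoot]
    field_simp
    ring

/-- The inverse of `chart`: on the image, `u 4 = e^{-2iφ/3}` is positive. -/
def chartInv (i : ℝ) (Q : J1 → ℝ) (u : R8) : R8 :=
  let T := Real.exp (-1 / 2 * Real.log (u 4))
  ![u 0, u 1, u 2, u 3 * T⁻¹, -3 / 2 * i⁻¹ * Real.log (u 4), -2 * (u 6 * u 3 * T⁻¹ ^ 2),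
    i⁻¹ * (u 5 * (u 4)⁻¹),
    2 * u 7 * T⁻¹ + (u 3)⁻¹ * T * (-(u 6 * u 3 * T⁻¹ ^ 2 * (u 5 * (u 4)⁻¹))
      - 1 / 2 * (i⁻¹ * (u 5 * (u 4)⁻¹) * pd 2 Q (base u)))]

theorem isDiffeoOn_chart (hi : i ≠ 0) (hU : IsOpen U) (hQ : ContDiffOn ℝ ∞ Q U) :
    IsDiffeoOn (chart i Q) (coordData i U Q).P
      {u | u ∈ (bundle i U Q).P ∧ 0 < (bundle i U Q).b u * (bundle i U Q).bb u} := by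
  have hb {u : R8} :
      (bundle i U Q).b u * (bundle i U Q).bb u = u 3 * (u 4)⁻¹ * (u 3 * u 4 ^ 2) := rfl
  have pos {u : R8} (hu : u ∈ {u | u ∈ (bundle i U Q).P ∧
      0 < (bundle i U Q).b u * (bundle i U Q).bb u}) : u ∈ total U ∧ 0 < u 4 := by
    obtain ⟨h1, h2⟩ := hu
    have h4 := h1.2.2
    have e : u 3 * (u 4)⁻¹ * (u 3 * u 4 ^ 2) = u 3 ^ 2 * u 4 := by field_simp
    rw [hb, e] at h2
    exact ⟨h1, pos_of_mul_pos_right h2 (sq_nonneg _)⟩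
  have hQp : ContDiffOn ℝ ∞ (pd 2 Q) U := ((rep_of_contDiffOn hU hQ).pd 2).contDiffOn
  have hT (w : R8) := (cubeRoot_pos i w).ne'
  refine ⟨(isMorphism_chart hi hU hQ).smooth, fun w hw => ⟨chart_mem_total hw, ?_⟩, chartInv i Q,
    ?_, fun u hu => ?_, fun w hw => ?_, fun u hu => ?_⟩
  · rw [hb]
    have h3 := hw.2
    have hT := cubeRoot_pos i w
    change 0 < w 3 * cubeRoot i w * ((cubeRoot i w)⁻¹ ^ 2)⁻¹ *
      (w 3 * cubeRoot i w * ((cubeRoot i w)⁻¹ ^ 2) ^ 2)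
    have e : w 3 * cubeRoot i w * ((cubeRoot i w)⁻¹ ^ 2)⁻¹ *
      (w 3 * cubeRoot i w * ((cubeRoot i w)⁻¹ ^ 2) ^ 2) = w 3 ^ 2 := by field_simp
    rw [e]
    positivity
  · set V := {u | u ∈ (bundle i U Q).P ∧ 0 < (bundle i U Q).b u * (bundle i U Q).bb u}
    have x (k : Fin 8) : ContDiffOn ℝ ∞ (fun u : R8 => u k) V := contDiffOn_coord k _
    have c {r : ℝ} : ContDiffOn ℝ ∞ (fun _ : R8 => r) V := contDiffOn_const
    have l : ContDiffOn ℝ ∞ (fun u : R8 => Real.log (u 4)) V :=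
      (x 4).log fun u hu => (pos hu).2.ne'
    have T : ContDiffOn ℝ ∞ (fun u : R8 => Real.exp (-1 / 2 * Real.log (u 4))) V := (c.mul l).exp
    have Ti := T.inv fun u _ => (Real.exp_pos _).ne'
    have y3 := (x 3).inv fun u hu => (pos hu).1.2.1
    have y4 := (x 4).inv fun u hu => (pos hu).1.2.2
    have q : ContDiffOn ℝ ∞ (fun u : R8 => pd 2 Q (base u)) V :=
      (contDiffOn_comp_base hQp).mono fun u hu => hu.1
    have g := c (r := i⁻¹) |>.mul ((x 5).mul y4)
    have h7 := (((c (r := 2)).mul (x 7)).mul Ti).add ((y3.mul T).mul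
      (((((x 6).mul (x 3)).mul (Ti.pow 2)).mul ((x 5).mul y4)).neg.sub
        ((c (r := 1 / 2)).mul (g.mul q))))
    refine contDiffOn_pi.2 fun k => ?_
    fin_cases k
    exacts [x 0, x 1, x 2, (x 3).mul Ti, c.mul l, c.mul (((x 6).mul (x 3)).mul (Ti.pow 2)), g, h7]
  · exact ⟨(pos hu).1.1, mul_ne_zero (pos hu).1.2.1 (inv_ne_zero (Real.exp_pos _).ne')⟩
  · have hT := hT w
    have h3 := hw.2
    have hl : Real.log ((cubeRoot i w)⁻¹ ^ 2) = -2 * (i / 3 * w 4) := by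
      rw [Real.log_pow, Real.log_inv, cubeRoot, Real.log_exp]
      push_cast
      ring
    have he : Real.exp (-1 / 2 * Real.log ((cubeRoot i w)⁻¹ ^ 2)) = cubeRoot i w := by
      rw [hl, cubeRoot]
      congr 1
      ring
    ext k
    fin_cases k
    · rfl
    · rfl
    · rfl
    · change w 3 * cubeRoot i w * (Real.exp (-1 / 2 * Real.log ((cubeRoot i w)⁻¹ ^ 2)))⁻¹ = w 3
      rw [he]
      field_simp
    · change -3 / 2 * i⁻¹ * Real.log ((cubeRoot i w)⁻¹ ^ 2) = w 4
      rw [hl]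
      field_simp
    · change -2 * (-1 / 2 * (w 5 * (w 3)⁻¹ * cubeRoot i w) * (w 3 * cubeRoot i w) *
        (Real.exp (-1 / 2 * Real.log ((cubeRoot i w)⁻¹ ^ 2)))⁻¹ ^ 2) = w 5
      rw [he]
      field_simp
    · change i⁻¹ * (i * w 6 * (cubeRoot i w)⁻¹ ^ 2 * ((cubeRoot i w)⁻¹ ^ 2)⁻¹) = w 6
      field_simp
    · change 2 * (1 / 4 * (cubeRoot i w * (w 3)⁻¹ * (2 * (w 7 * w 3) - i * (w 5 * w 6)
        + w 6 * pd 2 Q (base w)))) * (Real.exp (-1 / 2 * Real.log ((cubeRoot i w)⁻¹ ^ 2)))⁻¹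
        + (w 3 * cubeRoot i w)⁻¹ * Real.exp (-1 / 2 * Real.log ((cubeRoot i w)⁻¹ ^ 2)) *
          (-(-1 / 2 * (w 5 * (w 3)⁻¹ * cubeRoot i w) * (w 3 * cubeRoot i w) *
            (Real.exp (-1 / 2 * Real.log ((cubeRoot i w)⁻¹ ^ 2)))⁻¹ ^ 2 *
              (i * w 6 * (cubeRoot i w)⁻¹ ^ 2 * ((cubeRoot i w)⁻¹ ^ 2)⁻¹))
            - 1 / 2 * (i⁻¹ * (i * w 6 * (cubeRoot i w)⁻¹ ^ 2 * ((cubeRoot i w)⁻¹ ^ 2)⁻¹) *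
              pd 2 Q (base (chart i Q w)))) = w 7
      rw [he, base_chart]
      field_simp
      ring
  · obtain ⟨hu, h4⟩ := pos hu
    have h3 := hu.2.1
    have hc : cubeRoot i (chartInv i Q u) = Real.exp (-1 / 2 * Real.log (u 4)) := by
      change Real.exp (i / 3 * (-3 / 2 * i⁻¹ * Real.log (u 4))) = _
      congr 1
      field_simp
    have h4' : u 4 = (Real.exp (-1 / 2 * Real.log (u 4)))⁻¹ ^ 2 := by
      rw [← Real.exp_neg, ← Real.exp_nat_mul]
      conv_lhs => rw [← Real.exp_log h4]
      congr 1
      push_cast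
      ring
    have hbase : base (chartInv i Q u) = base u := by ext k; fin_cases k <;> rfl
    have hE := (Real.exp_pos (-1 / 2 * Real.log (u 4))).ne'
    simp only [chart, hc, hbase]
    simp only [chartInv, Matrix.cons_val]
    generalize Real.exp (-1 / 2 * Real.log (u 4)) = T at *
    ext k
    fin_cases k
    · rfl
    · rfl
    · rfl
    · simp
      field_simp
    · exact h4'.symm
    · simp
      rw [h4']
      field_simp
    · simp
      field_simp
    · simp
      rw [h4']
      field_simp
      ring

end Chart

/-! ### Comparison of two solutions of the structure equations -/

section Comparison

/-- The structure equations for smooth one-forms on an open set, without the requirement that the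
forms be linearly independent. -/
structure StructureEquations (i : ℝ) (X : CartanData) : Prop where
  isOpen : IsOpen X.P
  smooth_form : ∀ α ∈ [X.θ₁, X.θ₂, X.θ₃, X.Ω₂, X.Ω₂b, X.Ω₃, X.Ω₃b, X.Ω₄], ContDiffOn ℝ ∞ α X.P
  d_θ₁ : ∀ u ∈ X.P, d X.θ₁ u = X.Ω₂ u ⋏ X.θ₁ u + X.Ω₃ u ⋏ X.θ₃ u
  d_θ₂ : ∀ u ∈ X.P, d X.θ₂ u = X.Ω₂b u ⋏ X.θ₂ u + X.Ω₃b u ⋏ X.θ₃ u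
  d_θ₃ : ∀ u ∈ X.P, d X.θ₃ u = i • (X.θ₁ u ⋏ X.θ₂ u) + (X.Ω₂ u + X.Ω₂b u) ⋏ X.θ₃ u
  d_Ω₂ : ∀ u ∈ X.P, d X.Ω₂ u =
    (2 * i) • (X.θ₁ u ⋏ X.Ω₃b u) + i • (X.θ₂ u ⋏ X.Ω₃ u) + X.Ω₄ u ⋏ X.θ₃ u
  d_Ω₂b : ∀ u ∈ X.P, d X.Ω₂b u =
    (-(2 * i)) • (X.θ₂ u ⋏ X.Ω₃ u) - i • (X.θ₁ u ⋏ X.Ω₃b u) + X.Ω₄ u ⋏ X.θ₃ u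
  d_Ω₃ : ∀ u ∈ X.P, d X.Ω₃ u =
    X.Ω₄ u ⋏ X.θ₁ u + X.Ω₃ u ⋏ X.Ω₂b u + X.R u • (X.θ₂ u ⋏ X.θ₃ u)
  d_Ω₃b : ∀ u ∈ X.P, d X.Ω₃b u =
    X.Ω₄ u ⋏ X.θ₂ u + X.Ω₃b u ⋏ X.Ω₂ u + X.Rb u • (X.θ₁ u ⋏ X.θ₃ u)
  d_Ω₄ : ∀ u ∈ X.P, d X.Ω₄ u =
    i • (X.Ω₃ u ⋏ X.Ω₃b u) + X.Ω₄ u ⋏ (X.Ω₂ u + X.Ω₂b u)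
      + X.Sb u • (X.θ₁ u ⋏ X.θ₃ u) + X.S u • (X.θ₂ u ⋏ X.θ₃ u)

theorem IsCartanCoframe.structureEquations {i : ℝ} {U : Set J1} {Q : J1 → ℝ} {X : CartanData}
    (h : IsCartanCoframe i U Q X) : StructureEquations i X :=
  ⟨h.isOpen, h.smooth_form, h.d_θ₁, h.d_θ₂, h.d_θ₃, h.d_Ω₂, h.d_Ω₂b, h.d_Ω₃, h.d_Ω₃b, h.d_Ω₄⟩

/-- The values of linearly independent covectors can be prescribed. -/
theorem exists_of_linearIndependent {f : Fin 8 → R8 →L[ℝ] ℝ} (h : LinearIndependent ℝ f)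
    (c : Fin 8 → ℝ) : ∃ v, ∀ k, f k v = c k := by
  let T : R8 →ₗ[ℝ] R8 := LinearMap.pi fun k => (f k).toLinearMap
  have hT : LinearMap.range T = ⊤ := by
    by_contra hne
    obtain ⟨g, hg, hle⟩ := Submodule.exists_le_ker_of_lt_top _ (lt_top_iff_ne_top.2 hne)
    have hz (x : R8) : g x = ∑ k, x k * g (Pi.single k 1) := by
      conv_lhs => rw [pi_eq_sum_univ' x, map_sum]
      simp
    have h0 := Fintype.linearIndependent_iff.1 h (fun k => g (Pi.single k 1)) (by
      ext v
      have := hle (LinearMap.mem_range_self T v)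
      rw [LinearMap.mem_ker, hz] at this
      simpa [T, mul_comm] using this)
    exact hg (LinearMap.ext fun x => by simp [hz x, h0])
  obtain ⟨v, hv⟩ := LinearMap.range_eq_top.1 hT c
  exact ⟨v, fun k => congrFun hv k⟩

/-- The vectors `e₁, e₂, e₃` are dual to `θ¹, θ², θ³` at `u`. -/
structure IsDualTriple (X : CartanData) (u e₁ e₂ e₃ : R8) : Prop where
  h₁₁ : X.θ₁ u e₁ = 1
  h₁₂ : X.θ₁ u e₂ = 0
  h₁₃ : X.θ₁ u e₃ = 0
  h₂₁ : X.θ₂ u e₁ = 0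
  h₂₂ : X.θ₂ u e₂ = 1
  h₂₃ : X.θ₂ u e₃ = 0
  h₃₁ : X.θ₃ u e₁ = 0
  h₃₂ : X.θ₃ u e₂ = 0
  h₃₃ : X.θ₃ u e₃ = 1

theorem IsCartanCoframe.exists_dual {i : ℝ} {U : Set J1} {Q : J1 → ℝ} {X : CartanData}
    (h : IsCartanCoframe i U Q X) {u : R8} (hu : u ∈ X.P) :
    ∃ e₁ e₂ e₃, IsDualTriple X u e₁ e₂ e₃ := by
  obtain ⟨e₁, h₁⟩ := exists_of_linearIndependent (h.coframe u hu) (Pi.single 0 1)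
  obtain ⟨e₂, h₂⟩ := exists_of_linearIndependent (h.coframe u hu) (Pi.single 1 1)
  obtain ⟨e₃, h₃⟩ := exists_of_linearIndependent (h.coframe u hu) (Pi.single 2 1)
  exact ⟨e₁, e₂, e₃, h₁ 0, h₂ 0, h₃ 0, h₁ 1, h₂ 1, h₃ 1, h₁ 2, h₂ 2, h₃ 2⟩

/-- The one-forms `Ω₂ + Ω̄₂` of two solutions of the structure equations with the same
`θ¹, θ², θ³` differ by a multiple of `θ³`. -/
theorem sum_sub_sum {i : ℝ} {X Y : CartanData} (hX : StructureEquations i X)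
    (hY : StructureEquations i Y) (hP : X.P = Y.P)
    (e1 : EqOn X.θ₁ Y.θ₁ Y.P) (e2 : EqOn X.θ₂ Y.θ₂ Y.P) (e3 : EqOn X.θ₃ Y.θ₃ Y.P)
    {u v₁ v₂ v₃ : R8} (hu : u ∈ Y.P) (hv : IsDualTriple Y u v₁ v₂ v₃) (v : R8) :
    X.Ω₂ u v + X.Ω₂b u v - (Y.Ω₂ u v + Y.Ω₂b u v) =
      (X.Ω₂ u v₃ + X.Ω₂b u v₃ - (Y.Ω₂ u v₃ + Y.Ω₂b u v₃)) * Y.θ₃ u v := by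
  have h := congrFun (congrFun (hX.d_θ₃ u (hP ▸ hu)) v) v₃
  rw [d_congr (e3.eventuallyEq_of_mem (hY.isOpen.mem_nhds hu)), hY.d_θ₃ u hu, e1 hu, e2 hu,
    e3 hu] at h
  simp only [Pi.add_apply, Pi.smul_apply, wedge_apply, add_apply, hv.h₃₃] at h
  linear_combination -h

set_option linter.unusedSimpArgs false in
/-- Uniqueness of the solution of the structure equations: when `θ¹, θ², θ³` and the sum
`Ω₂ + Ω̄₂` are given, all other forms and functions are determined. -/
theorem forms_unique {i : ℝ} (hi : i ≠ 0) {X Y : CartanData} (hX : StructureEquations i X)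
    (hY : StructureEquations i Y) (hP : X.P = Y.P)
    (e1 : EqOn X.θ₁ Y.θ₁ Y.P) (e2 : EqOn X.θ₂ Y.θ₂ Y.P) (e3 : EqOn X.θ₃ Y.θ₃ Y.P)
    (hdual : ∀ u ∈ Y.P, ∃ v₁ v₂ v₃, IsDualTriple Y u v₁ v₂ v₃)
    (hsum : ∀ u ∈ Y.P, X.Ω₂ u + X.Ω₂b u = Y.Ω₂ u + Y.Ω₂b u) :
    EqOn X.Ω₂ Y.Ω₂ Y.P ∧ EqOn X.Ω₂b Y.Ω₂b Y.P ∧ EqOn X.Ω₃ Y.Ω₃ Y.P ∧ EqOn X.Ω₃b Y.Ω₃b Y.P ∧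
      EqOn X.Ω₄ Y.Ω₄ Y.P ∧ EqOn X.R Y.R Y.P ∧ EqOn X.Rb Y.Rb Y.P ∧ EqOn X.S Y.S Y.P ∧
      EqOn X.Sb Y.Sb Y.P := by
  have hO := hY.isOpen
  have dc {α β : R8 → R8 →L[ℝ] ℝ} (h : EqOn α β Y.P) {u : R8} (hu : u ∈ Y.P) : d α u = d β u :=
    d_congr (h.eventuallyEq_of_mem (hO.mem_nhds hu))
  have sX := hX.smooth_form
  have sY := hY.smooth_form
  simp only [List.mem_cons, List.not_mem_nil, or_false, forall_eq_or_imp, forall_eq] at sX sY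
  rw [hP] at sX
  -- First order: the forms `Ω₂`, `Ω̄₂` agree modulo `θ³`, and `Ω₃`, `Ω̄₃` modulo `θ¹, θ², θ³`.
  have F {u : R8} (hu : u ∈ Y.P) {v₁ v₂ v₃ : R8} (hv : IsDualTriple Y u v₁ v₂ v₃) : ∃ β γ γb : ℝ,
      ∀ v, X.Ω₂ u v - Y.Ω₂ u v = β * Y.θ₃ u v ∧ X.Ω₂b u v - Y.Ω₂b u v = -β * Y.θ₃ u v ∧
        X.Ω₃ u v - Y.Ω₃ u v = β * Y.θ₁ u v + γ * Y.θ₃ u v ∧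
        X.Ω₃b u v - Y.Ω₃b u v = -β * Y.θ₂ u v + γb * Y.θ₃ u v := by
    have h1 (v w : R8) := congrFun (congrFun (hX.d_θ₁ u (hP ▸ hu)) v) w
    have h2 (v w : R8) := congrFun (congrFun (hX.d_θ₂ u (hP ▸ hu)) v) w
    have h3 (v : R8) := congrArg (· v) (hsum u hu)
    rw [dc e1 hu, hY.d_θ₁ u hu, e1 hu, e3 hu] at h1
    rw [dc e2 hu, hY.d_θ₂ u hu, e2 hu, e3 hu] at h2
    simp only [Pi.add_apply, wedge_apply] at h1 h2
    simp only [add_apply] at h3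
    obtain ⟨h11, h12, h13, h21, h22, h23, h31, h32, h33⟩ := hv
    have a1 (v : R8) := h1 v v₁
    have a3 (v : R8) := h1 v v₃
    have b2 (v : R8) := h2 v v₂
    have b3 (v : R8) := h2 v v₃
    simp only [h11, h12, h13, h21, h22, h23, h31, h32, h33] at a1 a3 b2 b3
    have a32 := a1 v₂
    have b31 := b2 v₁
    have a13 := a1 v₃
    simp only [h11, h12, h13, h21, h22, h23, h31, h32, h33] at a32 b31 a13
    refine ⟨X.Ω₂ u v₃ - Y.Ω₂ u v₃, X.Ω₃ u v₃ - Y.Ω₃ u v₃, X.Ω₃b u v₃ - Y.Ω₃b u v₃, fun v => ?_⟩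
    have k11 : X.Ω₂ u v₁ - Y.Ω₂ u v₁ = 0 := by linear_combination h3 v₁ + b31
    have r2 : X.Ω₂ u v - Y.Ω₂ u v = (X.Ω₂ u v₃ - Y.Ω₂ u v₃) * Y.θ₃ u v := by
      linear_combination -a1 v + Y.θ₁ u v * k11 + Y.θ₃ u v * a13
    exact ⟨r2, by linear_combination h3 v - r2, by linear_combination -a3 v,
      by linear_combination -b3 v + Y.θ₂ u v * h3 v₃⟩
  have G {u : R8} (hu : u ∈ Y.P) : X.Ω₂ u = Y.Ω₂ u := by
    obtain ⟨v₁, v₂, v₃, hv⟩ := hdual u hu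
    obtain ⟨β, γ, γb, h⟩ := F hu hv
    have hXd := differentiableAt_of_mem hO sX.2.2.2.1 hu
    have hYd := differentiableAt_of_mem hO sY.2.2.2.1 hu
    have hp : ∀ᶠ x in nhds u, ∃ β : ℝ, X.Ω₂ x - Y.Ω₂ x = β • Y.θ₃ x := by
      filter_upwards [hO.mem_nhds hu] with x hx
      obtain ⟨w₁, w₂, w₃, hw⟩ := hdual x hx
      obtain ⟨β, _, _, hβ⟩ := F hx hw
      exact ⟨β, ContinuousLinearMap.ext fun v => (hβ v).1⟩
    have hd := d_of_proportional (hXd.fun_sub hYd) (differentiableAt_of_mem hO sY.2.2.1 hu) hp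
      (ContinuousLinearMap.ext fun v => (h v).1) (v₀ := v₃) (by rw [hv.h₃₃]; exact one_ne_zero)
      hv.h₃₁ hv.h₃₂
    rw [d_sub hXd hYd, hX.d_Ω₂ u (hP ▸ hu), hY.d_Ω₂ u hu, hY.d_θ₃ u hu, e1 hu, e2 hu, e3 hu] at hd
    simp only [Pi.add_apply, Pi.sub_apply, Pi.smul_apply, wedge_apply, smul_eq_mul, add_apply,
      hv.h₁₁, hv.h₁₂, hv.h₂₁, hv.h₂₂, hv.h₃₁, hv.h₃₂] at hd
    have k1 := (h v₁).2.2.1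
    have k2 := (h v₂).2.2.2
    simp only [hv.h₁₁, hv.h₂₂, hv.h₃₁, hv.h₃₂] at k1 k2
    have hβ : i * β = 0 := by linear_combination -1 / 4 * hd + i / 2 * k2 - i / 4 * k1
    have hβ0 : β = 0 := (mul_eq_zero.1 hβ).resolve_left hi
    ext v
    linear_combination (h v).1 + Y.θ₃ u v * hβ0
  have Gb {u : R8} (hu : u ∈ Y.P) : X.Ω₂b u = Y.Ω₂b u := by
    have := hsum u hu
    rw [G hu] at this
    exact add_left_cancel this
  -- Second order: `Ω₃`, `Ω̄₃` and, modulo `θ³`, `Ω₄`.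
  have K {u : R8} (hu : u ∈ Y.P) {v₁ v₂ v₃ : R8} (hv : IsDualTriple Y u v₁ v₂ v₃) :
      X.Ω₃ u = Y.Ω₃ u ∧ X.Ω₃b u = Y.Ω₃b u ∧ ∃ δ : ℝ, ∀ v, X.Ω₄ u v - Y.Ω₄ u v = δ * Y.θ₃ u v := by
    obtain ⟨β, γ, γb, h⟩ := F hu hv
    have hβ := (h v₃).1
    rw [G hu, hv.h₃₃] at hβ
    have hβ0 : β = 0 := by linear_combination -hβ
    subst hβ0
    have h1 (v w : R8) := congrFun (congrFun (hX.d_Ω₂ u (hP ▸ hu)) v) w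
    have h2 (v w : R8) := congrFun (congrFun (hX.d_Ω₂b u (hP ▸ hu)) v) w
    rw [dc (fun _ hx => G hx) hu, hY.d_Ω₂ u hu, e1 hu, e2 hu, e3 hu] at h1
    rw [dc (fun _ hx => Gb hx) hu, hY.d_Ω₂b u hu, e1 hu, e2 hu, e3 hu] at h2
    simp only [Pi.add_apply, Pi.sub_apply, Pi.smul_apply, wedge_apply, smul_eq_mul] at h1 h2
    have p1 (v : R8) := (h v).2.2.1
    have p2 (v : R8) := (h v).2.2.2
    have q13 := h1 v₁ v₃
    have q23 := h1 v₂ v₃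
    have s13 := h2 v₁ v₃
    have s23 := h2 v₂ v₃
    obtain ⟨h11, h12, h13, h21, h22, h23, h31, h32, h33⟩ := hv
    simp only [h11, h12, h13, h21, h22, h23, h31, h32, h33] at q13 q23 s13 s23
    have r3 := p1 v₃
    have r3b := p2 v₃
    simp only [h13, h23, h33] at r3 r3b
    have g0 : i * γ = 0 := by linear_combination 1 / 3 * (s23 - q23) - i * r3
    have g0b : i * γb = 0 := by linear_combination 1 / 3 * (s13 - q13) - i * r3b
    have g := (mul_eq_zero.1 g0).resolve_left hi
    have gb := (mul_eq_zero.1 g0b).resolve_left hi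
    subst g gb
    have E3 : X.Ω₃ u = Y.Ω₃ u := ContinuousLinearMap.ext fun v => by linear_combination p1 v
    have E3b : X.Ω₃b u = Y.Ω₃b u := ContinuousLinearMap.ext fun v => by linear_combination p2 v
    refine ⟨E3, E3b, X.Ω₄ u v₃ - Y.Ω₄ u v₃, fun v => ?_⟩
    have t := h1 v v₃
    rw [E3, E3b, h33] at t
    linear_combination -t
  have K3 {u : R8} (hu : u ∈ Y.P) : X.Ω₃ u = Y.Ω₃ u :=
    let ⟨_, _, _, hv⟩ := hdual u hu; (K hu hv).1
  have K3b {u : R8} (hu : u ∈ Y.P) : X.Ω₃b u = Y.Ω₃b u :=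
    let ⟨_, _, _, hv⟩ := hdual u hu; (K hu hv).2.1
  -- Third order: `Ω₄` and the curvature functions.
  have L {u : R8} (hu : u ∈ Y.P) : X.Ω₄ u = Y.Ω₄ u ∧ X.R u = Y.R u ∧ X.Rb u = Y.Rb u := by
    obtain ⟨v₁, v₂, v₃, hv⟩ := hdual u hu
    obtain ⟨-, -, δ, hδ⟩ := K hu hv
    have h1 (v w : R8) := congrFun (congrFun (hX.d_Ω₃ u (hP ▸ hu)) v) w
    have h2 (v w : R8) := congrFun (congrFun (hX.d_Ω₃b u (hP ▸ hu)) v) w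
    rw [dc (fun _ hx => K3 hx) hu, hY.d_Ω₃ u hu, e1 hu, e2 hu, e3 hu, Gb hu, K3 hu] at h1
    rw [dc (fun _ hx => K3b hx) hu, hY.d_Ω₃b u hu, e1 hu, e2 hu, e3 hu, G hu, K3b hu] at h2
    simp only [Pi.add_apply, Pi.smul_apply, wedge_apply, smul_eq_mul] at h1 h2
    have q13 := h1 v₁ v₃
    have q23 := h1 v₂ v₃
    have s13 := h2 v₁ v₃
    have s23 := h2 v₂ v₃
    have d1 := hδ v₁
    have d2 := hδ v₂
    have d3 := hδ v₃
    simp only [hv.h₁₁, hv.h₁₂, hv.h₁₃, hv.h₂₁, hv.h₂₂, hv.h₂₃, hv.h₃₁, hv.h₃₂, hv.h₃₃]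
      at q13 q23 s13 s23 d1 d2 d3
    have hδ0 : δ = 0 := by linear_combination q13 - d3
    subst hδ0
    refine ⟨ContinuousLinearMap.ext fun v => by linear_combination hδ v, ?_, ?_⟩
    · linear_combination -q23
    · linear_combination -s13
  have M {u : R8} (hu : u ∈ Y.P) : X.S u = Y.S u ∧ X.Sb u = Y.Sb u := by
    obtain ⟨v₁, v₂, v₃, hv⟩ := hdual u hu
    have h1 (v w : R8) := congrFun (congrFun (hX.d_Ω₄ u (hP ▸ hu)) v) w
    rw [dc (fun _ hx => (L hx).1) hu, hY.d_Ω₄ u hu, e1 hu, e2 hu, e3 hu, G hu, Gb hu, K3 hu,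
      K3b hu, (L hu).1] at h1
    simp only [Pi.add_apply, Pi.smul_apply, wedge_apply, smul_eq_mul] at h1
    have q13 := h1 v₁ v₃
    have q23 := h1 v₂ v₃
    simp only [hv.h₁₁, hv.h₁₂, hv.h₁₃, hv.h₂₁, hv.h₂₂, hv.h₂₃, hv.h₃₁, hv.h₃₂, hv.h₃₃] at q13 q23
    constructor
    · linear_combination -q23
    · linear_combination -q13
  exact ⟨fun _ h => G h, fun _ h => Gb h, fun _ h => K3 h, fun _ h => K3b h, fun _ h => (L h).1,
    fun _ h => (L h).2.1, fun _ h => (L h).2.2, fun _ h => (M h).1, fun _ h => (M h).2⟩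

end Comparison

/-! ### The universal property of the bundle -/

section Universal

variable {i : ℝ} {U : Set J1} {Q : J1 → ℝ} {X Y : CartanData}

theorem contDiffOn_pull {E F : Type*} [NormedAddCommGroup E] [NormedSpace ℝ E]
    [NormedAddCommGroup F] [NormedSpace ℝ F] {A : Set E} {B : Set F} {f : E → F}
    {α : F → F →L[ℝ] ℝ} (hA : IsOpen A) (hf : ContDiffOn ℝ ∞ f A) (hAB : MapsTo f A B)
    (hα : ContDiffOn ℝ ∞ α B) : ContDiffOn ℝ ∞ (pull f α) A :=
  (hα.comp hf hAB).clm_comp (contDiffOn_fderiv hA hf)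

theorem pull_apply {E F : Type*} [NormedAddCommGroup E] [NormedSpace ℝ E]
    [NormedAddCommGroup F] [NormedSpace ℝ F] (f : E → F) (α : F → F →L[ℝ] ℝ) (u v : E) :
    pull f α u v = α (f u) (fderiv ℝ f u v) := rfl

/-- The forms and curvature functions of `X`, pulled back by a map from the manifold of `Y`. -/
def pullData (Y X : CartanData) (Φ : R8 → R8) : CartanData where
  P := Y.P
  π := Y.π
  a := Y.a
  b := Y.b
  bb := Y.bb
  c := Y.c
  cb := Y.cb
  θ₁ := pull Φ X.θ₁
  θ₂ := pull Φ X.θ₂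
  θ₃ := pull Φ X.θ₃
  Ω₂ := pull Φ X.Ω₂
  Ω₂b := pull Φ X.Ω₂b
  Ω₃ := pull Φ X.Ω₃
  Ω₃b := pull Φ X.Ω₃b
  Ω₄ := pull Φ X.Ω₄
  R u := X.R (Φ u)
  Rb u := X.Rb (Φ u)
  S u := X.S (Φ u)
  Sb u := X.Sb (Φ u)

theorem StructureEquations.pullData (hX : StructureEquations i X) (hY : IsOpen Y.P) {Φ : R8 → R8}
    (hΦ : ContDiffOn ℝ ∞ Φ Y.P) (hm : MapsTo Φ Y.P X.P) :
    StructureEquations i (pullData Y X Φ) := by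
  have s := hX.smooth_form
  simp only [List.mem_cons, List.not_mem_nil, or_false, forall_eq_or_imp, forall_eq] at s
  have dp {α : R8 → R8 →L[ℝ] ℝ} (hα : ContDiffOn ℝ ∞ α X.P) {u : R8} (hu : u ∈ Y.P) (v w : R8) :=
    d_pull (differentiableAt_of_mem hX.isOpen hα (hm hu)) (contDiffAt_of_mem hY hΦ hu) v w
  have sp {α : R8 → R8 →L[ℝ] ℝ} (hα : ContDiffOn ℝ ∞ α X.P) := contDiffOn_pull hY hΦ hm hα
  obtain ⟨s1, s2, s3, s4, s5, s6, s7, s8⟩ := s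
  refine ⟨hY, ?_, fun u hu => ?_, fun u hu => ?_, fun u hu => ?_, fun u hu => ?_, fun u hu => ?_,
    fun u hu => ?_, fun u hu => ?_, fun u hu => ?_⟩
  · simp only [List.mem_cons, List.not_mem_nil, or_false, forall_eq_or_imp, forall_eq]
    exact ⟨sp s1, sp s2, sp s3, sp s4, sp s5, sp s6, sp s7, sp s8⟩
  · funext v w
    exact (dp s1 hu v w).trans (congrFun (congrFun (hX.d_θ₁ _ (hm hu)) _) _)
  · funext v w
    exact (dp s2 hu v w).trans (congrFun (congrFun (hX.d_θ₂ _ (hm hu)) _) _)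
  · funext v w
    exact (dp s3 hu v w).trans (congrFun (congrFun (hX.d_θ₃ _ (hm hu)) _) _)
  · funext v w
    exact (dp s4 hu v w).trans (congrFun (congrFun (hX.d_Ω₂ _ (hm hu)) _) _)
  · funext v w
    exact (dp s5 hu v w).trans (congrFun (congrFun (hX.d_Ω₂b _ (hm hu)) _) _)
  · funext v w
    exact (dp s6 hu v w).trans (congrFun (congrFun (hX.d_Ω₃ _ (hm hu)) _) _)
  · funext v w
    exact (dp s7 hu v w).trans (congrFun (congrFun (hX.d_Ω₃b _ (hm hu)) _) _)
  · funext v w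
    exact (dp s8 hu v w).trans (congrFun (congrFun (hX.d_Ω₄ _ (hm hu)) _) _)

/-- The factor between proportional smooth one-forms is smooth where the second one does not
vanish. -/
theorem exists_smooth_factor {P : Set R8} (hP : IsOpen P) {α θ : R8 → R8 →L[ℝ] ℝ}
    (hα : ContDiffOn ℝ ∞ α P) (hθ : ContDiffOn ℝ ∞ θ P) (h0 : ∀ u ∈ P, ∃ v, θ u v ≠ 0)
    (h : ∀ u ∈ P, ∃ β : ℝ, ∀ v, α u v = β * θ u v) :
    ∃ s : R8 → ℝ, ContDiffOn ℝ ∞ s P ∧ ∀ u ∈ P, ∀ v, α u v = s u * θ u v := by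
  choose! s hs using h
  refine ⟨s, fun u hu => ?_, hs⟩
  obtain ⟨v, hv⟩ := h0 u hu
  have sα := (contDiffAt_of_mem hP hα hu).clm_apply (contDiffAt_const (c := v))
  have sθ := (contDiffAt_of_mem hP hθ hu).clm_apply (contDiffAt_const (c := v))
  refine ((sα.div sθ hv).congr_of_eventuallyEq ?_).contDiffWithinAt
  filter_upwards [hP.mem_nhds hu, sθ.continuousAt.eventually_ne hv] with x hx hx'
  exact eq_div_of_mul_eq hx' (hs x hx v).symm

/-- The coframe determines `a` from `b` and `b̄`. -/
theorem IsCartanCoframe.a_eq (hi : i ≠ 0) (hY : IsCartanCoframe i U Q Y) {u : R8} (hu : u ∈ Y.P) :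
    Y.a u = Y.b u * Y.bb u := by
  obtain ⟨v₁, v₂, v₃, hv⟩ := hY.exists_dual hu
  obtain ⟨ha, hb, hbb⟩ := hY.ne_zero u hu
  have sf := hY.smooth_fun
  simp only [List.mem_cons, List.not_mem_nil, or_false, forall_eq_or_imp, forall_eq] at sf
  have hL : ContDiffOn ℝ ∞ (pull Y.π (lam i)) Y.P :=
    contDiffOn_pull (B := univ) hY.isOpen hY.smooth_proj (mapsTo_univ _ _)
      (contDiff_lam i).contDiffOn
  have e : Y.θ₃ =ᶠ[nhds u] fun x => Y.a x • pull Y.π (lam i) x := by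
    filter_upwards [hY.isOpen.mem_nhds hu] with x hx using hY.θ₃_eq x hx
  have h := congrFun (congrFun (hY.d_θ₃ u hu) v₁) v₂
  rw [d_congr e, d_smul (differentiableAt_of_mem hY.isOpen sf.1 hu)
    (differentiableAt_of_mem hY.isOpen hL hu)] at h
  simp only [Pi.add_apply, Pi.smul_apply, wedge_apply, smul_eq_mul] at h
  rw [d_pull (differentiableAt_lam i _) (contDiffAt_of_mem hY.isOpen hY.smooth_proj hu),
    d_lam i Q] at h
  have l (v : R8) := congrArg (· v) (hY.θ₃_eq u hu)
  have m (v : R8) := congrArg (· v) (hY.θ₁_eq u hu)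
  have x (v : R8) := congrArg (· v) (hY.θ₂_eq u hu)
  simp only [add_apply, smul_apply, smul_eq_mul, pull_apply] at l m x
  have l1 := l v₁; have l2 := l v₂; have m1 := m v₁
  have m2 := m v₂; have x1 := x v₁; have x2 := x v₂
  simp only [hv.h₁₁, hv.h₁₂, hv.h₂₁, hv.h₂₂, hv.h₃₁, hv.h₃₂, wedge_apply, pull_apply]
    at l1 l2 m1 m2 x1 x2 h
  have L1 := (mul_eq_zero.1 l1.symm).resolve_left ha
  have L2 := (mul_eq_zero.1 l2.symm).resolve_left ha
  rw [L1, mul_zero, add_zero] at m1 x1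
  rw [L2, mul_zero, add_zero] at m2 x2
  have M2 := (mul_eq_zero.1 m2.symm).resolve_left hb
  rw [L1, L2, M2] at h
  refine mul_left_cancel₀ hi ?_
  linear_combination (Y.b u * Y.bb u) * h + (i * Y.a u) * m1
    + (i * Y.a u * Y.b u * mu Q (Y.π u) (fderiv ℝ Y.π u v₁)) * x2

/-- The cube root `x |x|^{-2/3}`, smooth on the nonzero reals, for both signs because `Real.log x` is
`log |x|`. -/
def realCbrt (x : ℝ) : ℝ := x * Real.exp (-2 / 3 * Real.log x)

theorem realCbrt_pow {x : ℝ} (hx : x ≠ 0) : realCbrt x ^ 3 = x := by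
  have h : Real.exp (-2 / 3 * Real.log x) ^ 3 = (x ^ 2)⁻¹ := by
    rw [← Real.exp_nat_mul, ← sq_abs, ← Real.log_abs, ← Real.exp_log (abs_pos.2 hx),
      ← Real.exp_nat_mul, ← Real.exp_neg, Real.log_exp]
    congr 1
    push_cast
    ring
  rw [realCbrt, mul_pow, h]
  field_simp

theorem realCbrt_ne_zero {x : ℝ} (hx : x ≠ 0) : realCbrt x ≠ 0 :=
  mul_ne_zero hx (Real.exp_pos _).ne'

theorem contDiffOn_realCbrt {P : Set R8} {f : R8 → ℝ} (hf : ContDiffOn ℝ ∞ f P)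
    (h0 : ∀ u ∈ P, f u ≠ 0) : ContDiffOn ℝ ∞ (fun u => realCbrt (f u)) P :=
  hf.mul ((contDiffOn_const.mul (hf.log h0)).exp)

/-- The map to the bundle that covers the projection of `Y`, is determined on the fibre coordinates
`u 3, …, u 6` by the functions `b, b̄, c, c̄` of `Y`, and has last coordinate `n`. -/
def lift (i : ℝ) (Y : CartanData) (n : R8 → ℝ) (u : R8) : R8 :=
  let k := realCbrt (Y.bb u * (Y.b u)⁻¹)
  ![Y.π u 0, Y.π u 1, Y.π u 2, Y.b u * k, k, i * (Y.cb u * k * (Y.bb u)⁻¹),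
    -1 / 2 * (Y.c u * (Y.b u * k)⁻¹ ^ 2), n u]

theorem base_lift (n : R8 → ℝ) (u : R8) : base (lift i Y n u) = Y.π u := by
  ext k; fin_cases k <;> rfl

theorem contDiffOn_lift (hY : IsCartanCoframe i U Q Y) {n : R8 → ℝ} (hn : ContDiffOn ℝ ∞ n Y.P) :
    ContDiffOn ℝ ∞ (lift i Y n) Y.P := by
  have sf := hY.smooth_fun
  simp only [List.mem_cons, List.not_mem_nil, or_false, forall_eq_or_imp, forall_eq] at sf
  obtain ⟨-, sb, sbb, sc, scb, -⟩ := sf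
  have hb := fun u hu => (hY.ne_zero u hu).2.1
  have hbb := fun u hu => (hY.ne_zero u hu).2.2
  have hk0 : ∀ u ∈ Y.P, Y.bb u * (Y.b u)⁻¹ ≠ 0 := fun u hu =>
    mul_ne_zero (hbb u hu) (inv_ne_zero (hb u hu))
  have k := contDiffOn_realCbrt (sbb.mul (sb.inv hb)) hk0
  have bk := sb.mul k
  have p (j : Fin 3) : ContDiffOn ℝ ∞ (fun u => Y.π u j) Y.P := contDiffOn_pi.1 hY.smooth_proj j
  have c {r : ℝ} : ContDiffOn ℝ ∞ (fun _ : R8 => r) Y.P := contDiffOn_const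
  refine contDiffOn_pi.2 fun j => ?_
  fin_cases j
  exacts [p 0, p 1, p 2, bk, k, c.mul ((scb.mul k).mul (sbb.inv hbb)), c.mul (sc.mul ((bk.inv
    fun u hu => mul_ne_zero (hb u hu) (realCbrt_ne_zero (hk0 u hu))).pow 2)), hn]

theorem lift_mem (hY : IsCartanCoframe i U Q Y) (n : R8 → ℝ) {u : R8} (hu : u ∈ Y.P) :
    lift i Y n u ∈ total U := by
  obtain ⟨-, hb, hbb⟩ := hY.ne_zero u hu
  have hk := realCbrt_ne_zero (mul_ne_zero hbb (inv_ne_zero hb))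
  exact ⟨(base_lift (i := i) (Y := Y) n u).symm ▸ hY.mapsTo hu, mul_ne_zero hb hk, hk⟩

theorem lift_coefficients (hi : i ≠ 0) (hY : IsCartanCoframe i U Q Y) (n : R8 → ℝ) {u : R8}
    (hu : u ∈ Y.P) :
    (bundle i U Q).a (lift i Y n u) = Y.a u ∧ (bundle i U Q).b (lift i Y n u) = Y.b u ∧
      (bundle i U Q).bb (lift i Y n u) = Y.bb u ∧ (bundle i U Q).c (lift i Y n u) = Y.c u ∧
      (bundle i U Q).cb (lift i Y n u) = Y.cb u := by
  obtain ⟨-, hb, hbb⟩ := hY.ne_zero u hu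
  have h0 := mul_ne_zero hbb (inv_ne_zero hb)
  have hk := realCbrt_ne_zero h0
  have hk3 := realCbrt_pow h0
  have ha := hY.a_eq hi hu
  simp only [bundle, lift, Matrix.cons_val]
  generalize realCbrt (Y.bb u * (Y.b u)⁻¹) = k at *
  have hk3' : Y.bb u = Y.b u * k ^ 3 := by rw [hk3]; field_simp
  refine ⟨?_, ?_, ?_, ?_, ?_⟩
  · rw [ha, hk3']; ring
  · field_simp
  · rw [hk3']; ring
  · field_simp
  · rw [hk3']; field_simp

/-- The forms `θ¹, θ², θ³` of the bundle, pulled back by a map that covers a given map to the jet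
space. -/
theorem pull_theta (hi : i ≠ 0) {Φ : R8 → R8} {π : R8 → J1} {u : R8} (hΦ : DifferentiableAt ℝ Φ u)
    (hm : Φ u ∈ total U) (hπ : (fun x => base (Φ x)) =ᶠ[nhds u] π) (v : R8) :
    pull Φ (bundle i U Q).θ₁ u v = (bundle i U Q).b (Φ u) * pull π (mu Q) u v
      + (bundle i U Q).c (Φ u) * pull π (lam i) u v ∧
    pull Φ (bundle i U Q).θ₂ u v = (bundle i U Q).bb (Φ u) * pull π mub u v
      + (bundle i U Q).cb (Φ u) * pull π (lam i) u v ∧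
    pull Φ (bundle i U Q).θ₃ u v = (bundle i U Q).a (Φ u) * pull π (lam i) u v := by
  have e1 : base (Φ u) = π u := hπ.self_of_nhds
  have e2 : baseL (fderiv ℝ Φ u v) = fderiv ℝ π u v := by rw [baseL_fderiv hΦ, hπ.fderiv_eq]
  simp only [pull_apply, ← e1, ← e2]
  exact ⟨bundle_θ₁_apply _ _, bundle_θ₂_apply hi hm _, bundle_θ₃_apply _ _⟩

/-- The dependence of `Ω₂ + Ω̄₂` on the last fibre coordinate. -/
theorem sum_shift {u u' v v' : R8} (hu : ∀ k, k ≠ 7 → u k = u' k) (hv : ∀ k, k ≠ 7 → v k = v' k) :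
    (bundle i U Q).Ω₂ u v + (bundle i U Q).Ω₂b u v =
      (bundle i U Q).Ω₂ u' v' + (bundle i U Q).Ω₂b u' v'
        - 4 * (u' 3 * u' 4) * (u 7 - u' 7) * lam i (base u') (baseL v') := by
  have eb : base u = base u' := by
    simp [base, hu 0 (by decide), hu 1 (by decide), hu 2 (by decide)]
  have ev : baseL v = baseL v' := by
    simp [baseL_apply, hv 0 (by decide), hv 1 (by decide), hv 2 (by decide)]
  simp only [bundle_Ω₂, bundle_Ω₂b, sub_apply, cartanForm_apply, Fin.sum_univ_three, gauge_apply,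
    eb, ev]
  simp [fiberInv, fiberMat, dFiber, gaugeP, gaugeL, gaugeM, dc, hu 3 (by decide), hu 4 (by decide),
    hu 5 (by decide), hu 6 (by decide), hv 3 (by decide), hv 4 (by decide), hv 5 (by decide),
    hv 6 (by decide)]
  ring

theorem fderiv_coord {Φ : R8 → R8} {u : R8} (h : DifferentiableAt ℝ Φ u) (v : R8) (k : Fin 8) :
    fderiv ℝ (fun x => Φ x k) u v = fderiv ℝ Φ u v k :=
  congrArg (· v) ((hasFDerivAt_apply (𝕜 := ℝ) k (Φ u)).comp u h.hasFDerivAt).fderiv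

theorem lift_apply_of_ne (n n' : R8 → ℝ) {k : Fin 8} (hk : k ≠ 7) (u : R8) :
    lift i Y n u k = lift i Y n' u k := by
  obtain ⟨k, h⟩ := k
  have hk7 : k ≠ 7 := fun h => hk (Fin.ext h)
  interval_cases k <;> simp_all [lift]

theorem pull_lift_theta (hi : i ≠ 0) (hY : IsCartanCoframe i U Q Y) {n : R8 → ℝ}
    (hn : ContDiffOn ℝ ∞ n Y.P) :
    EqOn (pull (lift i Y n) (bundle i U Q).θ₁) Y.θ₁ Y.P ∧
      EqOn (pull (lift i Y n) (bundle i U Q).θ₂) Y.θ₂ Y.P ∧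
      EqOn (pull (lift i Y n) (bundle i U Q).θ₃) Y.θ₃ Y.P := by
  have h {u : R8} (hu : u ∈ Y.P) (v : R8) := pull_theta (Q := Q) hi
    (differentiableAt_of_mem hY.isOpen (contDiffOn_lift (i := i) hY hn) hu) (lift_mem hY n hu)
    (Filter.Eventually.of_forall (base_lift n)) v
  have e {u : R8} (hu : u ∈ Y.P) := lift_coefficients hi hY n hu
  refine ⟨fun u hu => ?_, fun u hu => ?_, fun u hu => ?_⟩ <;> ext v
  · rw [(h hu v).1, (e hu).2.1, (e hu).2.2.2.1, hY.θ₁_eq u hu]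
    rfl
  · rw [(h hu v).2.1, (e hu).2.2.1, (e hu).2.2.2.2, hY.θ₂_eq u hu]
    rfl
  · rw [(h hu v).2.2, (e hu).1, hY.θ₃_eq u hu]
    rfl

theorem pullData_lift (hi : i ≠ 0) (hU : IsOpen U) (hQ : ContDiffOn ℝ ∞ Q U)
    (hY : IsCartanCoframe i U Q Y) {n : R8 → ℝ} (hn : ContDiffOn ℝ ∞ n Y.P) :
    StructureEquations i (pullData Y (bundle i U Q) (lift i Y n)) :=
  (isCartanCoframe_bundle hi hU hQ).structureEquations.pullData hY.isOpen (contDiffOn_lift hY hn)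
    fun _ hu => lift_mem hY n hu

/-- The last coordinate `n` can be chosen such that `Ω₂ + Ω̄₂` is pulled back correctly. -/
theorem exists_lift_sum (hi : i ≠ 0) (hU : IsOpen U) (hQ : ContDiffOn ℝ ∞ Q U)
    (hY : IsCartanCoframe i U Q Y) : ∃ n : R8 → ℝ, ContDiffOn ℝ ∞ n Y.P ∧ ∀ u ∈ Y.P,
      pull (lift i Y n) (bundle i U Q).Ω₂ u + pull (lift i Y n) (bundle i U Q).Ω₂b u
        = Y.Ω₂ u + Y.Ω₂b u := by
  have hO := hY.isOpen
  have sY := hY.smooth_form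
  have z : ContDiffOn ℝ ∞ (fun _ : R8 => (0 : ℝ)) Y.P := contDiffOn_const
  have S := pullData_lift hi hU hQ hY z
  have sS := S.smooth_form
  simp only [List.mem_cons, List.not_mem_nil, or_false, forall_eq_or_imp, forall_eq] at sY sS
  have D {n : R8 → ℝ} (hn : ContDiffOn ℝ ∞ n Y.P) {u : R8} (hu : u ∈ Y.P) :=
    differentiableAt_of_mem hO (contDiffOn_lift (i := i) hY hn) hu
  have T := pull_lift_theta hi hY z
  -- With last coordinate `0`, the sum `Ω₂ + Ω̄₂` is off by a multiple `s θ³`.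
  obtain ⟨s, ss, hs⟩ := exists_smooth_factor hO
    ((sS.2.2.2.1.add sS.2.2.2.2.1).sub (sY.2.2.2.1.add sY.2.2.2.2.1)) sY.2.2.1
    (fun u hu => by
      obtain ⟨v₁, v₂, v₃, hv⟩ := hY.exists_dual hu
      exact ⟨v₃, by rw [hv.h₃₃]; exact one_ne_zero⟩)
    (fun u hu => by
      obtain ⟨v₁, v₂, v₃, hv⟩ := hY.exists_dual hu
      exact ⟨_, fun v => sum_sub_sum S hY.structureEquations rfl T.1 T.2.1 T.2.2 hu hv v⟩)
  refine ⟨fun u => 1 / 4 * (s u * lift i Y (fun _ => 0) u 3),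
    contDiffOn_const.mul (ss.mul (contDiffOn_pi.1 (contDiffOn_lift hY z) 3)), fun u hu => ?_⟩
  have hn : ContDiffOn ℝ ∞ (fun u => 1 / 4 * (s u * lift i Y (fun _ => 0) u 3)) Y.P :=
    contDiffOn_const.mul (ss.mul (contDiffOn_pi.1 (contDiffOn_lift hY z) 3))
  have hn7 : lift i Y (fun u => 1 / 4 * (s u * lift i Y (fun _ => 0) u 3)) u 7
    = 1 / 4 * (s u * lift i Y (fun _ => 0) u 3) := rfl
  generalize (fun u => 1 / 4 * (s u * lift i Y (fun _ => 0) u 3)) = n at *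
  ext v
  have h0 : pull (lift i Y fun _ => 0) (bundle i U Q).Ω₂ u v
    + pull (lift i Y fun _ => 0) (bundle i U Q).Ω₂b u v - (Y.Ω₂ u v + Y.Ω₂b u v)
    = s u * Y.θ₃ u v := hs u hu v
  have h1 := sum_shift (i := i) (Q := Q) (U := U) (u := lift i Y n u)
    (u' := lift i Y (fun _ => 0) u) (v := fderiv ℝ (lift i Y n) u v)
    (v' := fderiv ℝ (lift i Y fun _ => 0) u v) (fun k hk => lift_apply_of_ne _ _ hk u)
    (fun k hk => by
      rw [← fderiv_coord (D hn hu), ← fderiv_coord (D z hu)]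
      simp only [lift_apply_of_ne n (fun _ => 0) hk])
  have h2 : Y.θ₃ u v = (bundle i U Q).θ₃ (lift i Y (fun _ => 0) u)
    (fderiv ℝ (lift i Y fun _ => 0) u v) := (congrArg (· v) (T.2.2 hu)).symm
  rw [bundle_θ₃_apply] at h2
  have h3 : (bundle i U Q).a (lift i Y (fun _ => 0) u)
    = lift i Y (fun _ => 0) u 3 ^ 2 * lift i Y (fun _ => 0) u 4 := rfl
  have h4 : lift i Y (fun _ => 0) u 7 = 0 := rfl
  rw [h3] at h2
  rw [h4, hn7] at h1
  simp only [pull_apply] at h0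
  simp only [add_apply, pull_apply]
  linear_combination h1 + h0 + s u * h2

/-- Existence in the universal property, over the identity. -/
theorem exists_isMorphism_id (hi : i ≠ 0) (hU : IsOpen U) (hQ : ContDiffOn ℝ ∞ Q U)
    (hY : IsCartanCoframe i U Q Y) : ∃ Φ, IsMorphism Y (bundle i U Q) id Φ := by
  obtain ⟨n, hn, hsum⟩ := exists_lift_sum hi hU hQ hY
  have T := pull_lift_theta hi hY hn
  obtain ⟨h2, h2b, h3, h3b, h4, hR, hRb, hS, hSb⟩ := forms_unique hi (pullData_lift hi hU hQ hY hn)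
    hY.structureEquations rfl T.1 T.2.1 T.2.2 (fun u hu => hY.exists_dual hu) hsum
  exact ⟨lift i Y n, contDiffOn_lift hY hn, fun u hu => lift_mem hY n hu,
    fun u _ => base_lift n u, T.1, T.2.1, T.2.2, h2, h2b, h3, h3b, h4, hR, hRb, hS, hSb⟩

/-- Uniqueness in the universal property, over the identity. -/
theorem isMorphism_id_unique (hi : i ≠ 0) (hY : IsCartanCoframe i U Q Y) {Φ Ψ : R8 → R8}
    (hΦ : IsMorphism Y (bundle i U Q) id Φ) (hΨ : IsMorphism Y (bundle i U Q) id Ψ) :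
    EqOn Φ Ψ Y.P := by
  -- The coefficients of the pulled back forms `θ¹, θ², θ³` determine all but the last coordinate.
  have key {Φ : R8 → R8} (hΦ : IsMorphism Y (bundle i U Q) id Φ) {u : R8} (hu : u ∈ Y.P) :
      (bundle i U Q).b (Φ u) = Y.b u ∧ (bundle i U Q).bb (Φ u) = Y.bb u ∧
        (bundle i U Q).c (Φ u) = Y.c u ∧ (bundle i U Q).cb (Φ u) = Y.cb u := by
    obtain ⟨v₁, v₂, v₃, hv⟩ := hY.exists_dual hu
    obtain ⟨ha, hb, hbb⟩ := hY.ne_zero u hu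
    have hπ : (fun x => base (Φ x)) =ᶠ[nhds u] Y.π := by
      filter_upwards [hY.isOpen.mem_nhds hu] with x hx using hΦ.proj x hx
    have h (v : R8) := pull_theta (Q := Q) hi (differentiableAt_of_mem hY.isOpen hΦ.smooth hu)
      (hΦ.mapsTo hu) hπ v
    have l (v : R8) := congrArg (· v) (hY.θ₃_eq u hu)
    have m (v : R8) := congrArg (· v) (hY.θ₁_eq u hu)
    have x (v : R8) := congrArg (· v) (hY.θ₂_eq u hu)
    simp only [add_apply, smul_apply, smul_eq_mul] at l m x
    have g1 (v : R8) := (h v).1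
    have g2 (v : R8) := (h v).2.1
    rw [hΦ.θ₁ u hu] at g1
    rw [hΦ.θ₂ u hu] at g2
    have l1 := l v₁; have l2 := l v₂; have l3 := l v₃
    have m1 := m v₁; have m3 := m v₃; have x2 := x v₂; have x3 := x v₃
    have p1 := g1 v₁; have p3 := g1 v₃; have q2 := g2 v₂; have q3 := g2 v₃
    simp only [hv.h₁₁, hv.h₁₃, hv.h₂₂, hv.h₂₃, hv.h₃₁, hv.h₃₂, hv.h₃₃]
      at l1 l2 l3 m1 m3 x2 x3 p1 p3 q2 q3
    have L1 := (mul_eq_zero.1 l1.symm).resolve_left ha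
    have L2 := (mul_eq_zero.1 l2.symm).resolve_left ha
    rw [L1, mul_zero, add_zero] at m1 p1
    rw [L2, mul_zero, add_zero] at x2 q2
    have eb : (bundle i U Q).b (Φ u) = Y.b u :=
      mul_right_cancel₀ (right_ne_zero_of_mul_eq_one m1.symm) (p1.symm.trans m1)
    have ebb : (bundle i U Q).bb (Φ u) = Y.bb u :=
      mul_right_cancel₀ (right_ne_zero_of_mul_eq_one x2.symm) (q2.symm.trans x2)
    have hL := right_ne_zero_of_mul_eq_one l3.symm
    refine ⟨eb, ebb, mul_right_cancel₀ hL ?_, mul_right_cancel₀ hL ?_⟩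
    · rw [eb] at p3
      linear_combination m3 - p3
    · rw [ebb] at q3
      linear_combination x3 - q3
  have co {u : R8} (hu : u ∈ Y.P) (k : Fin 8) (hk : k ≠ 7) : Φ u k = Ψ u k := by
    obtain ⟨b1, bb1, c1, cb1⟩ := key hΦ hu
    obtain ⟨b2, bb2, c2, cb2⟩ := key hΨ hu
    have eb : Φ u 3 * (Φ u 4)⁻¹ = Ψ u 3 * (Ψ u 4)⁻¹ := b1.trans b2.symm
    have ebb : Φ u 3 * Φ u 4 ^ 2 = Ψ u 3 * Ψ u 4 ^ 2 := bb1.trans bb2.symm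
    have ec : -2 * Φ u 6 * Φ u 3 ^ 2 = -2 * Ψ u 6 * Ψ u 3 ^ 2 := c1.trans c2.symm
    have ecb : i⁻¹ * (Φ u 5 * Φ u 3 * Φ u 4) = i⁻¹ * (Ψ u 5 * Ψ u 3 * Ψ u 4) := cb1.trans cb2.symm
    have hbase : base (Φ u) = base (Ψ u) := (hΦ.proj u hu).trans (hΨ.proj u hu).symm
    obtain ⟨-, n3, n4⟩ := hΦ.mapsTo hu
    obtain ⟨-, m3, m4⟩ := hΨ.mapsTo hu
    have e4 : Φ u 4 = Ψ u 4 := by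
      refine (Odd.strictMono_pow (R := ℝ) (n := 3) (by decide)).injective ?_
      refine mul_left_cancel₀ (mul_ne_zero n3 (inv_ne_zero n4)) ?_
      have h1 : Φ u 3 * (Φ u 4)⁻¹ * Φ u 4 ^ 3 = Φ u 3 * Φ u 4 ^ 2 := by field_simp
      have h2 : Ψ u 3 * (Ψ u 4)⁻¹ * Ψ u 4 ^ 3 = Ψ u 3 * Ψ u 4 ^ 2 := by field_simp
      change _ * Φ u 4 ^ 3 = _ * Ψ u 4 ^ 3
      rw [h1, ebb, eb, h2]
    have e3 : Φ u 3 = Ψ u 3 := by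
      rw [e4] at ebb
      exact mul_right_cancel₀ (pow_ne_zero 2 m4) ebb
    have e5 : Φ u 5 = Ψ u 5 := by
      rw [e3, e4] at ecb
      exact mul_right_cancel₀ m3 (mul_right_cancel₀ m4 (mul_left_cancel₀ (inv_ne_zero hi) ecb))
    have e6 : Φ u 6 = Ψ u 6 := by
      rw [e3] at ec
      exact mul_left_cancel₀ (by norm_num) (mul_right_cancel₀ (pow_ne_zero 2 m3) ec)
    fin_cases k
    exacts [congrFun hbase 0, congrFun hbase 1, congrFun hbase 2, e3, e4, e5, e6, absurd rfl hk]
  intro u hu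
  have e7 : Φ u 7 = Ψ u 7 := by
    obtain ⟨v₁, v₂, v₃, hv⟩ := hY.exists_dual hu
    have dΦ := differentiableAt_of_mem hY.isOpen hΦ.smooth hu
    have dΨ := differentiableAt_of_mem hY.isOpen hΨ.smooth hu
    have h := sum_shift (i := i) (Q := Q) (U := U) (u := Φ u) (u' := Ψ u) (v := fderiv ℝ Φ u v₃)
      (v' := fderiv ℝ Ψ u v₃) (co hu) (fun k hk => by
        rw [← fderiv_coord dΦ, ← fderiv_coord dΨ]
        have e : (fun x => Φ x k) =ᶠ[nhds u] fun x => Ψ x k := by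
          filter_upwards [hY.isOpen.mem_nhds hu] with x hx using co hx k hk
        rw [e.fderiv_eq])
    have a1 : (bundle i U Q).Ω₂ (Φ u) (fderiv ℝ Φ u v₃) = Y.Ω₂ u v₃ := congrArg (· v₃) (hΦ.Ω₂ u hu)
    have a2 : (bundle i U Q).Ω₂ (Ψ u) (fderiv ℝ Ψ u v₃) = Y.Ω₂ u v₃ := congrArg (· v₃) (hΨ.Ω₂ u hu)
    have b1 : (bundle i U Q).Ω₂b (Φ u) (fderiv ℝ Φ u v₃) = Y.Ω₂b u v₃ :=
      congrArg (· v₃) (hΦ.Ω₂b u hu)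
    have b2 : (bundle i U Q).Ω₂b (Ψ u) (fderiv ℝ Ψ u v₃) = Y.Ω₂b u v₃ :=
      congrArg (· v₃) (hΨ.Ω₂b u hu)
    have t : (bundle i U Q).θ₃ (Ψ u) (fderiv ℝ Ψ u v₃) = 1 :=
      (congrArg (· v₃) (hΨ.θ₃ u hu)).trans hv.h₃₃
    rw [bundle_θ₃_apply] at t
    rw [a1, a2, b1, b2] at h
    have hl := right_ne_zero_of_mul_eq_one t
    have h34 := mul_ne_zero (hΨ.mapsTo hu).2.1 (hΨ.mapsTo hu).2.2
    have h0 : (4 * (Ψ u 3 * Ψ u 4)) * (Φ u 7 - Ψ u 7) = 0 :=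
      (mul_eq_zero.1 (show 4 * (Ψ u 3 * Ψ u 4) * (Φ u 7 - Ψ u 7) *
        lam i (base (Ψ u)) (baseL (fderiv ℝ Ψ u v₃)) = 0 by linear_combination h)).resolve_right hl
    exact sub_eq_zero.1 ((mul_eq_zero.1 h0).resolve_left (mul_ne_zero four_ne_zero h34))
  ext k
  by_cases hk : k = 7
  · rw [hk, e7]
  · exact co hu k hk

end Universal

/-! ### Point equivalences -/

section PointMaps

variable {i : ℝ} {U U' : Set J1} {Q Q' : J1 → ℝ} {X Y Z : CartanData} {φ : J1 → J1}

theorem pull_comp {E F G : Type*} [NormedAddCommGroup E] [NormedSpace ℝ E] [NormedAddCommGroup F]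
    [NormedSpace ℝ F] [NormedAddCommGroup G] [NormedSpace ℝ G] {f : F → G} {g : E → F} {u : E}
    (hf : DifferentiableAt ℝ f (g u)) (hg : DifferentiableAt ℝ g u) (α : G → G →L[ℝ] ℝ) :
    pull (fun x => f (g x)) α u = (pull f α (g u)).comp (fderiv ℝ g u) := by
  exact congrArg (α (f (g u))).comp (hf.hasFDerivAt.comp u hg.hasFDerivAt).fderiv

theorem IsMorphism.comp {ψ χ : J1 → J1} {Φ Ψ : R8 → R8} (hX : IsOpen X.P) (hY : IsOpen Y.P)
    (hΨ : IsMorphism Y Z ψ Ψ) (hΦ : IsMorphism X Y φ Φ)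
    (hχ : ∀ u ∈ X.P, ψ (φ (X.π u)) = χ (X.π u)) :
    IsMorphism X Z χ (fun u => Ψ (Φ u)) := by
  have p {αX αY αZ : R8 → R8 →L[ℝ] ℝ} (h1 : ∀ u ∈ Y.P, pull Ψ αZ u = αY u)
      (h2 : ∀ u ∈ X.P, pull Φ αY u = αX u) {u : R8} (hu : u ∈ X.P) :
      pull (fun u => Ψ (Φ u)) αZ u = αX u := by
    rw [pull_comp (differentiableAt_of_mem hY hΨ.smooth (hΦ.mapsTo hu))
      (differentiableAt_of_mem hX hΦ.smooth hu), h1 _ (hΦ.mapsTo hu)]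
    exact h2 u hu
  have m {u : R8} (hu : u ∈ X.P) := hΦ.mapsTo hu
  exact
    { smooth := hΨ.smooth.comp hΦ.smooth hΦ.mapsTo
      mapsTo := hΨ.mapsTo.comp hΦ.mapsTo
      proj := fun u hu => by rw [hΨ.proj _ (m hu), hΦ.proj u hu, hχ u hu]
      θ₁ := fun u hu => p hΨ.θ₁ hΦ.θ₁ hu
      θ₂ := fun u hu => p hΨ.θ₂ hΦ.θ₂ hu
      θ₃ := fun u hu => p hΨ.θ₃ hΦ.θ₃ hu
      Ω₂ := fun u hu => p hΨ.Ω₂ hΦ.Ω₂ hu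
      Ω₂b := fun u hu => p hΨ.Ω₂b hΦ.Ω₂b hu
      Ω₃ := fun u hu => p hΨ.Ω₃ hΦ.Ω₃ hu
      Ω₃b := fun u hu => p hΨ.Ω₃b hΦ.Ω₃b hu
      Ω₄ := fun u hu => p hΨ.Ω₄ hΦ.Ω₄ hu
      R := fun u hu => (hΨ.R _ (m hu)).trans (hΦ.R u hu)
      Rb := fun u hu => (hΨ.Rb _ (m hu)).trans (hΦ.Rb u hu)
      S := fun u hu => (hΨ.S _ (m hu)).trans (hΦ.S u hu)
      Sb := fun u hu => (hΨ.Sb _ (m hu)).trans (hΦ.Sb u hu) }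

theorem pull_id (α : R8 → R8 →L[ℝ] ℝ) (u : R8) : pull id α u = α u := by
  rw [pull, fderiv_id]
  rfl

theorem IsMorphism.id (X : CartanData) : IsMorphism X X id id :=
  ⟨contDiffOn_id, mapsTo_id _, fun _ _ => rfl, fun u _ => pull_id _ u, fun u _ => pull_id _ u,
    fun u _ => pull_id _ u, fun u _ => pull_id _ u, fun u _ => pull_id _ u, fun u _ => pull_id _ u,
    fun u _ => pull_id _ u, fun u _ => pull_id _ u, fun _ _ => rfl, fun _ _ => rfl, fun _ _ => rfl,
    fun _ _ => rfl⟩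

/-- The coefficients of a point map are smooth. -/
theorem exists_smooth_coefficients (hi : i ≠ 0) (hU' : IsOpen U') (hQ : ContDiffOn ℝ ∞ Q U)
    (h : IsPointMap i U' Q' U Q φ) :
    ∃ A B Bb C Cb : J1 → ℝ, (∀ f ∈ [A, B, Bb, C, Cb], ContDiffOn ℝ ∞ f U') ∧
      ∀ z ∈ U', A z ≠ 0 ∧ B z ≠ 0 ∧ Bb z ≠ 0 ∧ pull φ (lam i) z = A z • lam i z ∧
        pull φ (mu Q) z = B z • mu Q' z + C z • lam i z ∧
        pull φ mub z = Bb z • mub z + Cb z • lam i z := by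
  obtain ⟨hφ, hm, A, B, Bb, C, Cb, hc⟩ := h
  have s {α : J1 → J1 →L[ℝ] ℝ} (hα : ContDiffOn ℝ ∞ α U) (v : J1) :
      ContDiffOn ℝ ∞ (fun z => pull φ α z v) U' :=
    (contDiffOn_pull hU' hφ hm hα).clm_apply contDiffOn_const
  have sl := s (contDiff_lam i).contDiffOn (Pi.single 1 1)
  have sm := s (contDiffOn_mu hQ)
  have sx := s contDiff_mub.contDiffOn
  have k {r : ℝ} : ContDiffOn ℝ ∞ (fun _ : J1 => r) U' := contDiffOn_const
  have p : ContDiffOn ℝ ∞ (fun z : J1 => z 2) U' := (contDiff_apply ℝ ℝ 2).contDiffOn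
  have sCb : ContDiffOn ℝ ∞ Cb U' :=
    ((k (r := -i⁻¹)).mul (sx (Pi.single 1 1))).congr fun z hz => by
      simp [(hc z hz).2.2.2.2.2, lam_apply, mub_apply]
      field_simp
  refine ⟨A, B, Bb, C, Cb, ?_, hc⟩
  simp only [List.mem_cons, List.not_mem_nil, or_false, forall_eq_or_imp, forall_eq]
  refine ⟨((k (r := -i⁻¹)).mul sl).congr fun z hz => ?_,
    (sm (Pi.single 2 1)).congr fun z hz => ?_,
    ((sx (Pi.single 0 1)).sub (((k (r := i)).mul sCb).mul p)).congr fun z hz => ?_,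
    ((k (r := -i⁻¹)).mul (sm (Pi.single 1 1))).congr fun z hz => ?_, sCb⟩
  · simp [(hc z hz).2.2.2.1, lam_apply]
    field_simp
  · simp [(hc z hz).2.2.2.2.1, lam_apply, mu_apply]
  · simp [(hc z hz).2.2.2.2.2, lam_apply, mub_apply]
    ring
  · simp [(hc z hz).2.2.2.2.1, lam_apply, mu_apply]
    field_simp

/-- A Cartan coframe over `(U', Q')` is also one over `(U, Q)`, for the projection composed with the
point map and suitable new coefficients. -/
theorem IsPointMap.exists_transport (hi : i ≠ 0) (hU' : IsOpen U') (hQ : ContDiffOn ℝ ∞ Q U)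
    (h : IsPointMap i U' Q' U Q φ) (hY : IsCartanCoframe i U' Q' Y) :
    ∃ Z, IsCartanCoframe i U Q Z ∧ Z.P = Y.P ∧
      ∀ X Φ, IsMorphism Z X id Φ ↔ IsMorphism Y X φ Φ := by
  obtain ⟨A, B, Bb, C, Cb, hs, hc⟩ := exists_smooth_coefficients hi hU' hQ h
  obtain ⟨hφ, hm, -⟩ := h
  have sf := hY.smooth_fun
  simp only [List.mem_cons, List.not_mem_nil, or_false, forall_eq_or_imp, forall_eq] at sf hs
  obtain ⟨sa, sb, sbb, sc, scb, sR⟩ := sf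
  obtain ⟨sA, sB, sBb, sC, sCb⟩ := hs
  have s {f : J1 → ℝ} (hf : ContDiffOn ℝ ∞ f U') : ContDiffOn ℝ ∞ (fun u => f (Y.π u)) Y.P :=
    hf.comp hY.smooth_proj hY.mapsTo
  have nA : ∀ u ∈ Y.P, A (Y.π u) ≠ 0 := fun u hu => (hc _ (hY.mapsTo hu)).1
  have nB : ∀ u ∈ Y.P, B (Y.π u) ≠ 0 := fun u hu => (hc _ (hY.mapsTo hu)).2.1
  have nBb : ∀ u ∈ Y.P, Bb (Y.π u) ≠ 0 := fun u hu => (hc _ (hY.mapsTo hu)).2.2.1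
  have hp {α : J1 → J1 →L[ℝ] ℝ} {u : R8} (hu : u ∈ Y.P) (v : R8) :
      pull (fun x => φ (Y.π x)) α u v = pull φ α (Y.π u) (fderiv ℝ Y.π u v) :=
    congrArg (· v) (pull_comp (differentiableAt_of_mem hU' hφ (hY.mapsTo hu))
      (differentiableAt_of_mem hY.isOpen hY.smooth_proj hu) α)
  refine ⟨{ Y with
    π := fun u => φ (Y.π u)
    a := fun u => Y.a u / A (Y.π u)
    b := fun u => Y.b u / B (Y.π u)
    bb := fun u => Y.bb u / Bb (Y.π u)
    c := fun u => (Y.c u - Y.b u / B (Y.π u) * C (Y.π u)) / A (Y.π u)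
    cb := fun u => (Y.cb u - Y.bb u / Bb (Y.π u) * Cb (Y.π u)) / A (Y.π u) },
    { hY with
      smooth_proj := hφ.comp hY.smooth_proj hY.mapsTo
      mapsTo := hm.comp hY.mapsTo
      smooth_fun := ?_
      ne_zero := fun u hu => ⟨div_ne_zero (hY.ne_zero u hu).1 (nA u hu),
        div_ne_zero (hY.ne_zero u hu).2.1 (nB u hu), div_ne_zero (hY.ne_zero u hu).2.2 (nBb u hu)⟩
      θ₁_eq := fun u hu => ?_
      θ₂_eq := fun u hu => ?_
      θ₃_eq := fun u hu => ?_ }, rfl, fun X Φ =>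
    ⟨fun h => ⟨h.smooth, h.mapsTo, h.proj, h.θ₁, h.θ₂, h.θ₃, h.Ω₂, h.Ω₂b, h.Ω₃, h.Ω₃b, h.Ω₄, h.R,
      h.Rb, h.S, h.Sb⟩, fun h => ⟨h.smooth, h.mapsTo, h.proj, h.θ₁, h.θ₂, h.θ₃, h.Ω₂, h.Ω₂b, h.Ω₃,
      h.Ω₃b, h.Ω₄, h.R, h.Rb, h.S, h.Sb⟩⟩⟩
  · simp only [List.mem_cons, List.not_mem_nil, or_false, forall_eq_or_imp, forall_eq]
    have b' := sb.div (s sB) nB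
    have bb' := sbb.div (s sBb) nBb
    exact ⟨sa.div (s sA) nA, b', bb', (sc.sub (b'.mul (s sC))).div (s sA) nA,
      (scb.sub (bb'.mul (s sCb))).div (s sA) nA, sR⟩
  · ext v
    have nA := nA u hu
    have nB := nB u hu
    obtain ⟨-, -, -, h1, h2, -⟩ := hc _ (hY.mapsTo hu)
    refine (congrArg (· v) (hY.θ₁_eq u hu)).trans ?_
    simp only [add_apply, smul_apply, smul_eq_mul, hp hu, h1, h2, pull_apply Y.π]
    field_simp
    ring
  · ext v
    have nA := nA u hu
    have nBb := nBb u hu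
    obtain ⟨-, -, -, h1, -, h2⟩ := hc _ (hY.mapsTo hu)
    refine (congrArg (· v) (hY.θ₂_eq u hu)).trans ?_
    simp only [add_apply, smul_apply, smul_eq_mul, hp hu, h1, h2, pull_apply Y.π]
    field_simp
    ring
  · ext v
    have nA := nA u hu
    obtain ⟨-, -, -, h1, -⟩ := hc _ (hY.mapsTo hu)
    refine (congrArg (· v) (hY.θ₃_eq u hu)).trans ?_
    simp only [smul_apply, smul_eq_mul, hp hu, h1, pull_apply Y.π]
    field_simp

theorem existsUnique_isMorphism (hi : i ≠ 0) (hU : IsOpen U) (hQ : ContDiffOn ℝ ∞ Q U)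
    (hU' : IsOpen U') (h : IsPointMap i U' Q' U Q φ) (hY : IsCartanCoframe i U' Q' Y) :
    ∃ Φ, IsMorphism Y (bundle i U Q) φ Φ ∧
      ∀ Φ', IsMorphism Y (bundle i U Q) φ Φ' → EqOn Φ' Φ Y.P := by
  obtain ⟨Z, hZ, hP, hm⟩ := h.exists_transport hi hU' hQ hY
  obtain ⟨Φ, hΦ⟩ := exists_isMorphism_id hi hU hQ hZ
  exact ⟨Φ, (hm _ _).1 hΦ, fun Φ' hΦ' =>
    hP ▸ isMorphism_id_unique hi hZ ((hm _ _).2 hΦ') hΦ⟩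

/-- The inverse of a diffeomorphic point equivalence is a point equivalence. -/
theorem IsPointMap.inverse (hU : IsOpen U) (hU' : IsOpen U') (h : IsPointMap i U' Q' U Q φ)
    {ψ : J1 → J1} (hψ : ContDiffOn ℝ ∞ ψ U) (hm : MapsTo ψ U U') (hinv : ∀ z ∈ U, φ (ψ z) = z) :
    IsPointMap i U Q U' Q' ψ := by
  obtain ⟨hφ, -, A, B, Bb, C, Cb, hc⟩ := h
  refine ⟨hψ, hm, fun z => (A (ψ z))⁻¹, fun z => (B (ψ z))⁻¹, fun z => (Bb (ψ z))⁻¹,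
    fun z => -((B (ψ z))⁻¹ * C (ψ z) * (A (ψ z))⁻¹),
    fun z => -((Bb (ψ z))⁻¹ * Cb (ψ z) * (A (ψ z))⁻¹), fun z hz => ?_⟩
  obtain ⟨nA, nB, nBb, h1, h2, h3⟩ := hc _ (hm hz)
  have hd := differentiableAt_of_mem hU hψ hz
  have e : (fun x => φ (ψ x)) =ᶠ[nhds z] id := by
    filter_upwards [hU.mem_nhds hz] with x hx using hinv x hx
  have p (α : J1 → J1 →L[ℝ] ℝ) (v : J1) : α z v = pull φ α (ψ z) (fderiv ℝ ψ z v) := by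
    have h4 := congrArg (· v)
      (pull_comp (differentiableAt_of_mem hU' hφ (hm hz)) hd α)
    rw [pull, e.fderiv_eq, fderiv_id, hinv z hz] at h4
    exact h4
  have l (v : J1) := p (lam i) v
  have m (v : J1) := p (mu Q) v
  have x (v : J1) := p mub v
  rw [h1] at l
  rw [h2] at m
  rw [h3] at x
  simp only [add_apply, smul_apply, smul_eq_mul] at l m x
  refine ⟨inv_ne_zero nA, inv_ne_zero nB, inv_ne_zero nBb, ?_, ?_, ?_⟩ <;> ext v
  · simp only [pull_apply, smul_apply, smul_eq_mul, l]
    field_simp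
  · simp only [pull_apply, add_apply, smul_apply, smul_eq_mul, l, m]
    field_simp
    ring
  · simp only [pull_apply, add_apply, smul_apply, smul_eq_mul, l, x]
    field_simp
    ring

theorem exists_isomorphism (hi : i ≠ 0) (hU : IsOpen U) (hQ : ContDiffOn ℝ ∞ Q U)
    (hU' : IsOpen U') (hQ' : ContDiffOn ℝ ∞ Q' U') (h : IsPointMap i U' Q' U Q φ)
    (hφ : IsDiffeoOn φ U' U) :
    ∃ Φ, IsMorphism (bundle i U' Q') (bundle i U Q) φ Φ ∧
      IsDiffeoOn Φ (bundle i U' Q').P (bundle i U Q).P := by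
  obtain ⟨-, -, ψ, hψ, hm, hl, hr⟩ := hφ
  have hX := isCartanCoframe_bundle hi hU hQ
  have hX' := isCartanCoframe_bundle hi hU' hQ'
  obtain ⟨Φ, hΦ, -⟩ := existsUnique_isMorphism hi hU hQ hU' h hX'
  obtain ⟨Ψ, hΨ, -⟩ := existsUnique_isMorphism hi hU' hQ' hU (h.inverse hU hU' hψ hm hr) hX
  refine ⟨Φ, hΦ, hΦ.smooth, hΦ.mapsTo, Ψ, hΨ.smooth, hΨ.mapsTo, fun u hu => ?_, fun u hu => ?_⟩
  · exact isMorphism_id_unique hi hX' (IsMorphism.comp hX'.isOpen hX.isOpen hΨ hΦ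
      fun u hu => hl (hX'.mapsTo hu)) (IsMorphism.id _) hu
  · exact isMorphism_id_unique hi hX (IsMorphism.comp hX.isOpen hX'.isOpen hΦ hΨ
      fun u hu => hr (hX.mapsTo hu)) (IsMorphism.id _) hu

theorem curvature_coefficients (hi : i ≠ 0) {u : R8} (hu : u ∈ total U) :
    (bundle i U Q).R u = -(1 / (6 * i ^ 2 * (bundle i U Q).b u * (bundle i U Q).bb u ^ 3))
      * w₁ Q ((bundle i U Q).π u) ∧
    (bundle i U Q).Rb u = -(1 / (6 * i ^ 2 * (bundle i U Q).b u ^ 3 * (bundle i U Q).bb u))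
      * w₂ Q ((bundle i U Q).π u) := by
  obtain ⟨-, h3, h4⟩ := hu
  simp only [bundle]
  constructor <;> field_simp

end PointMaps

end PointODE

end

open PointODE

theorem theorem2 (i : ℝ) (hi : i ≠ 0) :
    ∃ X : Set J1 → (J1 → ℝ) → CartanData,
      ∀ (U : Set J1) (Q : J1 → ℝ), IsOpen U → ContDiffOn ℝ ∞ Q U →
        -- the coframe, its structure equations, and the equations for `R, R̄, S, S̄`
        IsCartanCoframe i U Q (X U Q) ∧
        InvariantEquations i (X U Q) ∧
        -- the coframe is an `sl(3, ℝ)` Cartan connection on a principal bundle over `U`,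
        -- with the following curvature
        IsCartanConnection i U (X U Q) ∧
        (∀ u ∈ (X U Q).P, curvature i (X U Q) u =
          !![0, (i * (X U Q).Rb u) • ((X U Q).θ₁ u ⋏ (X U Q).θ₃ u),
              (-1 / 2 * (X U Q).Sb u) • ((X U Q).θ₁ u ⋏ (X U Q).θ₃ u)
                + (-1 / 2 * (X U Q).S u) • ((X U Q).θ₂ u ⋏ (X U Q).θ₃ u);
            0, 0, (-1 / 2 * (X U Q).R u) • ((X U Q).θ₂ u ⋏ (X U Q).θ₃ u);
            0, 0, 0]) ∧
        -- uniqueness, given only the class of the equation modulo point transformations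
        (∀ (U' : Set J1) (Q' : J1 → ℝ) (φ : J1 → J1), IsOpen U' → ContDiffOn ℝ ∞ Q' U' →
          IsPointMap i U' Q' U Q φ → ∀ Y : CartanData, IsCartanCoframe i U' Q' Y →
            ∃ Φ : R8 → R8, IsMorphism Y (X U Q) φ Φ ∧
              ∀ Φ' : R8 → R8, IsMorphism Y (X U Q) φ Φ' → EqOn Φ' Φ Y.P) ∧
        -- point equivalent equations have isomorphic bundles
        (∀ (U' : Set J1) (Q' : J1 → ℝ) (φ : J1 → J1), IsOpen U' → ContDiffOn ℝ ∞ Q' U' →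
          IsPointMap i U' Q' U Q φ → IsDiffeoOn φ U' U →
            ∃ Φ : R8 → R8, IsMorphism (X U' Q') (X U Q) φ Φ ∧
              IsDiffeoOn Φ (X U' Q').P (X U Q).P) ∧
        -- the coordinate formulas
        (∃ χ : R8 → R8, IsMorphism (coordData i U Q) (X U Q) id χ ∧
          IsDiffeoOn χ (coordData i U Q).P
            {u | u ∈ (X U Q).P ∧ 0 < (X U Q).b u * (X U Q).bb u}) ∧
        -- `R` and `R̄` are proportional to `w₁` and `w₂`
        (∀ u ∈ (X U Q).P,
          (X U Q).R u = -(1 / (6 * i ^ 2 * (X U Q).b u * (X U Q).bb u ^ 3))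
            * w₁ Q ((X U Q).π u) ∧
          (X U Q).Rb u = -(1 / (6 * i ^ 2 * (X U Q).b u ^ 3 * (X U Q).bb u))
            * w₂ Q ((X U Q).π u)) := by
  refine ⟨fun U Q => bundle i U Q, fun U Q hU hQ => ⟨isCartanCoframe_bundle hi hU hQ,
    invariantEquations_bundle hi hU hQ, isCartanConnection_bundle hi hU,
    fun u hu => curvature_bundle hi hU hQ hu,
    fun U' Q' φ hU' _ h Y hY => existsUnique_isMorphism hi hU hQ hU' h hY,
    fun U' Q' φ hU' hQ' h hφ => exists_isomorphism hi hU hQ hU' hQ' h hφ,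
    ⟨chart i Q, isMorphism_chart hi hU hQ, isDiffeoOn_chart hi hU hQ⟩,
    fun u hu => curvature_coefficients hi hu⟩⟩
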